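/- Let $K$ be a field and let $\mathcal C$ be a (small) graded $K$-category: each $\operatorname{Hom}_{\mathcal C}(X,Y)=\bigoplus_{i\in\mathbb Z}\operatorname{Hom}_{\mathcal C}(X,Y)_i$ is a graded $K$-vector space, identities have degree $0$, and composition is $K$-bilinear and adds degrees. Let $\operatorname{Gr}(\mathcal C)$ be the abelian category of graded $K$-linear functors from $\mathcal C^{\mathrm{op}}$ to graded $K$-vector spaces, with natural transformations of degree $0$. A functor in $\operatorname{Gr}(\mathcal C)$ is finitely generated if it is a quotient of a finite direct sum of shifts $\operatorname{Hom}_{\mathcal C}(-,X)[j]$, and finitely presented if it is such a quotient with finitely generated kernel. Projective dimension, $\operatorname{Ext}$, simplicity and length are taken in $\operatorname{Gr}(\mathcal C)$. For $F$ in $\operatorname{Gr}(\mathcal C)$ let $\operatorname{tr}^i(F)$ in $\operatorname{Gr}(\mathcal C^{\mathrm{op}})$ be the functor $X\mapsto\bigoplus_{j}\operatorname{Ext}^i(F,\operatorname{Hom}_{\mathcal C}(-,X)[j])$. For $n\ge 1$ let $\mathcal H^n_{\mathcal C}$ consist of the $F$ of projective dimension $n$ that have a projective resolution by finitely generated functors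 and satisfy $\operatorname{tr}^i(F)=0$ for all $i\ne n$; define $\mathcal H^n_{\mathcal C^{\mathrm{op}}}$ in the same way. Let $t^n(F)\subseteq F$ be the sum of all subfunctors of $F$ that have finite length with all composition factors simple functors in $\mathcal H^n_{\mathcal C}$. The graded category $\mathcal C$ is generalized Artin–Schelter regular of dimension $n$ if: every object is a finite direct sum, in degree $0$, of objects whose rings of degree-$0$ endomorphisms are local (Krull–Schmidt); $\operatorname{Gr}(\mathcal C)$ has global dimension $n$; either every finitely generated functor in $\operatorname{Gr}(\mathcal C)$ is Noetherian, or $\mathcal C$ is positively graded and its graded radical is $\operatorname{Hom}_{\mathcal C}(-,-)_{\ge 1}$; and every simple functor $S$ of projective dimension $n$ in $\operatorname{Gr}(\mathcal C)$ (respectively $\operatorname{Gr}(\mathcal C^{\mathrm{op}})$) lies in $\mathcal H^n_{\mathcal C}$ (respectively $\mathcal H^n_{\mathcal C^{\mathrm{op}}}$), and $\operatorname{tr}^n(S)$ has a simple subfunctor lying in $\mathcal H^n_{\mathcal C^{\mathrm{op}}}$ (respectively $\mathcal H^n_{\mathcal C}$). **Theorem.** Let $\mathcal C$ be a generalized Artin–Schelter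 regular graded $K$-category of (global) dimension $2$ that is positively graded ($\operatorname{Hom}_{\mathcal C}(X,Y)_i=0$ for $i<0$), locally finite (all $\operatorname{Hom}_{\mathcal C}(X,Y)_i$ are finite dimensional) and generated in degrees $0$ and $1$ (every morphism is a sum of compositions of morphisms of degrees $0$ and $1$). Then: (a) for every finitely presented functor $F$ in $\operatorname{Gr}(\mathcal C)$, the functor $t^2(F)$ has finite length; (b) $\mathcal C$ is coherent: every finitely generated subfunctor of a finitely generated projective functor in $\operatorname{Gr}(\mathcal C)$ is finitely presented; (c) the category of finitely presented functors in $\operatorname{Gr}(\mathcal C)$ is abelian. -/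

import Mathlib

open CategoryTheory CategoryTheory.Limits Opposite

universe w u

namespace GradedAS

noncomputable section

/-! ## Linear functors on a linear category

For a small `K`-linear category `A`, `LinFun K A` is the category of all `K`-linear functors
`A ⥤ Mod K`. -/

section LinFun

variable (K : Type w) [Field K] (A : Type u) [SmallCategory A] [Preadditive A] [Linear K A]

/-- The additive `K`-linear functors from `A` to `K`-vector spaces. -/
def isLinearFunctor : ObjectProperty (A ⥤ ModuleCat.{u} K) :=
  fun F => F.Additive ∧ Functor.Linear K F

/-- The category of `K`-linear functors from `A` to `K`-vector spaces. -/
abbrev LinFun : Type (max w (u + 1)) := (isLinearFunctor K A).FullSubcategory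

variable {K A}

theorem isLinearFunctor_of_mono_family {ι : Type*} {F : A ⥤ ModuleCat.{u} K}
    (G : ι → (A ⥤ ModuleCat.{u} K)) (hG : ∀ i, isLinearFunctor K A (G i))
    (p : ∀ i, F ⟶ G i)
    (hp : ∀ (a : A) (M : ModuleCat.{u} K) (x y : M ⟶ F.obj a),
      (∀ i, x ≫ (p i).app a = y ≫ (p i).app a) → x = y) :
    isLinearFunctor K A F := by
  constructor
  · constructor
    intro X Y f g
    apply hp
    intro i
    have := (hG i).1
    simp [NatTrans.naturality, Functor.map_add]
  · constructor
    intro X Y f r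
    apply hp
    intro i
    have := (hG i).1
    have := (hG i).2
    simp [NatTrans.naturality, Functor.map_smul]

theorem isLinearFunctor_of_epi_family {ι : Type*} {F : A ⥤ ModuleCat.{u} K}
    (G : ι → (A ⥤ ModuleCat.{u} K)) (hG : ∀ i, isLinearFunctor K A (G i))
    (p : ∀ i, G i ⟶ F)
    (hp : ∀ (a : A) (M : ModuleCat.{u} K) (x y : F.obj a ⟶ M),
      (∀ i, (p i).app a ≫ x = (p i).app a ≫ y) → x = y) :
    isLinearFunctor K A F := by
  constructor
  · constructor
    intro X Y f g
    apply hp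
    intro i
    have := (hG i).1
    simp [← NatTrans.naturality, Functor.map_add]
  · constructor
    intro X Y f r
    apply hp
    intro i
    have := (hG i).1
    have := (hG i).2
    simp [← NatTrans.naturality, Functor.map_smul]

instance (J : Type*) [Category J] [HasLimitsOfShape J (ModuleCat.{u} K)] :
    (isLinearFunctor K A).IsClosedUnderLimitsOfShape J where
  limitsOfShape_le := by
    rintro F ⟨h⟩
    refine isLinearFunctor_of_mono_family h.diag.obj h.prop_diag_obj h.π.app ?_
    intro a M x y hxy
    exact (isLimitOfPreserves ((evaluation _ _).obj a) h.isLimit).hom_ext hxy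

instance (J : Type*) [Category J] [HasColimitsOfShape J (ModuleCat.{u} K)] :
    (isLinearFunctor K A).IsClosedUnderColimitsOfShape J where
  colimitsOfShape_le := by
    rintro F ⟨h⟩
    refine isLinearFunctor_of_epi_family h.diag.obj h.prop_diag_obj h.ι.app ?_
    intro a M x y hxy
    exact (isColimitOfPreserves ((evaluation _ _).obj a) h.isColimit).hom_ext hxy

instance : (isLinearFunctor K A).IsClosedUnderKernels where
  kernels_le := by
    rintro _ ⟨f, k, hk, hf⟩
    refine isLinearFunctor_of_mono_family (fun _ : Unit => _) (fun _ => hf.1)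
      (fun _ => k.ι) ?_
    intro a M x y hxy
    have := mono_of_isLimit_fork hk
    exact (cancel_mono ((Fork.ι k).app a)).1 (hxy ())

instance : (isLinearFunctor K A).IsClosedUnderCokernels where
  cokernels_le := by
    rintro _ ⟨f, k, hk, hf⟩
    refine isLinearFunctor_of_epi_family (fun _ : Unit => _) (fun _ => hf.2)
      (fun _ => k.π) ?_
    intro a M x y hxy
    have := epi_of_isColimit_cofork hk
    exact (cancel_epi ((Cofork.π k).app a)).1 (hxy ())

instance : (isLinearFunctor K A).IsClosedUnderFiniteProducts where
  isClosedUnderLimitsOfShape _ _ := inferInstance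

instance : HasCoproducts.{u} (LinFun K A) := fun _ => inferInstance

/-- The functor `h^a = Hom_A(a, -)`. -/
def corep (a : A) : LinFun K A :=
  ⟨(linearCoyoneda K A).obj (op a), inferInstance, ⟨by
    intro b c f r
    ext (g : a ⟶ b)
    exact Linear.comp_smul _ _ _ g r f⟩⟩

/-- The natural transformation `h^b ⟶ h^a` given by composition with `f : a ⟶ b`. -/
def corepMap {a b : A} (f : a ⟶ b) : corep (K := K) b ⟶ corep a :=
  ObjectProperty.homMk ((linearCoyoneda K A).map f.op)

/-- Yoneda: the natural transformation `h^a ⟶ F` given by an element of `F(a)`. -/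
def ofElement (F : LinFun K A) (a : A) (x : F.obj.obj a) : corep a ⟶ F :=
  ObjectProperty.homMk
    { app := fun b => @ModuleCat.ofHom K _ (a ⟶ b) (F.obj.obj b) _ _ _ _
        { toFun := fun g => (F.obj.map g).hom x
          map_add' := fun g h => by
            have := F.property.1
            simp [Functor.map_add]
          map_smul' := fun r g => by
            have := F.property.1
            have := F.property.2
            simp [Functor.map_smul] }
      naturality := fun b c f => by
        ext (g : a ⟶ b)
        change (F.obj.map (g ≫ f)).hom x = (F.obj.map f).hom ((F.obj.map g).hom x)
        simp }

theorem ofElement_id (F : LinFun K A) (a : A) (x : F.obj.obj a) :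
    ((ofElement F a x).hom.app a).hom (𝟙 a : a ⟶ a) = x := by
  change (F.obj.map (𝟙 a)).hom x = x
  simp

theorem corep_hom_ext {F : LinFun K A} {a : A} (f g : corep a ⟶ F)
    (h : (f.hom.app a).hom (𝟙 a : a ⟶ a) = (g.hom.app a).hom (𝟙 a : a ⟶ a)) : f = g := by
  ext b (t : a ⟶ b)
  have hf := ConcreteCategory.congr_hom (f.hom.naturality t) (𝟙 a : a ⟶ a)
  have hg := ConcreteCategory.congr_hom (g.hom.naturality t) (𝟙 a : a ⟶ a)
  have e : ((corep (K := K) a).obj.map t).hom (𝟙 a : a ⟶ a) = t := Category.id_comp t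
  change (f.hom.app b).hom (((corep (K := K) a).obj.map t).hom (𝟙 a : a ⟶ a)) = _ at hf
  change (g.hom.app b).hom (((corep (K := K) a).obj.map t).hom (𝟙 a : a ⟶ a)) = _ at hg
  rw [e] at hf hg
  rw [hf, hg]
  exact congrArg _ h

variable (K A) in
theorem isSeparating_corep :
    ObjectProperty.IsSeparating (.ofObj (corep (K := K) (A := A))) := by
  intro F G f g h
  ext a x
  have := congrArg (fun t => (t.hom.app a).hom (𝟙 a : a ⟶ a)) (h _ ⟨a⟩ (ofElement F a x))
  change (f.hom.app a).hom (((ofElement F a x).hom.app a).hom (𝟙 a : a ⟶ a)) =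
    (g.hom.app a).hom (((ofElement F a x).hom.app a).hom (𝟙 a : a ⟶ a)) at this
  rwa [ofElement_id] at this

instance : WellPowered.{u} (LinFun K A) :=
  wellPowered_of_isDetecting (isSeparating_corep K A).isDetecting

instance (a : A) : Projective (corep (K := K) a) where
  factors {E X} f e he := by
    have := (isLinearFunctor K A).preservesEpimorphisms_ι_of_isNormalMonoCategory
    have h1 : Epi e.hom := inferInstanceAs (Epi ((isLinearFunctor K A).ι.map e))
    have h2 : Epi (e.hom.app a) := inferInstance
    obtain ⟨y, hy⟩ := (ModuleCat.epi_iff_surjective _).1 h2 ((f.hom.app a).hom (𝟙 a : a ⟶ a))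
    refine ⟨ofElement E a y, corep_hom_ext _ _ ?_⟩
    change (e.hom.app a).hom (((ofElement E a y).hom.app a).hom (𝟙 a : a ⟶ a)) = _
    rw [ofElement_id]
    exact hy

instance : EnoughProjectives (LinFun K A) where
  presentation F :=
    have : HasColimitsOfShape (Discrete (Σ a : A, F.obj.obj a)) (LinFun K A) := inferInstance
    ⟨{
      p := ∐ fun x : (Σ a : A, F.obj.obj a) => corep x.1
      f := Sigma.desc fun x => ofElement F x.1 x.2
      epi := ⟨fun f g h => by
        ext a x
        have h1 := congrArg
          (fun t => Sigma.ι (fun x : (Σ a : A, F.obj.obj a) => corep (K := K) x.1) ⟨a, x⟩ ≫ t) h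
        simp only [Sigma.ι_desc_assoc] at h1
        have := congrArg (fun t => (t.hom.app a).hom (𝟙 a : a ⟶ a)) h1
        change (f.hom.app a).hom (((ofElement F a x).hom.app a).hom (𝟙 a : a ⟶ a)) =
          (g.hom.app a).hom (((ofElement F a x).hom.app a).hom (𝟙 a : a ⟶ a)) at this
        rwa [ofElement_id] at this⟩ }⟩

instance : HasExt.{u} (LinFun K A) := hasExt_of_enoughProjectives _

/-- The opposite of a `K`-linear category is `K`-linear. -/
instance : Linear K Aᵒᵖ where
  homModule _ _ :=
    { smul := fun r f => (r • f.unop).op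
      one_smul := fun f => Quiver.Hom.unop_inj (one_smul K f.unop)
      mul_smul := fun r s f => Quiver.Hom.unop_inj (mul_smul r s f.unop)
      smul_zero := fun r => Quiver.Hom.unop_inj (smul_zero r)
      smul_add := fun r f g => Quiver.Hom.unop_inj (smul_add r f.unop g.unop)
      add_smul := fun r s f => Quiver.Hom.unop_inj (add_smul r s f.unop)
      zero_smul := fun f => Quiver.Hom.unop_inj (zero_smul K f.unop) }
  smul_comp _ _ _ r f g := Quiver.Hom.unop_inj (Linear.comp_smul _ _ _ g.unop r f.unop)
  comp_smul _ _ _ f r g := Quiver.Hom.unop_inj (Linear.smul_comp _ _ _ r g.unop f.unop)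

theorem corepMap_id (a : A) : corepMap (K := K) (𝟙 a) = 𝟙 (corep a) := by
  ext b (t : a ⟶ b)
  exact Category.id_comp t

theorem corepMap_comp {a b c : A} (f : a ⟶ b) (g : b ⟶ c) :
    corepMap (K := K) (f ≫ g) = corepMap g ≫ corepMap f := by
  ext d (t : c ⟶ d)
  exact Category.assoc f g t

theorem corepMap_add {a b : A} (f g : a ⟶ b) :
    corepMap (K := K) (f + g) = corepMap f + corepMap g := by
  ext d (t : b ⟶ d)
  exact Preadditive.add_comp _ _ _ f g t

theorem corepMap_smul {a b : A} (r : K) (f : a ⟶ b) :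
    corepMap (K := K) (r • f) = r • corepMap f := by
  ext d (t : b ⟶ d)
  exact Linear.smul_comp _ _ _ r f t

/-- `tr^n(F)`: the functor `a ↦ Ext^n(F, Hom_A(a, -))` on `Aᵒᵖ`. -/
def tr (n : ℕ) (F : LinFun K A) : LinFun K Aᵒᵖ :=
  ⟨{ obj := fun a => ModuleCat.of K (Abelian.Ext.{u} F (corep a.unop) n)
     map := fun f => ModuleCat.ofHom
       (Abelian.Ext.postcompOfLinear (Abelian.Ext.mk₀ (corepMap f.unop)) K F (add_zero n))
     map_id := fun a => by
       ext x
       simp [corepMap_id]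
     map_comp := fun f g => by
       ext x
       simp [corepMap_comp, ← Abelian.Ext.mk₀_comp_mk₀] },
    ⟨by
      intro a b f g
      ext x
      simp [corepMap_add, Abelian.Ext.mk₀_add]⟩,
    ⟨by
      intro a b f r
      have h : (r • f).unop = r • f.unop := rfl
      ext x
      simp [h, corepMap_smul, Abelian.Ext.mk₀_smul]⟩⟩

/-! ### Finiteness conditions -/

/-- `F` is finitely generated: a quotient of a finite direct sum of functors `Hom_A(a, -)`. -/
def FinGen : ObjectProperty (LinFun K A) := fun F =>
  ∃ (m : ℕ) (a : Fin m → A) (p : (∐ fun k => corep (K := K) (a k)) ⟶ F), Epi p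

/-- `F` is finitely presented: a quotient of a finite direct sum of functors `Hom_A(a, -)` by a
finitely generated subfunctor. -/
def FinPres : ObjectProperty (LinFun K A) := fun F =>
  ∃ (m : ℕ) (a : Fin m → A) (p : (∐ fun k => corep (K := K) (a k)) ⟶ F),
    Epi p ∧ FinGen (kernel p)

/-- `F` has a finite filtration (composition series) with all factors in `P`. -/
inductive FiniteFiltration (P : ObjectProperty (LinFun K A)) : LinFun K A → Prop
  | zero (F : LinFun K A) (hF : IsZero F) : FiniteFiltration P F
  | step (S : ShortComplex (LinFun K A)) (hS : S.ShortExact)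
      (h₁ : FiniteFiltration P S.X₁) (h₃ : P S.X₃) : FiniteFiltration P S.X₂

/-- `F` has finite length: it has a finite composition series with simple factors. -/
def FiniteLength (F : LinFun K A) : Prop :=
  FiniteFiltration (fun S => Simple S) F

/-! ### The subcategory `H^n` and the functor `t^n` -/

/-- `H^n`: the functors `F` of projective dimension `n` having a projective resolution by finitely
generated functors, with `tr^i(F) = 0` for all `i ≠ n`. -/
def InH (n : ℕ) : ObjectProperty (LinFun K A) := fun F =>
  projectiveDimension F = n ∧
  (∃ P : ProjectiveResolution F, ∀ i, FinGen (P.complex.X i)) ∧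
  ∀ i, i ≠ n → IsZero (tr i F)

/-- The simple functors that belong to `H^n`. -/
def SimpleInH (n : ℕ) : ObjectProperty (LinFun K A) := fun S =>
  Simple S ∧ InH n S

/-- `t^n(F)`: the sum of all subfunctors of `F` of finite length with all composition factors
simple functors in `H^n`. -/
def torsion (n : ℕ) (F : LinFun K A) : Subobject F :=
  sSup {L | FiniteFiltration (SimpleInH n) (L : LinFun K A)}

/-! ### Global dimension, the Noetherian condition and coherence -/

variable (K A)

/-- The (projective) global dimension of `LinFun K A`. -/
def globalDimension : WithBot ℕ∞ := ⨆ F : LinFun K A, projectiveDimension F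

/-- Every finitely generated functor is Noetherian. -/
def IsNoetherianCat : Prop :=
  ∀ F : LinFun K A, FinGen F → IsNoetherianObject F

/-- Every finitely generated subfunctor of a finitely generated projective functor is finitely
presented. -/
def IsCoherentCat : Prop :=
  ∀ (P : LinFun K A) (L : Subobject P), Projective P → FinGen P →
    FinGen (L : LinFun K A) → FinPres (L : LinFun K A)

/-- Every simple functor `S` on `A` of projective dimension `n` is in `H^n`, and `tr^n(S)`, a
functor on `Aᵒᵖ`, has a simple subfunctor that is in `H^n`. -/
def SimplesRegular (n : ℕ) : Prop :=
  ∀ S : LinFun K A, Simple S → projectiveDimension S = n →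
    InH n S ∧ ∃ T : Subobject (tr n S), SimpleInH n (T : LinFun K Aᵒᵖ)

end LinFun

/-! ## Graded categories -/

section Graded

/-- A `ℤ`-grading on a `K`-linear category `C`: each `Hom_C(X, Y)` is the direct sum of subspaces
`Hom_C(X, Y)_i`, identities have degree `0`, and degrees add under composition. -/
structure HomGrading (K : Type w) [Field K] (C : Type u) [SmallCategory C] [Preadditive C]
    [Linear K C] where
  deg : ∀ X Y : C, ℤ → Submodule K (X ⟶ Y)
  isInternal : ∀ X Y : C, DirectSum.IsInternal (deg X Y)
  id_mem : ∀ X : C, 𝟙 X ∈ deg X X 0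
  comp_mem : ∀ {X Y Z : C} {i j : ℤ} {f : X ⟶ Y} {g : Y ⟶ Z},
    f ∈ deg X Y i → g ∈ deg Y Z j → f ≫ g ∈ deg X Z (i + j)

variable {K : Type w} [Field K] {C : Type u} [SmallCategory C] [Preadditive C] [Linear K C]

namespace HomGrading

/-- The category of shifts `(X, i)` of objects of `C`; a morphism `(X, i) ⟶ (Y, j)` is a
homogeneous morphism `X ⟶ Y` of degree `j - i`. -/
@[ext]
structure Shifted (G : HomGrading K C) : Type u where
  obj : C
  shift : ℤ

variable (G : HomGrading K C)

instance : SmallCategory G.Shifted where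
  Hom P Q := G.deg P.obj Q.obj (Q.shift - P.shift)
  id P := ⟨𝟙 P.obj, by simpa using G.id_mem P.obj⟩
  comp {P Q R} f g := ⟨f.1 ≫ g.1, by
    have h := G.comp_mem f.2 g.2
    rwa [sub_add_sub_cancel'] at h⟩
  id_comp f := Subtype.ext (Category.id_comp f.1)
  comp_id f := Subtype.ext (Category.comp_id f.1)
  assoc f g h := Subtype.ext (Category.assoc f.1 g.1 h.1)

instance : Preadditive G.Shifted where
  homGroup P Q := inferInstanceAs (AddCommGroup (G.deg P.obj Q.obj (Q.shift - P.shift)))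
  add_comp _ _ _ f g h := Subtype.ext (Preadditive.add_comp _ _ _ f.1 g.1 h.1)
  comp_add _ _ _ f g h := Subtype.ext (Preadditive.comp_add _ _ _ f.1 g.1 h.1)

instance : Linear K G.Shifted where
  homModule P Q := inferInstanceAs (Module K (G.deg P.obj Q.obj (Q.shift - P.shift)))
  smul_comp _ _ _ r f g := Subtype.ext (Linear.smul_comp _ _ _ r f.1 g.1)
  comp_smul _ _ _ f r g := Subtype.ext (Linear.comp_smul _ _ _ f.1 r g.1)

/-- The category of graded functors from `Cᵒᵖ` to graded `K`-vector spaces, with natural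
transformations of degree `0`: such a functor `M` is the `K`-linear functor
`(X, -i) ↦ M(X)_i` on `G.Shiftedᵒᵖ`, a homogeneous `f : X' ⟶ X` of degree `j` inducing
`M(X)_i ⟶ M(X')_{i+j}`. The functor `Hom_C(-, Y)` and its shifts are the `corep (op (Y, j))`. -/
abbrev Gr : Type (max w (u + 1)) := LinFun K G.Shiftedᵒᵖ

/-- The category of graded `Cᵒᵖ`-modules, that is, of graded functors from `C` to graded
`K`-vector spaces: such a functor `N` is the `K`-linear functor `(X, i) ↦ N(X)_i` on
`G.Shifted`. -/
abbrev GrOp : Type (max w (u + 1)) := LinFun K G.Shifted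

/-- There are no nonzero morphisms of negative degree. -/
def IsPositivelyGraded : Prop := ∀ (X Y : C) (i : ℤ), i < 0 → G.deg X Y i = ⊥

/-- All homogeneous components of the morphism spaces are finite dimensional. -/
def IsLocallyFinite : Prop := ∀ (X Y : C) (i : ℤ), FiniteDimensional K (G.deg X Y i)

/-- The morphisms that are sums of compositions of morphisms of degrees `0` and `1`. -/
inductive GeneratedHom : ∀ {X Y : C}, (X ⟶ Y) → Prop
  | zero {X Y : C} (f : X ⟶ Y) (hf : f ∈ G.deg X Y 0) : GeneratedHom f
  | one {X Y : C} (f : X ⟶ Y) (hf : f ∈ G.deg X Y 1) : GeneratedHom f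
  | add {X Y : C} (f g : X ⟶ Y) (hf : GeneratedHom f) (hg : GeneratedHom g) :
      GeneratedHom (f + g)
  | comp {X Y Z : C} (f : X ⟶ Y) (g : Y ⟶ Z) (hf : GeneratedHom f) (hg : GeneratedHom g) :
      GeneratedHom (f ≫ g)

/-- The category is generated in degrees `0` and `1`. -/
def IsGeneratedInDegreesZeroOne : Prop := ∀ (X Y : C) (f : X ⟶ Y), G.GeneratedHom f

/-- The graded category is Krull-Schmidt: by morphisms of degree `0`, every object is a finite
direct sum of objects whose rings of degree `0` endomorphisms are local. -/
def IsKrullSchmidt : Prop :=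
  ∀ X : C, ∃ (m : ℕ) (Y : Fin m → C)
    (ι : ∀ k, (⟨Y k, 0⟩ : G.Shifted) ⟶ ⟨X, 0⟩) (π : ∀ k, (⟨X, 0⟩ : G.Shifted) ⟶ ⟨Y k, 0⟩),
    (∀ k, IsLocalRing (End (⟨Y k, 0⟩ : G.Shifted))) ∧
    (∀ k, ι k ≫ π k = 𝟙 _) ∧ (∀ k l, k ≠ l → ι k ≫ π l = 0) ∧
    ∑ k, π k ≫ ι k = 𝟙 _

/-- The homogeneous component of degree `i` of the graded radical of the category: the morphisms
`f : X ⟶ Y` of degree `i` such that `1 - gf` is invertible in `End(X)` for all `g : Y ⟶ X` of degree `-i`. -/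
def radDeg (X Y : C) (i : ℤ) : Set (X ⟶ Y) :=
  {f | f ∈ G.deg X Y i ∧ ∀ g ∈ G.deg Y X (-i), IsIso (𝟙 X - f ≫ g)}

/-- The graded radical is `Hom_C(-, -)_{≥ 1}`. -/
def RadicalEqPositivePart : Prop :=
  ∀ X Y : C, Submodule.span K (⋃ i, G.radDeg X Y i) = ⨆ i : {i : ℤ // 1 ≤ i}, G.deg X Y i

/-- The graded category `C` is generalized Artin-Schelter regular of dimension `n`. -/
structure IsGeneralizedASRegular (n : ℕ) : Prop where
  krullSchmidt : G.IsKrullSchmidt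
  globalDimension_eq : globalDimension K G.Shiftedᵒᵖ = n
  noetherian_or_radical : IsNoetherianCat K G.Shiftedᵒᵖ ∨
    (G.IsPositivelyGraded ∧ G.RadicalEqPositivePart)
  simples : SimplesRegular K G.Shiftedᵒᵖ n
  simples_op : SimplesRegular K G.Shifted n

end HomGrading

end Graded
end
end GradedAS

/-! If finitely generated functors are Noetherian, every subfunctor of one is finitely generated and
all claims follow quickly. The substance is the other case, where the graded radical is the part of
positive degree. Write `t` for `t²` and `D_E = Hom_K(-, E)` for a vector space `E`.

Everything rests on one estimate (`hasProjectiveDimensionLE_quot`): for finitely generated `F`, the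
quotient `F/tF` has projective dimension at most one. Granting it, let `F` be finitely presented, `P
→ F` a finitely generated projective cover with finitely generated kernel `M`, and `M'` the kernel
of `P → F/tF`. Then `M'` is projective and is an extension of `tF` by `M`. Simple functors in `H²`
have no nonzero morphisms to representable functors, so neither has `tF`; a splitting of `M'` off a
coproduct of representables therefore only meets the finitely many summands already met by `M`, and
`M'` is finitely generated (`finGen_of_projective_of_hom_eq_zero`). Hence `tF` is finitely generated
and has finite length. For coherence take `F = P/L`: then `L` is the kernel of `M' → tF`, and `tF`
is filtered by simple functors with finitely presented syzygies, so `L` is finitely presented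
(`FiniteFiltration.finPres_kernel`). Coherence gives (c) formally.

The estimate is proved by testing. A functor bounded below has projective dimension at most `m` as
soon as `Ext^(m+1)` into enough functors concentrated in one degree vanishes
(`IsPositive.hasProjectiveDimensionLE`), and the functors `D_E T`, with `T` the simple top of a
representable on the opposite side, are enough. By duality, `Ext²(F/tF, D_E T) = 0` is equivalent to
`Ext²(T, D_E(F/tF)) = 0` (`ext_dual_eq_zero_iff`). This is clear if `T` has projective dimension at
most one. Otherwise regularity provides a simple `S` in `H²` inside `tr²(T)`, and `T` is then the
cokernel of the dual of the last map in a resolution of `S` (`iso_dual_cokernel`). Computed with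
that dual resolution, `Ext²(T, D_E(F/tF))` vanishes because `Hom(S, F/tF) = 0` (`ext_two_eq_zero`),
and `F/tF` has no simple subfunctors in `H²` (`hom_quot_torsionSub_eq_zero`). -/

open CategoryTheory CategoryTheory.Limits Opposite ZeroObject

namespace GradedAS

noncomputable section

/-! ## Elements of linear functors -/

section Elements

variable {K : Type w} [Field K] {A : Type u} [SmallCategory A] [Preadditive A] [Linear K A]

/-- The action of a morphism on the elements of a functor. -/
def act (F : LinFun K A) {a b : A} (f : a ⟶ b) : F.obj.obj a →ₗ[K] F.obj.obj b :=
  (F.obj.map f).hom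

/-- The components of a natural transformation as linear maps. -/
def ev {F G : LinFun K A} (f : F ⟶ G) (a : A) : F.obj.obj a →ₗ[K] G.obj.obj a :=
  (f.hom.app a).hom

@[simp] theorem act_id (F : LinFun K A) (a : A) (x : F.obj.obj a) : act F (𝟙 a) x = x := by
  simp [act]

@[simp] theorem act_comp (F : LinFun K A) {a b c : A} (f : a ⟶ b) (g : b ⟶ c)
    (x : F.obj.obj a) : act F (f ≫ g) x = act F g (act F f x) := by
  simp [act]

theorem act_add (F : LinFun K A) {a b : A} (f g : a ⟶ b) (x : F.obj.obj a) :
    act F (f + g) x = act F f x + act F g x := by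
  have := F.property.1
  simp [act, Functor.map_add]

theorem act_smul (F : LinFun K A) {a b : A} (r : K) (f : a ⟶ b) (x : F.obj.obj a) :
    act F (r • f) x = r • act F f x := by
  have := F.property.1
  have := F.property.2
  simp [act, Functor.map_smul]

/-- The action of morphisms on a fixed element, as a linear map. -/
def orbit (F : LinFun K A) {a : A} (x : F.obj.obj a) (b : A) : (a ⟶ b) →ₗ[K] F.obj.obj b where
  toFun f := act F f x
  map_add' f g := act_add F f g x
  map_smul' r f := act_smul F r f x

@[simp] theorem orbit_apply (F : LinFun K A) {a : A} (x : F.obj.obj a) {b : A} (f : a ⟶ b) :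
    orbit F x b f = act F f x := rfl

@[simp] theorem act_zero (F : LinFun K A) {a b : A} (x : F.obj.obj a) :
    act F (0 : a ⟶ b) x = 0 := (orbit F x b).map_zero

theorem act_sum (F : LinFun K A) {a b : A} {ι : Type*} (s : Finset ι) (f : ι → (a ⟶ b))
    (x : F.obj.obj a) : act F (∑ i ∈ s, f i) x = ∑ i ∈ s, act F (f i) x :=
  map_sum (orbit F x b) f s

@[simp] theorem ev_id (F : LinFun K A) (a : A) (x : F.obj.obj a) : ev (𝟙 F) a x = x := rfl

@[simp] theorem ev_comp {F G H : LinFun K A} (f : F ⟶ G) (g : G ⟶ H) (a : A)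
    (x : F.obj.obj a) : ev (f ≫ g) a x = ev g a (ev f a x) := rfl

@[simp] theorem ev_zero {F G : LinFun K A} (a : A) (x : F.obj.obj a) :
    ev (0 : F ⟶ G) a x = 0 := rfl

@[simp] theorem ev_add {F G : LinFun K A} (f g : F ⟶ G) (a : A) (x : F.obj.obj a) :
    ev (f + g) a x = ev f a x + ev g a x := rfl

@[simp] theorem ev_sub {F G : LinFun K A} (f g : F ⟶ G) (a : A) (x : F.obj.obj a) :
    ev (f - g) a x = ev f a x - ev g a x := rfl

/-- Evaluation of natural transformations at an element, as a linear map. -/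
def evAt {F : LinFun K A} {a : A} (x : F.obj.obj a) (G : LinFun K A) :
    (F ⟶ G) →ₗ[K] G.obj.obj a where
  toFun f := ev f a x
  map_add' _ _ := rfl
  map_smul' _ _ := rfl

theorem ev_sum {F G : LinFun K A} {ι : Type*} (s : Finset ι) (f : ι → (F ⟶ G)) (a : A)
    (x : F.obj.obj a) : ev (∑ i ∈ s, f i) a x = ∑ i ∈ s, ev (f i) a x :=
  map_sum (evAt x G) f s

theorem ev_act {F G : LinFun K A} (f : F ⟶ G) {a b : A} (g : a ⟶ b) (x : F.obj.obj a) :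
    ev f b (act F g x) = act G g (ev f a x) :=
  ConcreteCategory.congr_hom (f.hom.naturality g) x

theorem hom_ext' {F G : LinFun K A} {f g : F ⟶ G} (h : ∀ a x, ev f a x = ev g a x) : f = g := by
  ext a x
  exact h a x

/-- A natural transformation from its components. -/
def mkHom {F G : LinFun K A} (φ : ∀ a, F.obj.obj a →ₗ[K] G.obj.obj a)
    (h : ∀ {a b : A} (f : a ⟶ b) (x : F.obj.obj a), φ b (act F f x) = act G f (φ a x)) : F ⟶ G :=
  ObjectProperty.homMk
    { app := fun a => ModuleCat.ofHom (φ a)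
      naturality := fun a b f => by
        ext x
        exact h f x }

@[simp] theorem ev_mkHom {F G : LinFun K A} (φ : ∀ a, F.obj.obj a →ₗ[K] G.obj.obj a)
    (h : ∀ {a b : A} (f : a ⟶ b) (x : F.obj.obj a), φ b (act F f x) = act G f (φ a x)) (a : A)
    (x : F.obj.obj a) : ev (mkHom φ h) a x = φ a x := rfl

/-- A linear functor from its values and its action on morphisms. -/
def mkFun (V : A → ModuleCat.{u} K) (m : ∀ {a b : A}, (a ⟶ b) → (V a →ₗ[K] V b))
    (hid : ∀ a x, m (𝟙 a) x = x)
    (hcomp : ∀ {a b c : A} (f : a ⟶ b) (g : b ⟶ c) x, m (f ≫ g) x = m g (m f x))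
    (hadd : ∀ {a b : A} (f g : a ⟶ b) x, m (f + g) x = m f x + m g x)
    (hsmul : ∀ {a b : A} (r : K) (f : a ⟶ b) x, m (r • f) x = r • m f x) : LinFun K A :=
  ⟨{ obj := V
     map := fun f => ModuleCat.ofHom (m f)
     map_id := fun a => by ext x; exact hid a x
     map_comp := fun f g => by ext x; exact hcomp f g x },
   ⟨by intro a b f g; ext x; exact hadd f g x⟩,
   ⟨by intro a b f r; ext x; exact hsmul r f x⟩⟩

/-! ### Representable functors -/

/-- The element of a representable functor given by a morphism. -/
def el {a b : A} (g : a ⟶ b) : (corep (K := K) a).obj.obj b := g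

@[simp] theorem act_el {a b c : A} (g : a ⟶ b) (f : b ⟶ c) :
    act (corep a) f (el (K := K) g) = el (g ≫ f) := rfl

theorem ev_ofElement_id (F : LinFun K A) (a : A) (x : F.obj.obj a) :
    ev (ofElement F a x) a (el (𝟙 a)) = x := act_id F a x

theorem ev_corep {F : LinFun K A} {a : A} (f : corep a ⟶ F) {b : A} (g : a ⟶ b) :
    ev f b (el g) = act F g (ev f a (el (𝟙 a))) := by
  rw [← ev_act, act_el, Category.id_comp]

theorem ofElement_comp {F G : LinFun K A} (a : A) (x : F.obj.obj a) (f : F ⟶ G) :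
    ofElement F a x ≫ f = ofElement G a (ev f a x) := by
  apply corep_hom_ext
  change ev f a (ev (ofElement F a x) a (el (𝟙 a))) = ev (ofElement G a _) a (el (𝟙 a))
  rw [ev_ofElement_id, ev_ofElement_id]

theorem ofElement_ev {F : LinFun K A} {a : A} (f : corep a ⟶ F) :
    ofElement F a (ev f a (el (𝟙 a))) = f := by
  apply corep_hom_ext
  exact ev_ofElement_id F a _

theorem ofElement_add {F : LinFun K A} {a : A} (x y : F.obj.obj a) :
    ofElement F a (x + y) = ofElement F a x + ofElement F a y :=
  hom_ext' fun _ g => map_add (act F (show a ⟶ _ from g)) x y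

theorem ofElement_zero {F : LinFun K A} {a : A} :
    ofElement F a (0 : F.obj.obj a) = 0 :=
  hom_ext' fun _ g => map_zero (act F (show a ⟶ _ from g))

/-! ### Monomorphisms and epimorphisms -/

theorem mono_iff {F G : LinFun K A} (f : F ⟶ G) :
    Mono f ↔ ∀ a, Function.Injective (ev f a) := by
  constructor
  · intro hf a x y hxy
    have : ofElement F a x = ofElement F a y := by
      rw [← cancel_mono f, ofElement_comp, ofElement_comp, hxy]
    have := congrArg (fun t => ev t a (el (𝟙 a))) this
    simpa only [ev_ofElement_id] using this
  · intro h
    refine ⟨fun g k hgk => hom_ext' fun a x => h a ?_⟩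
    rw [← ev_comp, ← ev_comp, hgk]

/-- Representable functors are projective, so an element of `G`, read as a morphism from a
representable, lifts through an epimorphism. -/
theorem epi_iff {F G : LinFun K A} (f : F ⟶ G) :
    Epi f ↔ ∀ a, Function.Surjective (ev f a) := by
  constructor
  · intro hf a x
    obtain ⟨g, hg⟩ := Projective.factors (ofElement G a x) f
    refine ⟨ev g a (el (𝟙 a)), ?_⟩
    rw [← ev_comp, hg, ev_ofElement_id]
  · intro h
    refine ⟨fun g k hgk => hom_ext' fun a x => ?_⟩
    obtain ⟨y, rfl⟩ := h a x
    rw [← ev_comp, ← ev_comp, hgk]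

theorem ev_injective {F G : LinFun K A} (f : F ⟶ G) [hf : Mono f] (a : A) :
    Function.Injective (ev f a) := (mono_iff f).1 hf a

theorem ev_surjective {F G : LinFun K A} (f : F ⟶ G) [hf : Epi f] (a : A) :
    Function.Surjective (ev f a) := (epi_iff f).1 hf a

theorem isZero_iff (F : LinFun K A) : IsZero F ↔ ∀ a (x : F.obj.obj a), x = 0 := by
  rw [IsZero.iff_id_eq_zero]
  constructor
  · intro h a x
    exact congrArg (fun t => ev t a x) h
  · intro h
    exact hom_ext' fun a x => h a x

/-! ### Subfunctors -/

/-- A subfunctor of a linear functor. -/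
@[ext]
structure SubF (F : LinFun K A) where
  carrier : ∀ a, Submodule K (F.obj.obj a)
  act_mem : ∀ {a b : A} (f : a ⟶ b) {x : F.obj.obj a}, x ∈ carrier a → act F f x ∈ carrier b

namespace SubF

variable {F G : LinFun K A}

instance : LE (SubF F) := ⟨fun U V => ∀ a, U.carrier a ≤ V.carrier a⟩

/-- The functor underlying a subfunctor. -/
def fn (U : SubF F) : LinFun K A :=
  mkFun (fun a => ModuleCat.of K (U.carrier a))
    (fun f => (act F f).restrict fun _ hx => U.act_mem f hx)
    (fun a x => Subtype.ext (act_id F a x.1))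
    (fun f g x => Subtype.ext (act_comp F f g x.1))
    (fun f g x => Subtype.ext (act_add F f g x.1))
    (fun r f x => Subtype.ext (act_smul F r f x.1))

/-- The inclusion of a subfunctor. -/
def ι (U : SubF F) : U.fn ⟶ F := mkHom (fun a => (U.carrier a).subtype) fun _ _ => rfl

/-- An element of a subfunctor, from an element of the functor. -/
def mk' (U : SubF F) {a : A} (x : F.obj.obj a) (hx : x ∈ U.carrier a) : U.fn.obj.obj a := ⟨x, hx⟩

theorem ev_ι_mem (U : SubF F) {a : A} (x : U.fn.obj.obj a) : ev U.ι a x ∈ U.carrier a := x.2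

instance (U : SubF F) : Mono U.ι := (mono_iff _).2 fun _ _ _ h => Subtype.ext h

/-- The quotient by a subfunctor. -/
def quot (U : SubF F) : LinFun K A :=
  mkFun (fun a => ModuleCat.of K (F.obj.obj a ⧸ U.carrier a))
    (fun f => Submodule.mapQ _ _ (act F f) fun _ hx => U.act_mem f hx)
    (fun a x => by
      obtain ⟨x, rfl⟩ := Submodule.Quotient.mk_surjective _ x
      exact congrArg _ (act_id F a x))
    (fun f g x => by
      obtain ⟨x, rfl⟩ := Submodule.Quotient.mk_surjective _ x
      exact congrArg _ (act_comp F f g x))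
    (fun f g x => by
      obtain ⟨x, rfl⟩ := Submodule.Quotient.mk_surjective _ x
      exact congrArg (Submodule.Quotient.mk) (act_add F f g x))
    (fun r f x => by
      obtain ⟨x, rfl⟩ := Submodule.Quotient.mk_surjective _ x
      exact congrArg (Submodule.Quotient.mk) (act_smul F r f x))

/-- The projection to the quotient by a subfunctor. -/
def π (U : SubF F) : F ⟶ U.quot := mkHom (fun a => (U.carrier a).mkQ) fun _ _ => rfl

theorem ev_π_eq_zero (U : SubF F) {a : A} (x : F.obj.obj a) :
    ev U.π a x = 0 ↔ x ∈ U.carrier a := Submodule.Quotient.mk_eq_zero _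

instance (U : SubF F) : Epi U.π := (epi_iff _).2 fun _ => Submodule.Quotient.mk_surjective _

/-- The range of a natural transformation. -/
def range (f : F ⟶ G) : SubF G where
  carrier a := LinearMap.range (ev f a)
  act_mem := by
    rintro a b g _ ⟨x, rfl⟩
    exact ⟨act F g x, ev_act f g x⟩

/-- The preimage of a subfunctor. -/
def comap (f : F ⟶ G) (U : SubF G) : SubF F where
  carrier a := (U.carrier a).comap (ev f a)
  act_mem := by
    intro a b g x hx
    rw [Submodule.mem_comap, ev_act]
    exact U.act_mem g hx

theorem mem_comap {f : F ⟶ G} {U : SubF G} {a : A} {x : F.obj.obj a} :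
    x ∈ (U.comap f).carrier a ↔ ev f a x ∈ U.carrier a := Iff.rfl

/-- The kernel of a natural transformation. -/
def ker (f : F ⟶ G) : SubF F where
  carrier a := LinearMap.ker (ev f a)
  act_mem := by
    intro a b g x hx
    rw [LinearMap.mem_ker] at hx ⊢
    rw [ev_act, hx, map_zero]

theorem mem_ker {f : F ⟶ G} {a : A} {x : F.obj.obj a} : x ∈ (ker f).carrier a ↔ ev f a x = 0 :=
  Iff.rfl

end SubF

/-- A natural transformation whose values lie in the range of a monomorphism factors through it. -/
theorem exists_lift_of_mono {F G H : LinFun K A} (i : F ⟶ G) [Mono i] (g : H ⟶ G)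
    (h : ∀ a x, ∃ y, ev i a y = ev g a x) : ∃ k : H ⟶ F, k ≫ i = g := by
  have hg : g ≫ cokernel.π i = 0 := hom_ext' fun a x => by
    obtain ⟨y, hy⟩ := h a x
    rw [ev_comp, ← hy, ← ev_comp, cokernel.condition]
    rfl
  exact ⟨Abelian.monoLift i g hg, Abelian.monoLift_comp i g hg⟩

/-- A natural transformation that kills the kernel of an epimorphism factors through it. -/
theorem exists_desc_of_epi {F G H : LinFun K A} (p : F ⟶ G) [Epi p] (g : F ⟶ H)
    (h : ∀ a x, ev p a x = 0 → ev g a x = 0) : ∃ k : G ⟶ H, p ≫ k = g := by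
  have hg : kernel.ι p ≫ g = 0 := hom_ext' fun a x => by
    refine h a _ (congrArg (fun t => ev t a x) (kernel.condition p))
  exact ⟨Abelian.epiDesc p g hg, Abelian.comp_epiDesc p g hg⟩

/-- Exactness of a short complex, in terms of elements. -/
theorem exact_iff (S : ShortComplex (LinFun K A)) :
    S.Exact ↔ ∀ a (x : S.X₂.obj.obj a), ev S.g a x = 0 → ∃ y, ev S.f a y = x := by
  constructor
  · intro hS a x hx
    have h0 : ofElement S.X₂ a x ≫ S.g = 0 := by rw [ofElement_comp, hx, ofElement_zero]
    refine ⟨ev (hS.liftFromProjective _ h0) a (el (𝟙 a)), ?_⟩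
    rw [← ev_comp, ShortComplex.Exact.liftFromProjective_comp, ev_ofElement_id]
  · intro h
    -- A morphism killed by `S.g` lands in the image of `S.f`; pulling back along `S.X₁ → image`
    -- gives the refinement on which it lifts.
    rw [S.exact_iff_exact_up_to_refinements]
    intro X x hx
    obtain ⟨k, hk⟩ := exists_lift_of_mono (SubF.range S.f).ι x fun a y =>
      ⟨⟨ev x a y, h a _ (congrArg (fun t => ev t a y) hx)⟩, rfl⟩
    let e : S.X₁ ⟶ (SubF.range S.f).fn :=
      mkHom (fun a => (ev S.f a).rangeRestrict) fun f y => Subtype.ext (ev_act S.f f y)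
    have he : Epi e := (epi_iff _).2 fun a => LinearMap.surjective_rangeRestrict _
    have he' : e ≫ (SubF.range S.f).ι = S.f := rfl
    refine ⟨pullback k e, pullback.fst k e, inferInstance, pullback.snd k e, ?_⟩
    rw [← hk, pullback.condition_assoc, he']

/-- A short exact sequence, from element conditions. -/
theorem shortExact_of {F G H : LinFun K A} (f : F ⟶ G) (g : G ⟶ H)
    (hf : ∀ a, Function.Injective (ev f a)) (hg : ∀ a, Function.Surjective (ev g a))
    (h0 : ∀ a x, ev g a (ev f a x) = 0) (h : ∀ a x, ev g a x = 0 → ∃ y, ev f a y = x) :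
    (ShortComplex.mk f g (hom_ext' h0)).ShortExact :=
  { exact := (exact_iff _).2 h
    mono_f := (mono_iff _).2 hf
    epi_g := (epi_iff _).2 hg }

theorem SubF.shortExact {F : LinFun K A} (U : SubF F) :
    (ShortComplex.mk U.ι U.π (hom_ext' fun _ x => (U.ev_π_eq_zero _).2 (U.ev_ι_mem x))).ShortExact :=
  shortExact_of _ _ (ev_injective _) (ev_surjective _) (fun _ x => (U.ev_π_eq_zero _).2 (U.ev_ι_mem x))
    fun _ x hx => ⟨⟨x, (U.ev_π_eq_zero x).1 hx⟩, rfl⟩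

theorem SubF.shortExact_ker {F G : LinFun K A} (p : F ⟶ G) [Epi p] :
    (ShortComplex.mk (SubF.ker p).ι p (hom_ext' fun _ x => (SubF.ker p).ev_ι_mem x)).ShortExact :=
  shortExact_of _ _ (ev_injective _) (ev_surjective _) (fun _ x => (SubF.ker p).ev_ι_mem x)
    fun _ x hx => ⟨⟨x, hx⟩, rfl⟩

theorem ShortExact.exact' {S : ShortComplex (LinFun K A)} (hS : S.ShortExact) (a : A)
    (x : S.X₂.obj.obj a) (hx : ev S.g a x = 0) : ∃ y, ev S.f a y = x :=
  (exact_iff S).1 hS.exact a x hx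

theorem ev_zero' (S : ShortComplex (LinFun K A)) (a : A) (x : S.X₁.obj.obj a) :
    ev S.g a (ev S.f a x) = 0 := congrArg (fun t => ev t a x) S.zero

theorem isIso_of_bijective {F G : LinFun K A} (f : F ⟶ G)
    (h₁ : ∀ a, Function.Injective (ev f a)) (h₂ : ∀ a, Function.Surjective (ev f a)) : IsIso f :=
  have := (mono_iff f).2 h₁
  have := (epi_iff f).2 h₂
  isIso_of_mono_of_epi f

/-! ### Coproducts -/

instance projective_coproduct {I : Type*} (F : I → LinFun K A) [HasCoproduct F]
    [∀ i, Projective (F i)] : Projective (∐ F) where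
  factors f e he := ⟨Sigma.desc fun i => Projective.factorThru (Sigma.ι F i ≫ f) e,
    Sigma.hom_ext _ _ fun i => by
      rw [Sigma.ι_desc_assoc, Projective.factorThru_comp]⟩

/-- A subfunctor of a coproduct that contains the images of all summands is everything. -/
theorem SubF.mem_of_coproduct {I : Type*} {F : I → LinFun K A} [HasCoproduct F]
    (U : SubF (∐ F)) (h : ∀ i a x, ev (Sigma.ι F i) a x ∈ U.carrier a)
    (a : A) (x : (∐ F).obj.obj a) : x ∈ U.carrier a := by
  have h1 : ∀ i, ∃ k : F i ⟶ U.fn, k ≫ U.ι = Sigma.ι F i := fun i =>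
    exists_lift_of_mono _ _ fun a y => ⟨⟨_, h i a y⟩, rfl⟩
  choose k hk using h1
  have h2 : Sigma.desc k ≫ U.ι = 𝟙 _ := by
    apply Sigma.hom_ext
    intro i
    rw [Sigma.ι_desc_assoc, hk, Category.comp_id]
  have h3 := congrArg (fun t => ev t a x) h2
  simp only [ev_comp, ev_id] at h3
  rw [← h3]
  exact U.ev_ι_mem _

open Classical in
/-- The projection of a coproduct to a summand. -/
def coprojection {I : Type*} (F : I → LinFun K A) [HasCoproduct F] (i : I) : ∐ F ⟶ F i :=
  Sigma.desc fun j => if h : j = i then eqToHom (congrArg F h) else 0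

@[simp] theorem ι_coprojection_self {I : Type*} (F : I → LinFun K A) [HasCoproduct F] (i : I) :
    Sigma.ι F i ≫ coprojection F i = 𝟙 _ := by
  simp [coprojection]

theorem ι_coprojection_of_ne {I : Type*} (F : I → LinFun K A) [HasCoproduct F] {i j : I} (h : i ≠ j) :
    Sigma.ι F i ≫ coprojection F j = 0 := by
  simp [coprojection, h]

/-- Every element of a coproduct is the sum of finitely many of its components. -/
theorem exists_finset_sum_components {I : Type*} (F : I → LinFun K A) [HasCoproduct F] (a : A)
    (x : (∐ F).obj.obj a) :
    ∃ s : Finset I, x = ∑ i ∈ s, ev (Sigma.ι F i) a (ev (coprojection F i) a x) := by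
  classical
  have hmono : ∀ (b : A) (y : (∐ F).obj.obj b) (s t : Finset I), s ⊆ t →
      y = ∑ i ∈ s, ev (Sigma.ι F i) b (ev (coprojection F i) b y) →
      y = ∑ i ∈ t, ev (Sigma.ι F i) b (ev (coprojection F i) b y) := by
    intro b y s t hst hy
    rw [← Finset.sum_subset hst]
    · exact hy
    · intro i _ hi
      rw [hy, map_sum, Finset.sum_eq_zero, map_zero]
      intro j hj
      rw [← ev_comp, ι_coprojection_of_ne F (by rintro rfl; exact hi hj)]
      rfl
  -- The elements that are finite sums of their own components form a subfunctor, and it contains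
  -- every summand.
  let U : SubF (∐ F) :=
    { carrier := fun b =>
        { carrier := {y | ∃ s : Finset I,
            y = ∑ i ∈ s, ev (Sigma.ι F i) b (ev (coprojection F i) b y)}
          zero_mem' := ⟨∅, by simp⟩
          add_mem' := by
            rintro y z ⟨s, hs⟩ ⟨t, ht⟩
            refine ⟨s ∪ t, ?_⟩
            have h1 := hmono b y s (s ∪ t) Finset.subset_union_left hs
            have h2 := hmono b z t (s ∪ t) Finset.subset_union_right ht
            simp only [map_add, Finset.sum_add_distrib]
            rw [← h1, ← h2]
          smul_mem' := by
            rintro r y ⟨s, hs⟩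
            refine ⟨s, ?_⟩
            simp only [map_smul, ← Finset.smul_sum]
            rw [← hs] }
      act_mem := by
        rintro b c f y ⟨s, hs⟩
        refine ⟨s, ?_⟩
        simp only [ev_act, ← map_sum]
        rw [← hs] }
  refine SubF.mem_of_coproduct U (fun i b y => ⟨{i}, ?_⟩) a x
  rw [Finset.sum_singleton, ← ev_comp _ (coprojection F i), ι_coprojection_self, ev_id]

end Elements

section FinGen

variable {K : Type w} [Field K] {A : Type u} [SmallCategory A] [Preadditive A] [Linear K A]

/-! ## Finitely generated functors -/

/-- A family of elements generates a functor. -/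
def Generates {F : LinFun K A} {ι : Type*} (a : ι → A) (x : ∀ i, F.obj.obj (a i)) : Prop :=
  ∀ U : SubF F, (∀ i, x i ∈ U.carrier (a i)) → ∀ b y, y ∈ U.carrier b

theorem epi_sigma_desc_iff {F : LinFun K A} {ι : Type*} (a : ι → A)
    [HasCoproduct fun i => corep (K := K) (a i)] (x : ∀ i, F.obj.obj (a i)) :
    Epi (Sigma.desc fun i => ofElement F (a i) (x i)) ↔ Generates a x := by
  rw [epi_iff]
  constructor
  · intro h U hU b y
    obtain ⟨z, rfl⟩ := h b y
    refine (U.comap (Sigma.desc fun i => ofElement F (a i) (x i))).mem_of_coproduct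
      (fun i c t => ?_) b z
    rw [SubF.mem_comap, ← ev_comp, Sigma.ι_desc]
    exact U.act_mem _ (hU i)
  · intro h b y
    refine h (SubF.range _) (fun i => ⟨ev (Sigma.ι (fun i => corep (K := K) (a i)) i) _
      (el (𝟙 (a i))), ?_⟩) b y
    rw [← ev_comp, Sigma.ι_desc, ev_ofElement_id]

theorem finGen_of_fin {F : LinFun K A} {m : ℕ} {a : Fin m → A} {x : ∀ i, F.obj.obj (a i)}
    (h : Generates a x) : FinGen F :=
  ⟨m, a, _, (epi_sigma_desc_iff a x).2 h⟩

theorem FinGen.exists_generates {F : LinFun K A} (hF : FinGen F) :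
    ∃ (m : ℕ) (a : Fin m → A) (x : ∀ i, F.obj.obj (a i)), Generates a x := by
  obtain ⟨m, a, p, hp⟩ := hF
  refine ⟨m, a, fun i => ev (Sigma.ι (fun i => corep (K := K) (a i)) i ≫ p) _ (el (𝟙 (a i))), ?_⟩
  rw [← epi_sigma_desc_iff]
  convert hp
  apply Sigma.hom_ext
  intro i
  rw [Sigma.ι_desc, ofElement_ev]

theorem finGen_of_generates {F : LinFun K A} {ι : Type*} [Finite ι] {a : ι → A}
    {x : ∀ i, F.obj.obj (a i)} (h : Generates a x) : FinGen F := by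
  obtain ⟨m, ⟨e⟩⟩ := Finite.exists_equiv_fin ι
  refine finGen_of_fin (a := fun k => a (e.symm k)) (x := fun k => x (e.symm k)) ?_
  intro U hU
  refine h U fun i => ?_
  obtain ⟨k, rfl⟩ := e.symm.surjective i
  exact hU k

theorem Generates.exists_sum {F : LinFun K A} {m : ℕ} {a : Fin m → A}
    {x : ∀ i, F.obj.obj (a i)} (h : Generates a x) (b : A) (y : F.obj.obj b) :
    ∃ g : ∀ i, a i ⟶ b, y = ∑ i, act F (g i) (x i) := by
  let U : SubF F :=
    { carrier := fun b =>
        { carrier := {y | ∃ g : ∀ i, a i ⟶ b, y = ∑ i, act F (g i) (x i)}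
          zero_mem' := ⟨fun _ => 0, by simp⟩
          add_mem' := by
            rintro y z ⟨g, rfl⟩ ⟨g', rfl⟩
            exact ⟨fun i => g i + g' i, by simp only [act_add, Finset.sum_add_distrib]⟩
          smul_mem' := by
            rintro r y ⟨g, rfl⟩
            exact ⟨fun i => r • g i, by simp only [act_smul, Finset.smul_sum]⟩ }
      act_mem := by
        rintro b c f y ⟨g, rfl⟩
        exact ⟨fun i => g i ≫ f, by simp only [act_comp, map_sum]⟩ }
  classical
  refine h U (fun i => ⟨fun j => if e : j = i then eqToHom (congrArg a e) else 0, ?_⟩) b y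
  rw [Finset.sum_eq_single i]
  · simp
  · intro j _ hj
    simp [hj]
  · simp

theorem generates_corep (a : A) :
    Generates (K := K) (F := corep a) (fun _ : Unit => a) (fun _ => el (𝟙 a)) := by
  intro U hU b y
  have := U.act_mem (show a ⟶ b from y) (hU ())
  rwa [act_el, Category.id_comp] at this

theorem finGen_corep (a : A) : FinGen (corep (K := K) a) :=
  finGen_of_generates (generates_corep a)

theorem FinGen.of_surjective {F G : LinFun K A} (hF : FinGen F) (p : F ⟶ G)
    (hp : ∀ a, Function.Surjective (ev p a)) : FinGen G := by
  obtain ⟨m, a, x, hx⟩ := hF.exists_generates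
  refine finGen_of_fin (a := a) (x := fun i => ev p _ (x i)) fun U hU b y => ?_
  obtain ⟨z, rfl⟩ := hp b y
  exact hx (U.comap p) hU b z

theorem FinGen.of_epi {F G : LinFun K A} (hF : FinGen F) (p : F ⟶ G) [Epi p] : FinGen G :=
  hF.of_surjective p (ev_surjective p)

theorem FinGen.of_iso {F G : LinFun K A} (hF : FinGen F) (e : F ≅ G) : FinGen G :=
  hF.of_epi e.hom

theorem finGen_of_isZero {F : LinFun K A} (hF : IsZero F) : FinGen F :=
  finGen_of_generates (ι := PEmpty.{1}) (a := fun i => i.elim) (x := fun i => i.elim)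
    fun _ _ b y => (isZero_iff F).1 hF b y ▸ zero_mem _

theorem FinGen.of_shortExact {S : ShortComplex (LinFun K A)} (hS : S.ShortExact)
    (h₁ : FinGen S.X₁) (h₃ : FinGen S.X₃) : FinGen S.X₂ := by
  have := hS.epi_g
  obtain ⟨m, a, x, hx⟩ := h₁.exists_generates
  obtain ⟨n, b, z, hz⟩ := h₃.exists_generates
  choose z' hz' using fun i => ev_surjective S.g _ (z i)
  refine finGen_of_generates (ι := Fin m ⊕ Fin n) (a := Sum.elim a b)
    (x := fun i => match i with
      | .inl i => ev S.f _ (x i)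
      | .inr i => z' i) fun U hU c y => ?_
  obtain ⟨g, hg⟩ := hz.exists_sum c (ev S.g c y)
  have h2 : ∑ i, act S.X₂ (g i) (z' i) ∈ U.carrier c :=
    sum_mem fun i _ => U.act_mem _ (hU (.inr i))
  obtain ⟨t, ht⟩ := ShortExact.exact' hS c (y - ∑ i, act S.X₂ (g i) (z' i)) (by
    rw [map_sub, hg, map_sum, sub_eq_zero]
    exact Finset.sum_congr rfl fun i _ => by rw [ev_act, hz'])
  have h1 : ev S.f c t ∈ U.carrier c :=
    hx (U.comap S.f) (fun i => hU (.inl i)) c t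
  rw [ht] at h1
  simpa using add_mem h1 h2

/-- A finitely generated functor is a quotient of a finitely generated projective one. -/
theorem FinGen.exists_cover {F : LinFun K A} (hF : FinGen F) :
    ∃ (P : LinFun K A) (p : P ⟶ F), Projective P ∧ FinGen P ∧ Epi p := by
  obtain ⟨m, a, p, hp⟩ := hF
  exact ⟨_, p, inferInstance, ⟨m, a, 𝟙 _, inferInstance⟩, hp⟩

/-! ## Finitely presented functors -/

theorem kernel_iso_ker {F G : LinFun K A} (p : F ⟶ G) :
    Nonempty (kernel p ≅ (SubF.ker p).fn) := by
  obtain ⟨k, hk⟩ := exists_lift_of_mono (SubF.ker p).ι (kernel.ι p)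
    fun a x => ⟨⟨_, congrArg (fun t => ev t a x) (kernel.condition p)⟩, rfl⟩
  have h0 : (SubF.ker p).ι ≫ p = 0 := hom_ext' fun a x => (SubF.ker p).ev_ι_mem x
  refine ⟨⟨k, kernel.lift p _ h0, ?_, ?_⟩⟩
  · rw [← cancel_mono (kernel.ι p), Category.assoc, kernel.lift_ι, hk, Category.id_comp]
  · rw [← cancel_mono (SubF.ker p).ι, Category.assoc, hk, kernel.lift_ι, Category.id_comp]

theorem finPres_iff {F : LinFun K A} : FinPres F ↔
    ∃ (m : ℕ) (a : Fin m → A) (p : (∐ fun k => corep (K := K) (a k)) ⟶ F),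
      Epi p ∧ FinGen (SubF.ker p).fn := by
  constructor
  · rintro ⟨m, a, p, hp, hk⟩
    exact ⟨m, a, p, hp, hk.of_iso (kernel_iso_ker p).some⟩
  · rintro ⟨m, a, p, hp, hk⟩
    exact ⟨m, a, p, hp, hk.of_iso (kernel_iso_ker p).some.symm⟩

theorem FinPres.finGen {F : LinFun K A} (hF : FinPres F) : FinGen F := by
  obtain ⟨m, a, p, hp, -⟩ := hF
  exact ⟨m, a, p, hp⟩

/-- The kernel of an epimorphism from a finitely generated functor to a finitely presented functor
is finitely generated. -/
theorem FinPres.finGen_kernel {S : ShortComplex (LinFun K A)} (hS : S.ShortExact)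
    (h₂ : FinGen S.X₂) (h₃ : FinPres S.X₃) : FinGen S.X₁ := by
  have := hS.epi_g
  have := hS.mono_f
  obtain ⟨n, b, q, hq, hk⟩ := finPres_iff.1 h₃
  obtain ⟨m, a, x, hx⟩ := h₂.exists_generates
  obtain ⟨k, c, t, ht⟩ := hk.exists_generates
  -- Schanuel's argument: `h` lifts the presentation `q` of `S.X₃` to `S.X₂`. The corrections `x i -
  -- h (y i)` and the images under `h` of the generators of `ker q` come from `S.X₁`, and their
  -- preimages generate it.
  let h := Projective.factorThru q S.g
  have hh : h ≫ S.g = q := Projective.factorThru_comp q S.g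
  have hh' : ∀ d y, ev S.g d (ev h d y) = ev q d y := fun d y => by rw [← ev_comp, hh]
  choose y hy using fun i => ev_surjective q _ (ev S.g _ (x i))
  choose u hu using fun i => ShortExact.exact' hS _ (x i - ev h _ (y i)) (by
    rw [map_sub, hh', hy, sub_self])
  choose v hv using fun i => ShortExact.exact' hS _ (ev h _ (ev (SubF.ker q).ι _ (t i))) (by
    rw [hh']; exact (SubF.ker q).ev_ι_mem _)
  refine finGen_of_generates (ι := Fin m ⊕ Fin k) (a := Sum.elim a c)
    (x := fun i => match i with
      | .inl i => u i
      | .inr i => v i) fun U hU d z => ?_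
  obtain ⟨g, hg⟩ := hx.exists_sum d (ev S.f d z)
  have hker : ev q d (∑ i, act _ (g i) (y i)) = 0 := by
    rw [map_sum, ← ev_zero' S d z, hg, map_sum]
    exact Finset.sum_congr rfl fun i _ => by rw [ev_act, ev_act, hy]
  obtain ⟨g', hg'⟩ := ht.exists_sum d ((SubF.ker q).mk' _ hker)
  have e : z = ∑ i, act _ (g i) (u i) + ∑ i, act _ (g' i) (v i) := by
    apply ev_injective S.f d
    rw [map_add, map_sum, map_sum]
    simp only [ev_act, hu, hv]
    have e1 := congrArg (fun t => ev h d (ev (SubF.ker q).ι d t)) hg'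
    simp only [map_sum (ev h d), map_sum (ev (SubF.ker q).ι d), ev_act] at e1
    have e2 : ev (SubF.ker q).ι d ((SubF.ker q).mk' _ hker) = ∑ i, act _ (g i) (y i) := rfl
    rw [← e1, e2, hg, map_sum, ← Finset.sum_add_distrib]
    exact Finset.sum_congr rfl fun i _ => by rw [ev_act, map_sub, sub_add_cancel]
  rw [e]
  exact add_mem (sum_mem fun i _ => U.act_mem _ (hU (.inl i)))
    (sum_mem fun i _ => U.act_mem _ (hU (.inr i)))

/-- With a section `s` of `p`, the idempotent `1 - p ≫ s` maps `P` onto the kernel. -/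
theorem finGen_ker_of_projective {P Q : LinFun K A} [Projective Q] (p : P ⟶ Q) [Epi p]
    (hP : FinGen P) : FinGen (SubF.ker p).fn := by
  let s := Projective.factorThru (𝟙 Q) p
  have hs : s ≫ p = 𝟙 Q := Projective.factorThru_comp _ _
  obtain ⟨k, hk⟩ := exists_lift_of_mono (SubF.ker p).ι (𝟙 P - p ≫ s) fun a x =>
    ⟨⟨ev (𝟙 P - p ≫ s) a x, by
      have : ev p a (ev (𝟙 P - p ≫ s) a x) = ev p a x - ev (s ≫ p) a (ev p a x) := by simp
      rw [SubF.mem_ker, this, hs, ev_id, sub_self]⟩, rfl⟩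
  refine hP.of_surjective k fun a x => ⟨ev (SubF.ker p).ι a x, ?_⟩
  apply ev_injective (SubF.ker p).ι a
  rw [← ev_comp, hk]
  have : ev p a (ev (SubF.ker p).ι a x) = 0 := (SubF.ker p).ev_ι_mem x
  simp [this]

theorem finPres_of_projective {P : LinFun K A} [Projective P] (hP : FinGen P) : FinPres P := by
  obtain ⟨m, a, p, hp⟩ := hP
  exact finPres_iff.2 ⟨m, a, p, hp, finGen_ker_of_projective p ⟨m, a, 𝟙 _, inferInstance⟩⟩

/-- The kernel of a composition of epimorphisms is an extension of the kernels. -/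
theorem shortExact_ker_comp {F G H : LinFun K A} (p : F ⟶ G) (q : G ⟶ H) [Epi p] :
    ∃ S : ShortComplex (LinFun K A), S.ShortExact ∧ S.X₁ = (SubF.ker p).fn ∧
      S.X₂ = (SubF.ker (p ≫ q)).fn ∧ S.X₃ = (SubF.ker q).fn := by
  let f : (SubF.ker p).fn ⟶ (SubF.ker (p ≫ q)).fn :=
    mkHom (fun a => Submodule.inclusion fun x hx => by
      have hx : ev p a x = 0 := hx
      rw [SubF.mem_ker, ev_comp, hx, map_zero]) fun _ _ => rfl
  let g : (SubF.ker (p ≫ q)).fn ⟶ (SubF.ker q).fn :=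
    mkHom (fun a => (ev p a).restrict fun x hx => hx) fun h x => Subtype.ext (ev_act p h x.1)
  refine ⟨_, shortExact_of f g (fun a x y h => ?_) (fun a x => ?_) (fun a x => ?_)
    fun a x hx => ?_, rfl, rfl, rfl⟩
  · exact ev_injective (SubF.ker p).ι a (congrArg (ev (SubF.ker (p ≫ q)).ι a) h)
  · obtain ⟨y, hy⟩ := ev_surjective p a x.1
    exact ⟨⟨y, show ev q a (ev p a y) = 0 by rw [hy]; exact x.2⟩, Subtype.ext hy⟩
  · exact Subtype.ext x.2
  · exact ⟨⟨x.1, congrArg Subtype.val hx⟩, rfl⟩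

/-- For a presentation `p` of the middle term, the kernel of `p ≫ S.g` is an extension of `ker S.g`,
a quotient of `S.X₁`, by `ker p`. -/
theorem FinPres.of_quotient {S : ShortComplex (LinFun K A)} (hS : S.ShortExact)
    (h₁ : FinGen S.X₁) (h₂ : FinPres S.X₂) : FinPres S.X₃ := by
  have := hS.epi_g
  obtain ⟨m, a, p, hp, hk⟩ := finPres_iff.1 h₂
  refine finPres_iff.2 ⟨m, a, p ≫ S.g, inferInstance, ?_⟩
  obtain ⟨T, hT, e1, e2, e3⟩ := shortExact_ker_comp p S.g
  rw [← e2]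
  refine FinGen.of_shortExact hT (e1 ▸ hk) ?_
  rw [e3]
  refine h₁.of_surjective (mkHom (fun a => (ev S.f a).codRestrict _ fun x => ev_zero' S a x)
    fun f x => Subtype.ext (ev_act S.f f x)) fun a x => ?_
  obtain ⟨y, hy⟩ := ShortExact.exact' hS a x.1 x.2
  exact ⟨y, Subtype.ext hy⟩

theorem FinPres.of_iso {F G : LinFun K A} (hF : FinPres F) (e : F ≅ G) : FinPres G := by
  refine FinPres.of_quotient (S := ShortComplex.mk (0 : (0 : LinFun K A) ⟶ F) e.hom (by simp))
    (shortExact_of _ _ (fun a x y _ => ?_) (ev_surjective _) (fun a x => by simp) fun a x hx =>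
    ⟨0, ?_⟩) (finGen_of_isZero (isZero_zero _)) hF
  · rw [(isZero_iff _).1 (isZero_zero _) a x, (isZero_iff _).1 (isZero_zero _) a y]
  · rw [map_zero]
    exact (ev_injective e.hom a (by rw [hx, map_zero])).symm

theorem finPres_of_cover {P F : LinFun K A} [Projective P] (hP : FinGen P) (p : P ⟶ F) [Epi p]
    (h : FinGen (SubF.ker p).fn) : FinPres F :=
  FinPres.of_quotient (SubF.shortExact_ker p) h (finPres_of_projective hP)

theorem biprod_eq {F G : LinFun K A} (a : A) (x : (F ⊞ G).obj.obj a) :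
    x = ev biprod.inl a (ev biprod.fst a x) + ev biprod.inr a (ev biprod.snd a x) := by
  have := congrArg (fun t => ev t a x) (biprod.total (X := F) (Y := G))
  rw [ev_add, ev_comp, ev_comp, ev_id] at this
  exact this.symm

@[simp] theorem fst_inl {F G : LinFun K A} (a : A) (x : F.obj.obj a) :
    ev (biprod.fst : F ⊞ G ⟶ F) a (ev biprod.inl a x) = x := by
  rw [← ev_comp, biprod.inl_fst, ev_id]

@[simp] theorem fst_inr {F G : LinFun K A} (a : A) (x : G.obj.obj a) :
    ev (biprod.fst : F ⊞ G ⟶ F) a (ev biprod.inr a x) = 0 := by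
  rw [← ev_comp, biprod.inr_fst, ev_zero]

@[simp] theorem snd_inl {F G : LinFun K A} (a : A) (x : F.obj.obj a) :
    ev (biprod.snd : F ⊞ G ⟶ G) a (ev biprod.inl a x) = 0 := by
  rw [← ev_comp, biprod.inl_snd, ev_zero]

@[simp] theorem snd_inr {F G : LinFun K A} (a : A) (x : G.obj.obj a) :
    ev (biprod.snd : F ⊞ G ⟶ G) a (ev biprod.inr a x) = x := by
  rw [← ev_comp, biprod.inr_snd, ev_id]

theorem shortExact_biprod (F G : LinFun K A) :
    (ShortComplex.mk (biprod.inl : F ⟶ F ⊞ G) biprod.snd biprod.inl_snd).ShortExact :=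
  shortExact_of _ _ (ev_injective _) (ev_surjective _) (fun a x => by simp) fun a x hx =>
    ⟨ev biprod.fst a x, by
      conv_rhs => rw [biprod_eq a x, hx, map_zero, add_zero]⟩

theorem shortExact_biprod' (F G : LinFun K A) :
    (ShortComplex.mk (biprod.inr : G ⟶ F ⊞ G) biprod.fst biprod.inr_fst).ShortExact :=
  shortExact_of _ _ (ev_injective _) (ev_surjective _) (fun a x => by simp) fun a x hx =>
    ⟨ev biprod.snd a x, by
      conv_rhs => rw [biprod_eq a x, hx, map_zero, zero_add]⟩

/-- Extensions of finitely presented functors are finitely presented. -/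
theorem FinPres.of_shortExact {S : ShortComplex (LinFun K A)} (hS : S.ShortExact)
    (h₁ : FinPres S.X₁) (h₃ : FinPres S.X₃) : FinPres S.X₂ := by
  have := hS.epi_g
  have := hS.mono_f
  obtain ⟨P, p, _, hP, _⟩ := (FinGen.of_shortExact hS h₁.finGen h₃.finGen).exists_cover
  refine finPres_of_cover hP p ?_
  -- `ker p` is the kernel of `ker (p ≫ S.g) → ker S.g`. The source is finitely generated because
  -- `S.X₃` is finitely presented, and the target is the finitely presented `S.X₁`.
  obtain ⟨T, hT, e1, e2, e3⟩ := shortExact_ker_comp p S.g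
  have h2 : FinGen T.X₂ := by
    rw [e2]
    exact FinPres.finGen_kernel (SubF.shortExact_ker (p ≫ S.g)) hP h₃
  rw [← e1]
  refine FinPres.finGen_kernel hT h2 ?_
  rw [e3]
  refine h₁.of_iso (@asIso _ _ _ _ (mkHom (fun a => (ev S.f a).codRestrict _
    fun x => ev_zero' S a x) fun f x => Subtype.ext (ev_act S.f f x)) (isIso_of_bijective _ ?_ ?_))
  · intro a x y h
    exact ev_injective S.f a (congrArg Subtype.val h)
  · intro a x
    obtain ⟨y, hy⟩ := ShortExact.exact' hS a x.1 x.2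
    exact ⟨y, Subtype.ext hy⟩

/-- The kernel of an epimorphism from a finitely presented functor to a functor whose first syzygy is
finitely presented is finitely presented. -/
theorem FinPres.kernel_of_syzygy {S : ShortComplex (LinFun K A)} (hS : S.ShortExact)
    (h₂ : FinPres S.X₂) {P : LinFun K A} [Projective P] (hP : FinGen P) (p : P ⟶ S.X₃) [Epi p]
    (hp : FinPres (SubF.ker p).fn) : FinPres S.X₁ := by
  have := hS.epi_g
  have := hS.mono_f
  let h := Projective.factorThru p S.g
  have hh' : ∀ d y, ev S.g d (ev h d y) = ev p d y := fun d y => by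
    rw [← ev_comp, Projective.factorThru_comp]
  -- `q` is onto and its kernel is isomorphic to the syzygy `ker p`. So `S.X₁ ⊞ P` is an extension
  -- of finitely presented functors, and `S.X₁` is its quotient by the finitely generated `P`.
  let q : S.X₁ ⊞ P ⟶ S.X₂ := biprod.desc S.f h
  have hq : ∀ d x, ev q d x = ev S.f d (ev biprod.fst d x) + ev h d (ev biprod.snd d x) := by
    intro d x
    conv_lhs => rw [biprod_eq d x, map_add, ← ev_comp biprod.inl, ← ev_comp biprod.inr,
      biprod.inl_desc, biprod.inr_desc]
  have : Epi q := (epi_iff _).2 fun d x => by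
    obtain ⟨y, hy⟩ := ev_surjective p d (ev S.g d x)
    obtain ⟨z, hz⟩ := ShortExact.exact' hS d (x - ev h d y) (by rw [map_sub, hh', hy, sub_self])
    refine ⟨ev biprod.inl d z + ev biprod.inr d y, ?_⟩
    rw [hq]
    simp [hz]
  have hk : FinPres (SubF.ker q).fn := by
    let r : (SubF.ker q).fn ⟶ (SubF.ker p).fn :=
      mkHom (fun a => (ev (biprod.snd : S.X₁ ⊞ P ⟶ P) a).restrict fun x hx => by
        have h1 := (hq a x).symm.trans hx
        have h2 := congrArg (ev S.g a) h1
        rw [map_add, ev_zero' S, hh', zero_add, map_zero] at h2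
        exact h2) fun f x => Subtype.ext (ev_act _ f x.1)
    have hr : IsIso r := isIso_of_bijective _ (fun a => by
      rw [injective_iff_map_eq_zero]
      intro x hx
      have hx2 : ev biprod.snd a x.1 = 0 := congrArg Subtype.val hx
      have h1 := (hq a x.1).symm.trans x.2
      rw [hx2, map_zero, add_zero] at h1
      refine Subtype.ext ?_
      rw [biprod_eq a x.1, hx2, ev_injective S.f a (h1.trans (map_zero _).symm), map_zero,
        map_zero, add_zero]
      rfl) fun a x => by
      obtain ⟨z, hz⟩ := ShortExact.exact' hS a (ev h a x.1) (by rw [hh']; exact x.2)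
      refine ⟨⟨ev biprod.inr a x.1 - ev biprod.inl a z, ?_⟩, Subtype.ext ?_⟩
      · rw [SubF.mem_ker, hq]
        simp [hz]
      · change ev biprod.snd a (ev biprod.inr a x.1 - ev biprod.inl a z) = x.1
        simp
    exact hp.of_iso (asIso r).symm
  exact FinPres.of_quotient (shortExact_biprod' S.X₁ P) hP
    (FinPres.of_shortExact (S := ShortComplex.mk (SubF.ker q).ι q _) (SubF.shortExact_ker q) hk h₂)

/-! ## Coherence -/

/-- Pull `G` back along a presentation `p` of `F`: the preimage is a finitely generated subfunctor
of a projective, hence finitely presented, and `G` is its quotient by the finitely generated `ker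
p`. -/
theorem IsCoherentCat.finPres_of_mono (hA : IsCoherentCat K A) {F G : LinFun K A} (i : G ⟶ F)
    [Mono i] (hF : FinPres F) (hG : FinGen G) : FinPres G := by
  obtain ⟨m, a, p, hp, hk⟩ := finPres_iff.1 hF
  let U := (SubF.range i).comap p
  let j : (SubF.ker p).fn ⟶ U.fn := mkHom (fun c => Submodule.inclusion fun x hx => by
    rw [SubF.mem_comap, (show ev p c x = 0 from hx)]
    exact zero_mem _) fun _ _ => rfl
  obtain ⟨q, hq⟩ := exists_lift_of_mono i (U.ι ≫ p) fun a x => U.ev_ι_mem x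
  have hq' : ∀ c x, ev i c (ev q c x) = ev p c (ev U.ι c x) := fun c x => by
    rw [← ev_comp, hq, ev_comp]
  have hS := shortExact_of j q (fun c x y h => ev_injective (SubF.ker p).ι c
      (congrArg (ev U.ι c) h))
    (fun c x => by
      obtain ⟨y, hy⟩ := ev_surjective p c (ev i c x)
      exact ⟨U.mk' y ⟨x, hy.symm⟩, ev_injective i c ((hq' _ _).trans hy)⟩)
    (fun c x => ev_injective i c (by
      rw [hq', map_zero]
      exact (SubF.ker p).ev_ι_mem x))
    (fun c x hx => ⟨⟨x.1, by
      have := hq' c x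
      rw [hx, map_zero] at this
      exact this.symm⟩, rfl⟩)
  have hU : FinGen U.fn := FinGen.of_shortExact hS hk hG
  have e := Subobject.underlyingIso U.ι
  have hU' := hA _ (Subobject.mk U.ι) inferInstance ⟨m, a, 𝟙 _, inferInstance⟩ (hU.of_iso e.symm)
  exact FinPres.of_quotient hS hk (hU'.of_iso e)

/-- The image of a morphism is a finitely generated subfunctor of the target, hence finitely
presented. This makes the kernel finitely generated, thus finitely presented as a subfunctor of the
source, and the cokernel a quotient by a finitely generated subfunctor. -/
theorem finPres_closed_of_coherent (hA : IsCoherentCat K A) :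
    (FinPres : ObjectProperty (LinFun K A)).IsClosedUnderKernels ∧
    (FinPres : ObjectProperty (LinFun K A)).IsClosedUnderCokernels := by
  have h1 : ∀ {F G : LinFun K A} (f : F ⟶ G), FinPres F → FinPres G →
      FinPres (kernel f) ∧ FinPres (cokernel f) := by
    intro F G f hF hG
    have hI : FinGen (Abelian.image f) := hF.finGen.of_epi (Abelian.factorThruImage f)
    have hI' := hA.finPres_of_mono (Abelian.image.ι f) hG hI
    constructor
    · have hk : FinGen (kernel f) := by
        refine FinGen.of_iso ?_ (kernel_iso_ker f).some.symm
        have hS := SubF.shortExact_ker (Abelian.factorThruImage f)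
        refine (FinPres.finGen_kernel hS hF.finGen hI').of_surjective (mkHom (fun a =>
          Submodule.inclusion fun x hx => ?_) fun _ _ => rfl) fun a x => ⟨⟨x.1, ?_⟩, rfl⟩
        · rw [SubF.mem_ker, ← Abelian.image.fac f, ev_comp, (show ev _ a x = 0 from hx), map_zero]
        · apply ev_injective (Abelian.image.ι f) a
          rw [← ev_comp, Abelian.image.fac f, map_zero]
          exact x.2
      exact hA.finPres_of_mono (kernel.ι f) hF hk
    · refine FinPres.of_quotient (S := ShortComplex.mk (Abelian.image.ι f) (cokernel.π f)
        (kernel.condition _)) { exact := ?_, mono_f := inferInstance, epi_g := inferInstance } hI hG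
      exact ShortComplex.exact_kernel (cokernel.π f)
  constructor
  · constructor
    rintro _ ⟨f, k, hk, hf⟩
    exact (h1 f hf.1 hf.2).1.of_iso ((kernelIsKernel f).conePointUniqueUpToIso hk)
  · constructor
    rintro _ ⟨f, k, hk, hf⟩
    exact (h1 f hf.1 hf.2).2.of_iso ((cokernelIsCokernel f).coconePointUniqueUpToIso hk)

/-- A full subcategory of an abelian category closed under kernels, cokernels and finite products is
abelian; binary products are covered by closure under extensions. -/
theorem abelian_finPres (hA : IsCoherentCat K A) :
    Nonempty (Abelian (FinPres : ObjectProperty (LinFun K A)).FullSubcategory) := by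
  obtain ⟨h1, h2⟩ := finPres_closed_of_coherent hA
  have h0 : ∀ F : LinFun K A, IsZero F → FinPres F := fun F hF =>
    have := hF.projective
    finPres_of_projective (finGen_of_isZero hF)
  have : (FinPres : ObjectProperty (LinFun K A)).ContainsZero :=
    ⟨⟨0, isZero_zero _, h0 _ (isZero_zero _)⟩⟩
  have : (FinPres : ObjectProperty (LinFun K A)).IsClosedUnderBinaryProducts := ⟨by
    rintro F ⟨h⟩
    have e1 := IsLimit.conePointUniqueUpToIso (limit.isLimit _) h.isLimit
    have e2 := HasLimit.isoOfNatIso (diagramIsoPair h.diag)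
    have e3 := biprod.isoProd (h.diag.obj ⟨.left⟩) (h.diag.obj ⟨.right⟩)
    exact (FinPres.of_shortExact (shortExact_biprod _ _) (h.prop_diag_obj _)
      (h.prop_diag_obj _)).of_iso (e3 ≪≫ e2.symm ≪≫ e1)⟩
  have : (FinPres : ObjectProperty (LinFun K A)).IsClosedUnderLimitsOfShape
      (Discrete.{0} PEmpty) := ⟨by
    rintro F ⟨h⟩
    refine h0 F ?_
    rw [IsZero.iff_id_eq_zero]
    exact h.isLimit.hom_ext fun j => j.as.elim⟩
  have : (FinPres : ObjectProperty (LinFun K A)).IsClosedUnderFiniteProducts := .mk'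
  exact ⟨inferInstance⟩

end FinGen

section Filtrations

variable {K : Type w} [Field K] {A : Type u} [SmallCategory A] [Preadditive A] [Linear K A]

/-! ## Functors with a finite filtration -/

/-- If `0 → X₁ → X₂ → X₃ → 0` and `0 → Y₁ → X₃ → Y₃ → 0` are exact, then the kernel of the
composition `X₂ → Y₃` is an extension of `Y₁` by `X₁`. -/
theorem shortExact_ker_lift {M F H G R : LinFun K A} {f : M ⟶ F} {g : F ⟶ H} {h₀ : f ≫ g = 0}
    (hS : (ShortComplex.mk f g h₀).ShortExact) {i : G ⟶ H} {r : H ⟶ R} {h₁ : i ≫ r = 0}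
    (hT : (ShortComplex.mk i r h₁).ShortExact) :
    ∃ (j : M ⟶ (SubF.ker (g ≫ r)).fn) (q : (SubF.ker (g ≫ r)).fn ⟶ G) (h : j ≫ q = 0),
      (ShortComplex.mk j q h).ShortExact ∧ q ≫ i = (SubF.ker (g ≫ r)).ι ≫ g ∧
      j ≫ (SubF.ker (g ≫ r)).ι = f := by
  have hi : Mono i := hT.mono_f
  have hg : Epi g := hS.epi_g
  have hf : Mono f := hS.mono_f
  obtain ⟨q, hq⟩ := exists_lift_of_mono i ((SubF.ker (g ≫ r)).ι ≫ g) fun a x =>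
    ShortExact.exact' hT a (ev g a (ev (SubF.ker (g ≫ r)).ι a x)) ((SubF.ker (g ≫ r)).ev_ι_mem x)
  obtain ⟨j, hj⟩ := exists_lift_of_mono (SubF.ker (g ≫ r)).ι f fun a x =>
    ⟨(SubF.ker (g ≫ r)).mk' (ev f a x) (by
      have h2 : ev g a (ev f a x) = 0 := congrArg (fun t => ev t a x) h₀
      rw [SubF.mem_ker, ev_comp, h2, map_zero]), rfl⟩
  have hq' : ∀ a x, ev i a (ev q a x) = ev g a (ev (SubF.ker (g ≫ r)).ι a x) := fun a x => by
    rw [← ev_comp, hq, ev_comp]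
  have hj' : ∀ a x, ev (SubF.ker (g ≫ r)).ι a (ev j a x) = ev f a x := fun a x => by
    rw [← ev_comp, hj]
  refine ⟨j, q, _, shortExact_of j q (fun a x y h => ?_) (fun a x => ?_) (fun a x => ?_)
    fun a x hx => ?_, hq, hj⟩
  · apply ev_injective f a
    rw [← hj', ← hj', h]
  · obtain ⟨y, hy⟩ := ev_surjective g a (ev i a x)
    refine ⟨(SubF.ker (g ≫ r)).mk' y ?_, ev_injective i a ((hq' _ _).trans hy)⟩
    rw [SubF.mem_ker, ev_comp, hy]
    exact congrArg (fun t => ev t a x) h₁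
  · apply ev_injective i a
    rw [hq', hj', map_zero]
    exact congrArg (fun t => ev t a x) h₀
  · have h2 := hq' a x
    rw [hx, map_zero] at h2
    obtain ⟨y, hy⟩ := ShortExact.exact' hS a _ h2.symm
    exact ⟨y, ev_injective (SubF.ker (g ≫ r)).ι a ((hj' _ _).trans hy)⟩

theorem isZero_or_isIso_of_simple {S G : LinFun K A} (hS : Simple S) (q : S ⟶ G) [Epi q] :
    IsZero G ∨ IsIso q := by
  by_cases h : kernel.ι q = 0
  · right
    have := Preadditive.mono_of_kernel_zero h
    exact isIso_of_mono_of_epi q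
  · left
    have := (Simple.mono_isIso_iff_nonzero (kernel.ι q)).2 h
    have hq : q = 0 := by
      rw [← cancel_epi (kernel.ι q), kernel.condition, comp_zero]
    rw [IsZero.iff_id_eq_zero, ← cancel_epi q, hq, zero_comp, zero_comp]

variable {Q : ObjectProperty (LinFun K A)}

theorem FiniteFiltration.of_iso {F G : LinFun K A} (hF : FiniteFiltration Q F) (e : F ≅ G) :
    FiniteFiltration Q G := by
  cases hF with
  | zero _ h => exact .zero _ (h.of_iso e.symm)
  | step S hS h₁ h₃ =>
    refine .step (ShortComplex.mk (S.f ≫ e.hom) (e.inv ≫ S.g) (by simp)) ?_ h₁ h₃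
    refine ShortComplex.shortExact_of_iso (S₁ := S) ?_ hS
    exact ShortComplex.isoMk (Iso.refl _) e (Iso.refl _) (by simp) (by simp)

theorem finiteFiltration_of_mem (S : LinFun K A) (hS : Q S) : FiniteFiltration Q S := by
  refine .step (ShortComplex.mk (0 : 0 ⟶ S) (𝟙 S) zero_comp) ?_ (.zero _ (isZero_zero _)) hS
  exact shortExact_of _ _ (fun a x y _ => ((isZero_iff _).1 (isZero_zero _) a x).trans
      ((isZero_iff _).1 (isZero_zero _) a y).symm) (fun a x => ⟨x, rfl⟩) (fun a x => by simp)
    fun a x hx => ⟨0, by simpa using hx.symm⟩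

theorem FiniteFiltration.mono {Q' : ObjectProperty (LinFun K A)} (h : ∀ S, Q S → Q' S)
    {F : LinFun K A} (hF : FiniteFiltration Q F) : FiniteFiltration Q' F := by
  induction hF with
  | zero F h => exact .zero F h
  | step S hS _ h₃ ih => exact .step S hS ih (h _ h₃)

/-- The image of `S.X₁` in `G` is filtered by induction, and `G` modulo this image is a quotient of
the simple `S.X₃`, so it is zero or a copy of `S.X₃`. -/
theorem FiniteFiltration.of_epi (hQ : ∀ S, Q S → Simple S) {F : LinFun K A}
    (hF : FiniteFiltration Q F) : ∀ {G : LinFun K A} (p : F ⟶ G) [Epi p],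
      FiniteFiltration Q G := by
  induction hF with
  | zero F h =>
    intro G p _
    refine .zero G ?_
    rw [IsZero.iff_id_eq_zero, ← cancel_epi p]
    exact h.eq_of_src _ _
  | step S hS _ h₃ ih =>
    intro G p _
    have := hS.epi_g
    let I := SubF.range (S.f ≫ p)
    have hI : FiniteFiltration Q I.fn := by
      have : Epi (mkHom (F := S.X₁) (G := I.fn) (fun a => (ev (S.f ≫ p) a).rangeRestrict)
          fun f x => Subtype.ext (ev_act (S.f ≫ p) f x)) :=
        (epi_iff _).2 fun a => LinearMap.surjective_rangeRestrict _
      exact ih (mkHom (F := S.X₁) (G := I.fn) (fun a => (ev (S.f ≫ p) a).rangeRestrict)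
          fun f x => Subtype.ext (ev_act (S.f ≫ p) f x))
    obtain ⟨q, hq⟩ := exists_desc_of_epi S.g (p ≫ I.π) fun a x hx => by
      obtain ⟨y, rfl⟩ := ShortExact.exact' hS a x hx
      rw [ev_comp, I.ev_π_eq_zero]
      exact ⟨y, rfl⟩
    have : Epi q := by
      have : Epi (S.g ≫ q) := hq ▸ inferInstance
      exact epi_of_epi S.g q
    rcases isZero_or_isIso_of_simple (hQ _ h₃) q with h | h
    · refine hI.of_iso (@asIso _ _ _ _ I.ι (isIso_of_bijective _ (ev_injective _) fun a x => ?_))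
      exact ⟨I.mk' x ((I.ev_π_eq_zero x).1 ((isZero_iff _).1 h a _)), rfl⟩
    · refine .step (ShortComplex.mk I.ι (I.π ≫ inv q) ?_) ?_ hI h₃
      · rw [← Category.assoc, (hom_ext' fun _ x => (I.ev_π_eq_zero _).2 (I.ev_ι_mem x) :
          I.ι ≫ I.π = 0), zero_comp]
      · refine ShortComplex.shortExact_of_iso (S₁ := ShortComplex.mk I.ι I.π _) ?_ I.shortExact
        exact ShortComplex.isoMk (Iso.refl _) (Iso.refl _) (asIso (inv q)) (by simp) (by simp)

/-- Induction on the filtration of the quotient: its top factor becomes the top factor of `F`, and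
the kernel of `F` onto that factor is an extension of a shorter functor by `M`. -/
theorem FiniteFiltration.of_shortExact {N : LinFun K A} (hN : FiniteFiltration Q N) :
    ∀ {M F : LinFun K A} {f : M ⟶ F} {g : F ⟶ N} {h : f ≫ g = 0},
      (ShortComplex.mk f g h).ShortExact → FiniteFiltration Q M → FiniteFiltration Q F := by
  induction hN with
  | zero N hN =>
    intro M F f g h hS hM
    have := hS.mono_f
    refine hM.of_iso (@asIso _ _ _ _ f (isIso_of_bijective _ (ev_injective f) fun a x => ?_))
    exact ShortExact.exact' hS a x ((isZero_iff _).1 hN a _)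
  | step T hT _ h₃ ih =>
    intro M F f g h hS hM
    have := hS.epi_g
    have := hT.epi_g
    obtain ⟨j, q, h0, hS', -, -⟩ := shortExact_ker_lift hS hT
    exact .step _ (SubF.shortExact_ker (g ≫ T.g)) (ih hS' hM) h₃

theorem FiniteFiltration.hom_eq_zero {H : LinFun K A} (hQ : ∀ S, Q S → ∀ f : S ⟶ H, f = 0)
    {F : LinFun K A} (hF : FiniteFiltration Q F) : ∀ f : F ⟶ H, f = 0 := by
  induction hF with
  | zero F h => exact fun f => h.eq_of_src _ _
  | step S hS _ h₃ ih =>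
    intro f
    have := hS.epi_g
    obtain ⟨k, hk⟩ := exists_desc_of_epi S.g f fun a x hx => by
      obtain ⟨y, rfl⟩ := ShortExact.exact' hS a x hx
      rw [← ev_comp, ih (S.f ≫ f), ev_zero]
    rw [← hk, hQ _ h₃ k, comp_zero]

/-- If the members of `Q` have finitely presented first syzygies, then the kernel of an epimorphism
from a finitely presented functor to a functor filtered by `Q` is finitely presented. -/
theorem FiniteFiltration.finPres_kernel
    (hQ : ∀ S, Q S → ∃ (P : LinFun K A) (p : P ⟶ S), Projective P ∧ FinGen P ∧ Epi p ∧
      FinPres (SubF.ker p).fn) {N : LinFun K A} (hN : FiniteFiltration Q N) :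
    ∀ {M F : LinFun K A} {f : M ⟶ F} {g : F ⟶ N} {h : f ≫ g = 0},
      (ShortComplex.mk f g h).ShortExact → FinPres F → FinPres M := by
  induction hN with
  | zero N hN =>
    intro M F f g h hS hF
    have := hS.mono_f
    refine hF.of_iso (@asIso _ _ _ _ f (isIso_of_bijective _ (ev_injective f) fun a x => ?_)).symm
    exact ShortExact.exact' hS a x ((isZero_iff _).1 hN a _)
  | step T hT _ h₃ ih =>
    intro M F f g h hS hF
    have := hS.epi_g
    have := hT.epi_g
    obtain ⟨j, q, h0, hS', -, -⟩ := shortExact_ker_lift hS hT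
    obtain ⟨P, p, _, hP, _, hp⟩ := hQ _ h₃
    -- Peel off the top factor of `N`: the kernel of `F` onto it is still finitely presented and
    -- maps onto the shorter `T.X₁` with the same kernel `M`.
    exact ih hS' (FinPres.kernel_of_syzygy (SubF.shortExact_ker (g ≫ T.g)) hF hP p hp)

/-! ## The torsion subfunctor -/

theorem FiniteFiltration.range (hQ : ∀ S, Q S → Simple S) {F G : LinFun K A}
    (hF : FiniteFiltration Q F) (f : F ⟶ G) : FiniteFiltration Q (SubF.range f).fn := by
  have : Epi (mkHom (F := F) (G := (SubF.range f).fn) (fun a => (ev f a).rangeRestrict)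
      fun h x => Subtype.ext (ev_act f h x)) :=
    (epi_iff _).2 fun a => LinearMap.surjective_rangeRestrict _
  exact hF.of_epi hQ (mkHom (F := F) (G := (SubF.range f).fn) (fun a => (ev f a).rangeRestrict)
      fun h x => Subtype.ext (ev_act f h x))

/-- The sum is a quotient of `U ⊞ V`. So the filtered subfunctors are directed and their union is a
subfunctor. -/
theorem FiniteFiltration.exists_sup (hQ : ∀ S, Q S → Simple S) {F : LinFun K A} {U V : SubF F}
    (hU : FiniteFiltration Q U.fn) (hV : FiniteFiltration Q V.fn) :
    ∃ W : SubF F, FiniteFiltration Q W.fn ∧ U ≤ W ∧ V ≤ W := by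
  refine ⟨SubF.range (biprod.desc U.ι V.ι),
    (FiniteFiltration.of_shortExact hV (shortExact_biprod _ _) hU).range hQ _, fun a x hx => ?_,
    fun a x hx => ?_⟩
  · exact ⟨ev biprod.inl a (U.mk' x hx), by rw [← ev_comp, biprod.inl_desc]; rfl⟩
  · exact ⟨ev biprod.inr a (V.mk' x hx), by rw [← ev_comp, biprod.inr_desc]; rfl⟩

theorem exists_finiteFiltration_zero (F : LinFun K A) :
    ∃ U : SubF F, FiniteFiltration Q U.fn :=
  ⟨⟨fun _ => ⊥, fun f x hx => by
    rw [Submodule.mem_bot] at hx ⊢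
    rw [hx, map_zero]⟩, .zero _ ((isZero_iff _).2 fun _ x => Subtype.ext x.2)⟩

/-- The union of all subfunctors that are filtered by `Q`. -/
def torsionSub (hQ : ∀ S, Q S → Simple S) (F : LinFun K A) : SubF F where
  carrier a :=
    { carrier := {x | ∃ U : SubF F, FiniteFiltration Q U.fn ∧ x ∈ U.carrier a}
      zero_mem' := by
        obtain ⟨U, hU⟩ := exists_finiteFiltration_zero (Q := Q) F
        exact ⟨U, hU, zero_mem _⟩
      add_mem' := by
        rintro x y ⟨U, hU, hx⟩ ⟨V, hV, hy⟩
        obtain ⟨W, hW, h1, h2⟩ := FiniteFiltration.exists_sup hQ hU hV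
        exact ⟨W, hW, add_mem (h1 a hx) (h2 a hy)⟩
      smul_mem' := by
        rintro r x ⟨U, hU, hx⟩
        exact ⟨U, hU, Submodule.smul_mem _ r hx⟩ }
  act_mem := by
    rintro a b f x ⟨U, hU, hx⟩
    exact ⟨U, hU, U.act_mem f hx⟩

theorem le_torsionSub (hQ : ∀ S, Q S → Simple S) {F : LinFun K A} {U : SubF F}
    (hU : FiniteFiltration Q U.fn) : U ≤ torsionSub hQ F := fun _ _ hx => ⟨U, hU, hx⟩

theorem exists_finiteFiltration_of_finite (hQ : ∀ S, Q S → Simple S) {F : LinFun K A} {m : ℕ}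
    (a : Fin m → A) (x : ∀ i, F.obj.obj (a i))
    (hx : ∀ i, x i ∈ (torsionSub hQ F).carrier (a i)) :
    ∃ U : SubF F, FiniteFiltration Q U.fn ∧ ∀ i, x i ∈ U.carrier (a i) := by
  have : ∀ s : Finset (Fin m), ∃ U : SubF F, FiniteFiltration Q U.fn ∧
      ∀ i ∈ s, x i ∈ U.carrier (a i) := by
    intro s
    induction s using Finset.induction_on with
    | empty =>
      obtain ⟨U, hU⟩ := exists_finiteFiltration_zero (Q := Q) F
      exact ⟨U, hU, by simp⟩
    | insert i s _ ih =>
      obtain ⟨U, hU, h1⟩ := ih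
      obtain ⟨V, hV, h2⟩ := hx i
      obtain ⟨W, hW, h3, h4⟩ := FiniteFiltration.exists_sup hQ hU hV
      refine ⟨W, hW, fun j hj => ?_⟩
      rcases Finset.mem_insert.1 hj with rfl | hj
      · exact h4 _ h2
      · exact h3 _ (h1 j hj)
  obtain ⟨U, hU, h⟩ := this Finset.univ
  exact ⟨U, hU, fun i => h i (Finset.mem_univ i)⟩

theorem SubF.fn_iso_of_le {F : LinFun K A} {U V : SubF F} (h₁ : U ≤ V) (h₂ : V ≤ U) :
    Nonempty (U.fn ≅ V.fn) := by
  have : U = V := SubF.ext (funext fun a => le_antisymm (h₁ a) (h₂ a))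
  exact ⟨eqToIso (this ▸ rfl)⟩

theorem finiteFiltration_torsionSub (hQ : ∀ S, Q S → Simple S) {F : LinFun K A}
    (h : FinGen (torsionSub hQ F).fn) : FiniteFiltration Q (torsionSub hQ F).fn := by
  obtain ⟨m, a, x, hx⟩ := h.exists_generates
  obtain ⟨U, hU, h⟩ := exists_finiteFiltration_of_finite hQ a
    (fun i => ev (torsionSub hQ F).ι _ (x i)) fun i => (torsionSub hQ F).ev_ι_mem (x i)
  refine hU.of_iso (SubF.fn_iso_of_le (le_torsionSub hQ hU) fun b y hy => ?_).some
  exact hx (U.comap (torsionSub hQ F).ι) h b ((torsionSub hQ F).mk' y hy)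

theorem hom_torsionSub_eq_zero (hQ : ∀ S, Q S → Simple S) {F H : LinFun K A}
    (h : ∀ S, Q S → ∀ f : S ⟶ H, f = 0) (f : (torsionSub hQ F).fn ⟶ H) : f = 0 := by
  refine hom_ext' fun a x => ?_
  obtain ⟨U, hU, hx⟩ := (torsionSub hQ F).ev_ι_mem x
  let j : U.fn ⟶ (torsionSub hQ F).fn :=
    mkHom (fun a => Submodule.inclusion (le_torsionSub hQ hU a)) fun _ _ => rfl
  have h1 := congrArg (fun t => ev t a (U.mk' _ hx)) (hU.hom_eq_zero h (j ≫ f))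
  exact h1

/-- The quotient by the torsion subfunctor has no subfunctors in `Q`. -/
theorem hom_quot_torsionSub_eq_zero (hQ : ∀ S, Q S → Simple S) {F S : LinFun K A}
    (hS : Q S) (hS' : FinPres S) (f : S ⟶ (torsionSub hQ F).quot) : f = 0 := by
  obtain ⟨P, p, _, hP, _⟩ := hS'.finGen.exists_cover
  obtain ⟨m, a, x, hx⟩ :=
    (FinPres.finGen_kernel (SubF.shortExact_ker p) hP hS').exists_generates
  let h := Projective.factorThru (p ≫ f) (torsionSub hQ F).π
  have hh : ∀ b y, ev (torsionSub hQ F).π b (ev h b y) = ev f b (ev p b y) := fun b y => by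
    rw [← ev_comp, Projective.factorThru_comp, ev_comp]
  -- The preimage of the image of `S` in `F` contains the whole torsion part, which is not yet known
  -- to be filtered. But `ker p` is finitely generated, so its image under the lift `h` lies in a
  -- single filtered subfunctor `U`.
  obtain ⟨U, hU, hU'⟩ := exists_finiteFiltration_of_finite hQ a
    (fun i => ev h _ (ev (SubF.ker p).ι _ (x i))) fun i => by
      rw [← SubF.ev_π_eq_zero, hh]
      have : ev p _ (ev (SubF.ker p).ι _ (x i)) = 0 := (SubF.ker p).ev_ι_mem (x i)
      rw [this, map_zero]
  have hker : ∀ b y, ev p b y = 0 → ev h b y ∈ U.carrier b := fun b y hy =>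
    hx (U.comap ((SubF.ker p).ι ≫ h)) hU' b ((SubF.ker p).mk' y hy)
  -- `E` is `h(P) + U`. Since `h` sends `ker p` into `U`, the quotient `E/U` is a quotient of `S`;
  -- hence `E` is filtered, lies in the torsion part, and `f` is zero.
  let E := SubF.range (biprod.desc h U.ι)
  have hUE : U ≤ E := fun b y hy =>
    ⟨ev biprod.inr b (U.mk' y hy), by rw [← ev_comp, biprod.inr_desc]; rfl⟩
  have hhE : ∀ b y, ev h b y ∈ E.carrier b := fun b y =>
    ⟨ev biprod.inl b y, by rw [← ev_comp, biprod.inl_desc]⟩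
  let V : SubF E.fn := U.comap E.ι
  let h' : P ⟶ E.fn := mkHom (fun b => (ev h b).codRestrict _ (hhE b))
    fun g y => Subtype.ext (ev_act h g y)
  obtain ⟨q, hq⟩ := exists_desc_of_epi p (h' ≫ V.π) fun b y hy => by
    rw [ev_comp, V.ev_π_eq_zero]
    exact hker b y hy
  have hV : FiniteFiltration Q V.fn := by
    refine hU.of_iso (@asIso _ _ _ _ (mkHom (F := U.fn) (G := V.fn) (fun b =>
      (Submodule.inclusion (hUE b)).codRestrict (V.carrier b) fun y => y.2) fun _ _ => rfl)
      (isIso_of_bijective _ (fun b y z hyz => ?_) fun b y => ⟨⟨y.1.1, y.2⟩, rfl⟩))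
    exact ev_injective U.ι b (congrArg (fun t => ev E.ι b (ev V.ι b t)) hyz)
  have : Epi q := (epi_iff _).2 fun b y => by
    obtain ⟨y, rfl⟩ := ev_surjective V.π b y
    obtain ⟨z, hz⟩ := E.ev_ι_mem y
    refine ⟨ev p b (ev biprod.fst b z), ?_⟩
    have h1 : ev V.π b (ev h' b (ev biprod.fst b z) - y) = 0 := by
      rw [V.ev_π_eq_zero]
      change ev h b (ev biprod.fst b z) - ev E.ι b y ∈ U.carrier b
      rw [← hz, biprod_eq b z, map_add (ev (biprod.desc h U.ι) b), ← ev_comp biprod.inl,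
        ← ev_comp biprod.inr, biprod.inl_desc, biprod.inr_desc]
      simp only [map_add, fst_inl, fst_inr, add_zero]
      rw [sub_add_cancel_left]
      exact neg_mem (U.ev_ι_mem _)
    rw [map_sub, sub_eq_zero] at h1
    rw [← ev_comp, hq, ev_comp, h1]
  have hE : FiniteFiltration Q E.fn :=
    FiniteFiltration.of_shortExact ((finiteFiltration_of_mem S hS).of_epi hQ q) V.shortExact hV
  rw [← cancel_epi p]
  refine hom_ext' fun b y => ?_
  rw [ev_comp, ← hh, comp_zero, ev_zero, SubF.ev_π_eq_zero]
  exact le_torsionSub hQ hE b (hhE b y)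

/-- Because filtered subfunctors are directed, their supremum in the lattice of subobjects is their
elementwise union. -/
theorem torsion_eq (n : ℕ) (F : LinFun K A) :
    torsion n F = Subobject.mk (torsionSub (Q := SimpleInH n) (fun _ h => h.1) F).ι := by
  apply le_antisymm
  · refine sSup_le fun L hL => ?_
    obtain ⟨k, hk⟩ := exists_lift_of_mono (torsionSub (Q := SimpleInH n) (fun _ h => h.1) F).ι
      L.arrow fun a x => ⟨⟨ev L.arrow a x, _, hL.range (fun _ h => h.1) L.arrow, x, rfl⟩, rfl⟩
    exact Subobject.le_mk_of_comm k hk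
  · obtain ⟨k, hk⟩ := exists_lift_of_mono (torsion n F).arrow
      (torsionSub (Q := SimpleInH n) (fun _ h => h.1) F).ι fun a x => by
      obtain ⟨U, hU, hx⟩ := (torsionSub _ F).ev_ι_mem x
      have h1 : Subobject.mk U.ι ≤ torsion n F :=
        le_sSup (show FiniteFiltration _ _ from hU.of_iso (Subobject.underlyingIso U.ι).symm)
      refine ⟨ev (Subobject.ofMkLE _ _ h1) a (U.mk' _ hx), ?_⟩
      rw [← ev_comp, Subobject.ofMkLE_arrow]
      rfl
    exact Subobject.mk_le_of_comm k hk

end Filtrations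

/-! ### Finite generation of the torsion part and coherence -/

section Coherence

variable {K : Type w} [Field K] {A : Type u} [SmallCategory A] [Preadditive A] [Linear K A]

/-- If the elements indexed by `I` generate, then they define an epimorphism from a coproduct of
representable functors. -/
theorem generates_all (F : LinFun K A) :
    Generates (F := F) (fun i : (Σ a : A, F.obj.obj a) => i.1) (fun i => i.2) :=
  fun _ hU b y => hU ⟨b, y⟩

theorem projective_ker_of_le_one {P G : LinFun K A} [Projective P] (p : P ⟶ G) [Epi p]
    [h : HasProjectiveDimensionLE G 1] : Projective (SubF.ker p).fn := by
  have h1 : HasProjectiveDimensionLT (SubF.ker p).fn 1 :=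
    (SubF.shortExact_ker p).hasProjectiveDimensionLT_X₁ 1 inferInstance h
  exact projective_iff_hasProjectiveDimensionLT_one.2 h1

/-- An extension `M'` of `W` by a finitely generated functor is finitely generated if it is
projective and `W` has no nonzero morphisms to representable functors. -/
theorem finGen_of_projective_of_hom_eq_zero {M M' W : LinFun K A} {j : M ⟶ M'} {q : M' ⟶ W}
    {h : j ≫ q = 0} (hS : (ShortComplex.mk j q h).ShortExact) (hM : FinGen M) [Projective M']
    (hW : ∀ (a : A) (f : W ⟶ corep a), f = 0) : FinGen M' := by
  classical
  have := hS.epi_g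
  obtain ⟨m, b, x, hx⟩ := hM.exists_generates
  let a := fun i : (Σ a : A, M'.obj.obj a) => i.1
  let L := fun i : (Σ a : A, M'.obj.obj a) => corep (K := K) (a i)
  let r : ∐ L ⟶ M' := Sigma.desc fun i => ofElement M' i.1 i.2
  have hr : Epi r := (epi_sigma_desc_iff _ _).2 (generates_all M')
  -- `M'` is a retract of a coproduct of representables; the generators of `M` involve only the
  -- finite set `I` of summands.
  let s : M' ⟶ ∐ L := Projective.factorThru (𝟙 M') r
  have hsr : ∀ c y, ev r c (ev s c y) = y := fun c y => by
    rw [← ev_comp, Projective.factorThru_comp, ev_id]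
  choose t ht using fun k => exists_finset_sum_components L (b k) (ev s _ (ev j _ (x k)))
  let I := Finset.univ.biUnion t
  -- Outside `I` the component of `s` vanishes on `M`, so it factors through `W` and is zero. Hence
  -- the summands in `I` already cover `M'`.
  have hI : ∀ i, i ∉ I → s ≫ coprojection L i = 0 := by
    intro i hi
    have h1 : ∀ c y, ev (j ≫ s ≫ coprojection L i) c y = 0 := by
      intro c y
      refine hx (SubF.ker (j ≫ s ≫ coprojection L i)) (fun k => ?_) c y
      rw [SubF.mem_ker, ev_comp, ev_comp, ht k, map_sum]
      refine Finset.sum_eq_zero fun l hl => ?_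
      rw [← ev_comp, ι_coprojection_of_ne L (by
        rintro rfl
        exact hi (Finset.mem_biUnion.2 ⟨k, Finset.mem_univ _, hl⟩)), ev_zero]
    obtain ⟨k, hk⟩ := exists_desc_of_epi q (s ≫ coprojection L i) fun c y hy => by
      obtain ⟨z, rfl⟩ := ShortExact.exact' hS c y hy
      rw [← ev_comp, h1]
    rw [← hk, hW _ k, comp_zero]
  refine finGen_of_generates (ι := I) (a := fun i => a i.1)
    (x := fun i => ev (Sigma.ι L i.1 ≫ r) _ (el (𝟙 _))) fun U hU c y => ?_
  obtain ⟨t', ht'⟩ := exists_finset_sum_components L c (ev s c y)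
  rw [← hsr c y, ht', map_sum]
  refine sum_mem fun i _ => ?_
  by_cases hi : i ∈ I
  · rw [← ev_comp _ r]
    have := ev_corep (Sigma.ι L i ≫ r) (show a i ⟶ c from ev (coprojection L i) c (ev s c y))
    exact this ▸ U.act_mem _ (hU ⟨i, hi⟩)
  · rw [← ev_comp s, hI i hi, ev_zero, map_zero, map_zero]
    exact zero_mem _

variable {Q : ObjectProperty (LinFun K A)}

/-- The kernel of `P → F/tF` is projective by the bound on the dimension, and is an extension of
`tF` by the finitely generated `ker p`; `tF` inherits from its factors that it has no morphisms to
representables. -/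
theorem finGen_torsionSub (hQ : ∀ S, Q S → Simple S)
    (hQ₀ : ∀ S, Q S → ∀ (a : A) (f : S ⟶ corep a), f = 0) {F : LinFun K A} (hF : FinPres F)
    [HasProjectiveDimensionLE (torsionSub hQ F).quot 1] : FinGen (torsionSub hQ F).fn := by
  obtain ⟨P, p, _, hP, _⟩ := hF.finGen.exists_cover
  have hk := FinPres.finGen_kernel (SubF.shortExact_ker p) hP hF
  obtain ⟨j, q, h, hS, -, -⟩ :=
    shortExact_ker_lift (SubF.shortExact_ker p) (torsionSub hQ F).shortExact
  have := projective_ker_of_le_one (p ≫ (torsionSub hQ F).π)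
  have hq : Epi q := hS.epi_g
  exact (finGen_of_projective_of_hom_eq_zero hS hk fun a f =>
    hom_torsionSub_eq_zero hQ (fun S hS => hQ₀ S hS a) f).of_epi q

/-- With `F = P/L`, the kernel `M'` of `P → F/tF` is finitely generated projective and `L` is the
kernel of `M' → tF`, where `tF` has a finite filtration by functors with finitely presented
syzygies. -/
theorem isCoherentCat_of_torsionSub (hQ : ∀ S, Q S → Simple S)
    (hQ₀ : ∀ S, Q S → ∀ (a : A) (f : S ⟶ corep a), f = 0)
    (hQ₂ : ∀ S, Q S → ∃ (P : LinFun K A) (p : P ⟶ S), Projective P ∧ FinGen P ∧ Epi p ∧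
      FinPres (SubF.ker p).fn)
    (h : ∀ F : LinFun K A, FinPres F → HasProjectiveDimensionLE (torsionSub hQ F).quot 1) :
    IsCoherentCat K A := by
  intro P L _ hP hL
  let U := SubF.range L.arrow
  have eU : (L : LinFun K A) ≅ U.fn := @asIso _ _ _ _ (mkHom (fun a => (ev L.arrow a).rangeRestrict)
    fun f x => Subtype.ext (ev_act L.arrow f x)) (isIso_of_bijective _
      (fun a x y h => ev_injective L.arrow a (congrArg (ev U.ι a) h))
      fun a => LinearMap.surjective_rangeRestrict _)
  have hF : FinPres U.quot :=
    FinPres.of_quotient U.shortExact (hL.of_iso eU) (finPres_of_projective hP)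
  have := h _ hF
  have hW := finGen_torsionSub hQ hQ₀ hF
  obtain ⟨j, q, h, hS, -, -⟩ := shortExact_ker_lift U.shortExact (torsionSub hQ U.quot).shortExact
  have := projective_ker_of_le_one (U.π ≫ (torsionSub hQ U.quot).π)
  exact ((finiteFiltration_torsionSub hQ hW).finPres_kernel hQ₂ hS (finPres_of_projective
    (FinGen.of_shortExact hS (hL.of_iso eU) hW))).of_iso eU.symm

/-! ### The Noetherian case -/

/-- A maximal finitely generated subfunctor of `U` is `U` itself, since adjoining one more element
keeps it finitely generated. -/
theorem IsNoetherianCat.finGen_subF (hA : IsNoetherianCat K A) {F : LinFun K A} (hF : FinGen F)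
    (U : SubF F) : FinGen U.fn := by
  have := hA F hF
  have : WellFoundedGT (Subobject F) := inferInstance
  let X : Set (Subobject F) := {L | ∃ V : SubF F, V ≤ U ∧ FinGen V.fn ∧ L = Subobject.mk V.ι}
  obtain ⟨L, ⟨V, hVU, hV, rfl⟩, hmax⟩ := WellFounded.has_min
    (wellFounded_gt (α := Subobject F)) X ⟨_, ⟨fun _ => ⊥, fun f x hx => by
      rw [Submodule.mem_bot] at hx ⊢
      rw [hx, map_zero]⟩, fun a => bot_le,
      finGen_of_isZero ((isZero_iff _).2 fun _ x => Subtype.ext x.2), rfl⟩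
  refine hV.of_iso (SubF.fn_iso_of_le hVU fun a x hx => ?_).some
  let V' := SubF.range (biprod.desc V.ι (ofElement F a x))
  have h1 : V ≤ V' := fun b y hy =>
    ⟨ev biprod.inl b (V.mk' y hy), by rw [← ev_comp, biprod.inl_desc]; rfl⟩
  have h2 : x ∈ V'.carrier a :=
    ⟨ev biprod.inr a (el (𝟙 a)), by rw [← ev_comp, biprod.inr_desc, ev_ofElement_id]⟩
  have h3 : V' ≤ U := by
    rintro b _ ⟨z, rfl⟩
    rw [biprod_eq b z, map_add, ← ev_comp biprod.inl, ← ev_comp biprod.inr, biprod.inl_desc,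
      biprod.inr_desc]
    exact add_mem (hVU b (V.ev_ι_mem _)) (U.act_mem _ hx)
  have h4 : FinGen V'.fn :=
    (FinGen.of_shortExact (shortExact_biprod V.fn (corep a)) hV (finGen_corep a)).of_surjective
      (mkHom (fun b => (ev (biprod.desc V.ι (ofElement F a x)) b).rangeRestrict)
        fun f y => Subtype.ext (ev_act _ f y)) fun b => LinearMap.surjective_rangeRestrict _
  have h5 : Subobject.mk V.ι ≤ Subobject.mk V'.ι := Subobject.mk_le_mk_of_comm
    (mkHom (fun b => Submodule.inclusion (h1 b)) fun _ _ => rfl) rfl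
  have h6 : Subobject.mk V'.ι ≤ Subobject.mk V.ι := by
    by_contra h7
    exact hmax _ ⟨V', h3, h4, rfl⟩ (lt_of_le_not_ge h5 h7)
  have h7 := congrArg (fun t => ev t a (V'.mk' x h2)) (Subobject.ofMkLEMk_comp h6)
  have h8 : ev V.ι a (ev (Subobject.ofMkLEMk V'.ι V.ι h6) a (V'.mk' x h2)) = x := h7
  rw [← h8]
  exact V.ev_ι_mem _

theorem IsNoetherianCat.isCoherentCat (hA : IsNoetherianCat K A) : IsCoherentCat K A := by
  intro P L _ _ hL
  obtain ⟨P', p, _, hP', _⟩ := hL.exists_cover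
  exact finPres_of_cover hP' p (hA.finGen_subF hP' _)

/-! ### Resolutions by finitely generated projectives -/

/-- The beginning of a resolution by finitely generated projectives. -/
theorem exists_resolution {F : LinFun K A}
    (h : ∃ P : ProjectiveResolution F, ∀ i, FinGen (P.complex.X i)) :
    ∃ (P : LinFun K A) (p : P ⟶ F), Projective P ∧ FinGen P ∧ Epi p ∧
      ∃ (P' : LinFun K A) (p' : P' ⟶ (SubF.ker p).fn), Projective P' ∧ FinGen P' ∧ Epi p' ∧
        FinGen (SubF.ker p').fn := by
  obtain ⟨R, hR⟩ := h
  let p : R.complex.X 0 ⟶ F := R.π.f 0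
  have hp : Epi p := inferInstanceAs (Epi (R.π.f 0))
  refine ⟨R.complex.X 0, p, R.projective 0, hR 0, hp, R.complex.X 1, ?_⟩
  have h0 : ∀ a x, ev p a x = 0 → ∃ y, ev (R.complex.d 1 0) a y = x := (exact_iff _).1 R.exact₀
  have h1 := (exact_iff _).1 (R.exact_succ 0)
  obtain ⟨k, hk⟩ := exists_lift_of_mono (SubF.ker p).ι (R.complex.d 1 0) fun a x =>
    ⟨(SubF.ker p).mk' _
      (congrArg (fun t => ev t a x) R.complex_d_comp_π_f_zero), rfl⟩
  have hk' : ∀ a x, ev (SubF.ker p).ι a (ev k a x) = ev (R.complex.d 1 0) a x :=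
    fun a x => by rw [← ev_comp, hk]
  refine ⟨k, R.projective 1, hR 1, (epi_iff k).2 fun a x => ?_, ?_⟩
  · obtain ⟨y, hy⟩ := h0 a (ev (SubF.ker p).ι a x) ((SubF.ker p).ev_ι_mem x)
    exact ⟨y, ev_injective (SubF.ker p).ι a ((hk' a y).trans hy)⟩
  · obtain ⟨l, hl⟩ := exists_lift_of_mono (SubF.ker k).ι (R.complex.d 2 1) fun a x =>
      ⟨(SubF.ker k).mk' (ev (R.complex.d 2 1) a x) (ev_injective (SubF.ker p).ι a (by
        rw [hk', map_zero]
        exact congrArg (fun t => ev t a x) (R.complex.d_comp_d 2 1 0))), rfl⟩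
    refine (hR 2).of_surjective l fun a x => ?_
    obtain ⟨y, hy⟩ := h1 a (ev (SubF.ker k).ι a x) (by
      have h2 : ev k a (ev (SubF.ker k).ι a x) = 0 := (SubF.ker k).ev_ι_mem x
      change ev (R.complex.d 1 0) a _ = 0
      rw [← hk', h2, map_zero])
    refine ⟨y, ev_injective (SubF.ker k).ι a ?_⟩
    exact (congrArg (fun t => ev t a y) hl).trans hy

theorem InH.finPres_syzygy {n : ℕ} {S : LinFun K A} (hS : InH n S) :
    ∃ (P : LinFun K A) (p : P ⟶ S), Projective P ∧ FinGen P ∧ Epi p ∧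
      FinPres (SubF.ker p).fn := by
  obtain ⟨P, p, h1, h2, h3, P', p', h4, h5, h6, h7⟩ := exists_resolution hS.2.1
  exact ⟨P, p, h1, h2, h3, finPres_of_cover h5 p' h7⟩

theorem InH.ext_eq_zero {n : ℕ} {S : LinFun K A} (hS : InH n S) {i : ℕ} (hi : i ≠ n) (a : A)
    (e : Abelian.Ext.{u} S (corep a) i) : e = 0 :=
  (isZero_iff _).1 (hS.2.2 i hi) (op a) e

theorem InH.hom_eq_zero {n : ℕ} {S : LinFun K A} (hS : InH n S) (hn : 0 ≠ n) (a : A)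
    (f : S ⟶ corep a) : f = 0 := by
  have := hS.ext_eq_zero hn a (Abelian.Ext.mk₀ f)
  rwa [Abelian.Ext.mk₀_eq_zero_iff] at this

end Coherence

/-! ### Dimension shifting for the vanishing of `Ext` -/

section ExtLemmas

open Abelian

universe w' v' u'

variable {D : Type u'} [Category.{v'} D] [Abelian D] [HasExt.{w'} D]

theorem exists_eq_mk₀ {X Y : D} (e : Ext.{w'} X Y 0) : ∃ f : X ⟶ Y, e = Ext.mk₀ f :=
  ⟨Ext.homEquiv₀ e, (Ext.mk₀_homEquiv₀_apply e).symm⟩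

variable {S : ShortComplex D} (hS : S.ShortExact)

include hS

theorem ext_contravariant_shift [Projective S.X₂] (Y : D) (n : ℕ) :
    (∀ e : Ext.{w'} S.X₁ Y (n + 1), e = 0) ↔ ∀ e : Ext.{w'} S.X₃ Y (n + 2), e = 0 := by
  constructor
  · intro h e
    obtain ⟨x, rfl⟩ := Ext.contravariant_sequence_exact₃ hS Y e (Ext.eq_zero_of_projective _)
      (show 1 + (n + 1) = n + 2 by omega)
    rw [h x, Ext.comp_zero]
  · intro h e
    obtain ⟨x, rfl⟩ := Ext.contravariant_sequence_exact₁ hS Y e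
      (show 1 + (n + 1) = n + 2 by omega) (h _)
    rw [Ext.eq_zero_of_projective x, Ext.comp_zero]

/-- `Ext¹` is the obstruction to extending morphisms from the syzygy to the projective term.
Phrasing it as vanishing avoids comparing `Ext` groups. -/
theorem ext_contravariant_one [Projective S.X₂] (Y : D) :
    (∀ f : S.X₁ ⟶ Y, ∃ g : S.X₂ ⟶ Y, S.f ≫ g = f) ↔ ∀ e : Ext.{w'} S.X₃ Y 1, e = 0 := by
  constructor
  · intro h e
    obtain ⟨x, rfl⟩ := Ext.contravariant_sequence_exact₃ hS Y e (Ext.eq_zero_of_projective _)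
      (add_zero 1)
    obtain ⟨f, rfl⟩ := exists_eq_mk₀ x
    obtain ⟨g, rfl⟩ := h f
    rw [← Ext.mk₀_comp_mk₀, ← Ext.comp_assoc _ _ _ (add_zero 1) (zero_add 0) (by omega),
      hS.extClass_comp, Ext.zero_comp]
  · intro h f
    obtain ⟨x, hx⟩ := Ext.contravariant_sequence_exact₁ hS Y (Ext.mk₀ f) (add_zero 1) (h _)
    obtain ⟨g, rfl⟩ := exists_eq_mk₀ x
    refine ⟨g, ?_⟩
    rw [Ext.mk₀_comp_mk₀] at hx
    exact (Ext.mk₀_bijective _ _).1 hx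

theorem ext_covariant_shift [Injective S.X₂] (X : D) (n : ℕ) :
    (∀ e : Ext.{w'} X S.X₃ (n + 1), e = 0) ↔ ∀ e : Ext.{w'} X S.X₁ (n + 2), e = 0 := by
  constructor
  · intro h e
    obtain ⟨x, rfl⟩ := Ext.covariant_sequence_exact₁ X hS e (Ext.eq_zero_of_injective _)
      (show (n + 1) + 1 = n + 2 by omega)
    rw [h x, Ext.zero_comp]
  · intro h e
    obtain ⟨x, rfl⟩ := Ext.covariant_sequence_exact₃ X hS e
      (show (n + 1) + 1 = n + 2 by omega) (h _)
    rw [Ext.eq_zero_of_injective x, Ext.zero_comp]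

theorem ext_covariant_one [Injective S.X₂] (X : D) :
    (∀ f : X ⟶ S.X₃, ∃ g : X ⟶ S.X₂, g ≫ S.g = f) ↔ ∀ e : Ext.{w'} X S.X₁ 1, e = 0 := by
  constructor
  · intro h e
    obtain ⟨x, rfl⟩ := Ext.covariant_sequence_exact₁ X hS e (Ext.eq_zero_of_injective _)
      (zero_add 1)
    obtain ⟨f, rfl⟩ := exists_eq_mk₀ x
    obtain ⟨g, rfl⟩ := h f
    rw [← Ext.mk₀_comp_mk₀, Ext.comp_assoc _ _ _ (zero_add 0) (zero_add 1) (by omega),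
      hS.comp_extClass, Ext.comp_zero]
  · intro h f
    obtain ⟨x, hx⟩ := Ext.covariant_sequence_exact₃ X hS (Ext.mk₀ f) (zero_add 1) (h _)
    obtain ⟨g, rfl⟩ := exists_eq_mk₀ x
    refine ⟨g, ?_⟩
    rw [Ext.mk₀_comp_mk₀] at hx
    exact (Ext.mk₀_bijective _ _).1 hx

end ExtLemmas

section Duality

variable {K : Type w} [Field K] {B : Type u} [SmallCategory B] [Preadditive B] [Linear K B]
  (E : ModuleCat.{u} K)

/-! ## The dual functors with respect to a vector space -/

/-- The functor `b ↦ Hom_K(L(b), E)` on `Bᵒᵖ`. -/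
def dual (L : LinFun K B) : LinFun K Bᵒᵖ :=
  mkFun (fun b => ModuleCat.of K (L.obj.obj b.unop →ₗ[K] E))
    (fun f => LinearMap.lcomp K E (act L f.unop))
    (fun b φ => LinearMap.ext fun x => congrArg φ (act_id L b.unop x))
    (fun f g φ => LinearMap.ext fun x => congrArg φ (act_comp L g.unop f.unop x))
    (fun f g φ => LinearMap.ext fun x =>
      (congrArg φ (act_add L f.unop g.unop x)).trans (φ.map_add _ _))
    (fun r f φ => LinearMap.ext fun x =>
      (congrArg φ (act_smul L r f.unop x)).trans (φ.map_smul _ _))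

/-- The functor `b ↦ Hom_K(F(b), E)` on `B`. -/
def dualOp (F : LinFun K Bᵒᵖ) : LinFun K B :=
  mkFun (fun b => ModuleCat.of K (F.obj.obj (op b) →ₗ[K] E))
    (fun f => LinearMap.lcomp K E (act F f.op))
    (fun b φ => LinearMap.ext fun x => congrArg φ (act_id F (op b) x))
    (fun f g φ => LinearMap.ext fun x => congrArg φ (act_comp F g.op f.op x))
    (fun f g φ => LinearMap.ext fun x =>
      (congrArg φ (act_add F f.op g.op x)).trans (φ.map_add _ _))
    (fun r f φ => LinearMap.ext fun x =>
      (congrArg φ (act_smul F r f.op x)).trans (φ.map_smul _ _))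

/-- The linear map given by an element of a dual. -/
def dual.fn {E : ModuleCat.{u} K} {L : LinFun K B} {b : Bᵒᵖ} (φ : (dual E L).obj.obj b) :
    L.obj.obj b.unop →ₗ[K] E := φ

/-- The linear map given by an element of a dual. -/
def dualOp.fn {E : ModuleCat.{u} K} {F : LinFun K Bᵒᵖ} {b : B} (φ : (dualOp E F).obj.obj b) :
    F.obj.obj (op b) →ₗ[K] E := φ

/-- The action of `dual` on natural transformations. -/
def dualMap {L M : LinFun K B} (f : L ⟶ M) : dual E M ⟶ dual E L :=
  mkHom (fun b => LinearMap.lcomp K E (ev f b.unop)) fun g φ =>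
    LinearMap.ext fun x => congrArg (dual.fn φ) (ev_act f g.unop x).symm

/-- The action of `dualOp` on natural transformations. -/
def dualOpMap {F G : LinFun K Bᵒᵖ} (f : F ⟶ G) : dualOp E G ⟶ dualOp E F :=
  mkHom (fun b => LinearMap.lcomp K E (ev f (op b))) fun g φ =>
    LinearMap.ext fun x => congrArg (dualOp.fn φ) (ev_act f g.op x).symm

/-- Over a field the injection `V/ker f → W` has a left inverse. This makes both dual functors
exact, for every `E`. -/
theorem exists_comp_eq_of_ker_le {V W : Type*} [AddCommGroup V] [Module K V] [AddCommGroup W]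
    [Module K W] {X : Type*} [AddCommGroup X] [Module K X] (f : V →ₗ[K] W) (φ : V →ₗ[K] X)
    (h : ∀ x, f x = 0 → φ x = 0) : ∃ ψ : W →ₗ[K] X, ∀ x, ψ (f x) = φ x := by
  obtain ⟨g, hg⟩ := ((LinearMap.ker f).liftQ f le_rfl).exists_leftInverse_of_injective
    (LinearMap.ker_eq_bot.2 (LinearMap.ker_eq_bot.1 (Submodule.ker_liftQ_eq_bot _ _ _ le_rfl)))
  refine ⟨((LinearMap.ker f).liftQ φ h) ∘ₗ g, fun x => ?_⟩
  have h1 := LinearMap.congr_fun hg (Submodule.Quotient.mk x)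
  simp only [LinearMap.comp_apply, Submodule.liftQ_apply, LinearMap.id_apply] at h1 ⊢
  rw [h1]
  rfl

theorem dualMap_shortExact {S : ShortComplex (LinFun K B)} (hS : S.ShortExact) :
    ∃ h, (ShortComplex.mk (dualMap E S.g) (dualMap E S.f) h).ShortExact := by
  have := hS.epi_g
  have := hS.mono_f
  refine ⟨_, shortExact_of _ _ (fun b φ ψ h => ?_) (fun b φ => ?_) (fun b φ => ?_)
    fun b φ hφ => ?_⟩
  · refine LinearMap.ext fun x => ?_
    obtain ⟨y, rfl⟩ := ev_surjective S.g b.unop x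
    exact LinearMap.congr_fun h y
  · obtain ⟨ψ, hψ⟩ := exists_comp_eq_of_ker_le (ev S.f b.unop) (dual.fn φ) fun x hx => by
      rw [ev_injective S.f b.unop (hx.trans (map_zero _).symm), map_zero]
    exact ⟨ψ, LinearMap.ext hψ⟩
  · exact LinearMap.ext fun x =>
      (congrArg (dual.fn φ) (ev_zero' S b.unop x)).trans (map_zero (dual.fn φ))
  · obtain ⟨ψ, hψ⟩ := exists_comp_eq_of_ker_le (ev S.g b.unop) (dual.fn φ) fun x hx => by
      obtain ⟨y, rfl⟩ := ShortExact.exact' hS b.unop x hx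
      exact LinearMap.congr_fun hφ y
    exact ⟨ψ, LinearMap.ext hψ⟩

instance dualOpMap_epi {F G : LinFun K Bᵒᵖ} (f : F ⟶ G) [Mono f] : Epi (dualOpMap E f) :=
  (epi_iff _).2 fun b φ => by
    obtain ⟨ψ, hψ⟩ := exists_comp_eq_of_ker_le (ev f (op b)) (dualOp.fn φ) fun x hx => by
      rw [ev_injective f (op b) (hx.trans (map_zero _).symm), map_zero]
    exact ⟨ψ, LinearMap.ext hψ⟩

/-- The adjunction between the two dual functors. -/
def dualAdj (F : LinFun K Bᵒᵖ) (L : LinFun K B) : (F ⟶ dual E L) ≃ (L ⟶ dualOp E F) where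
  toFun f := mkHom (fun b => (ev f (op b)).flip) fun {b c} g x => by
    refine LinearMap.ext fun y => ?_
    have := LinearMap.congr_fun (ev_act f g.op y) x
    exact this.symm
  invFun f := mkHom (fun b => (ev f b.unop).flip) fun {b c} g x => by
    refine LinearMap.ext fun y => ?_
    have := LinearMap.congr_fun (ev_act f g.unop y) x
    exact this.symm
  left_inv f := rfl
  right_inv f := rfl

theorem dualAdj_dualMap {F : LinFun K Bᵒᵖ} {L M : LinFun K B} (f : F ⟶ dual E M) (g : L ⟶ M) :
    dualAdj E F L (f ≫ dualMap E g) = g ≫ dualAdj E F M f := rfl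

theorem dualAdj_symm_comp {F G : LinFun K Bᵒᵖ} {L : LinFun K B} (f : L ⟶ dualOp E G) (g : F ⟶ G) :
    (dualAdj E F L).symm (f ≫ dualOpMap E g) = g ≫ (dualAdj E G L).symm f := rfl

/-- By the adjunction, extending a morphism into `dual E P` along `i` amounts to lifting a morphism
from `P` along the epimorphism `dualOpMap E i`. -/
instance dual_injective (P : LinFun K B) [Projective P] : Injective (dual E P) where
  factors {F G} f i hi := by
    let g := Projective.factorThru (dualAdj E F P f) (dualOpMap E i)
    refine ⟨(dualAdj E G P).symm g, ?_⟩
    rw [← dualAdj_symm_comp, Projective.factorThru_comp, Equiv.symm_apply_apply]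

/-- `Ext^n(F, D L)` vanishes if and only if `Ext^n(L, D F)` vanishes. -/
theorem ext_dual_eq_zero_iff (F : LinFun K Bᵒᵖ) (n : ℕ) : ∀ L : LinFun K B,
    (∀ e : Abelian.Ext.{u} F (dual E L) (n + 1), e = 0) ↔
      ∀ e : Abelian.Ext.{u} L (dualOp E F) (n + 1), e = 0 := by
  induction n with
  | zero =>
    intro L
    -- A projective presentation of `L` dualizes to an injective copresentation of `dual E L`. The
    -- two `Ext¹` groups are then obstructions to an extension and to a lifting problem, which the
    -- adjunction exchanges.
    have hS := SubF.shortExact_ker (Projective.π L)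
    obtain ⟨h, hD⟩ := dualMap_shortExact E hS
    have hI : Injective (dual E (Projective.over L)) := dual_injective E _
    have h1 := ext_contravariant_one.{u} (S := ShortComplex.mk _ (Projective.π L) _) hS
      (dualOp E F)
    have h2 := ext_covariant_one.{u} (S := ShortComplex.mk (dualMap E (Projective.π L)) _ h) hD F
    rw [zero_add, ← h1, ← h2]
    constructor
    · intro H f
      obtain ⟨g, hg⟩ := H ((dualAdj E _ _).symm f)
      exact ⟨dualAdj E _ _ g, by rw [← dualAdj_dualMap, hg, Equiv.apply_symm_apply]⟩
    · intro H f
      obtain ⟨g, hg⟩ := H (dualAdj E _ _ f)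
      refine ⟨(dualAdj E _ _).symm g, ?_⟩
      apply (dualAdj E _ _).injective
      rw [dualAdj_dualMap, Equiv.apply_symm_apply, hg]
  | succ n ih =>
    intro L
    have hS := SubF.shortExact_ker (Projective.π L)
    obtain ⟨h, hD⟩ := dualMap_shortExact E hS
    have hI : Injective (dual E (Projective.over L)) := dual_injective E _
    have h1 := ext_contravariant_shift.{u} (S := ShortComplex.mk _ (Projective.π L) _) hS
      (dualOp E F) n
    have h2 := ext_covariant_shift.{u} (S := ShortComplex.mk (dualMap E (Projective.π L)) _ h)
      hD F n
    exact h2.symm.trans ((ih _).trans h1)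

end Duality

/-! ### Resolutions of length two and `Ext²` -/

section TwoStep

open Abelian

universe w' v' u'

variable {D : Type u'} [Category.{v'} D] [Abelian D] [HasExt.{w'} D]

/-- A resolution of length two with projective terms in degrees zero and one, presented by two short
exact sequences. -/
structure TwoStep (X : D) where
  {P₀ P₁ P₂ Ω : D}
  ε : P₀ ⟶ X
  i : Ω ⟶ P₀
  p : P₁ ⟶ Ω
  d : P₂ ⟶ P₁
  zero₁ : i ≫ ε = 0
  zero₂ : d ≫ p = 0
  exact₁ : (ShortComplex.mk i ε zero₁).ShortExact
  exact₂ : (ShortComplex.mk d p zero₂).ShortExact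
  proj₀ : Projective P₀
  proj₁ : Projective P₁

namespace TwoStep

variable {X : D} (R : TwoStep X)

/-- The class of a two step resolution in `Ext²`. -/
def cls : Ext.{w'} X R.P₂ 2 := R.exact₁.extClass.comp R.exact₂.extClass rfl

/-- Shifting twice, `Ext²(X, Y)` is `Hom(P₂, Y)` modulo the morphisms that extend to `P₁`; this and
`cls_comp_eq_zero_iff` are the two halves. Projectivity of `P₂` plays no role. -/
theorem exists_eq_cls_comp {Y : D} (e : Ext.{w'} X Y 2) :
    ∃ φ : R.P₂ ⟶ Y, R.cls.comp (Ext.mk₀ φ) (add_zero 2) = e := by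
  have := R.proj₀
  have := R.proj₁
  obtain ⟨x, rfl⟩ := Ext.contravariant_sequence_exact₃ R.exact₁ Y e
    (Ext.eq_zero_of_projective _) (show 1 + 1 = 2 from rfl)
  obtain ⟨y, rfl⟩ := Ext.contravariant_sequence_exact₃ R.exact₂ Y x
    (Ext.eq_zero_of_projective _) (add_zero 1)
  obtain ⟨φ, rfl⟩ := exists_eq_mk₀ y
  exact ⟨φ, Ext.comp_assoc _ _ _ rfl (add_zero 1) (by omega)⟩

theorem cls_comp_eq_zero_iff {Y : D} (φ : R.P₂ ⟶ Y) :
    R.cls.comp (Ext.mk₀ φ) (add_zero 2) = (0 : Ext.{w'} X Y 2) ↔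
      ∃ g : R.P₁ ⟶ Y, R.d ≫ g = φ := by
  have := R.proj₀
  have := R.proj₁
  have h : R.cls.comp (Ext.mk₀ φ) (add_zero 2) = R.exact₁.extClass.comp
      (R.exact₂.extClass.comp (Ext.mk₀ φ) (add_zero 1)) (show 1 + 1 = 2 from rfl) :=
    Ext.comp_assoc _ _ _ rfl (add_zero 1) (by omega)
  rw [h]
  constructor
  · intro h0
    obtain ⟨y, hy⟩ := Ext.contravariant_sequence_exact₁ R.exact₁ Y _ _ h0
    rw [Ext.eq_zero_of_projective y, Ext.comp_zero] at hy
    obtain ⟨z, hz⟩ := Ext.contravariant_sequence_exact₁ R.exact₂ Y (Ext.mk₀ φ) _ hy.symm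
    obtain ⟨g, rfl⟩ := exists_eq_mk₀ z
    rw [Ext.mk₀_comp_mk₀] at hz
    exact ⟨g, (Ext.mk₀_bijective _ _).1 hz⟩
  · rintro ⟨g, rfl⟩
    rw [← Ext.mk₀_comp_mk₀, ← Ext.comp_assoc R.exact₂.extClass _ _ (add_zero 1) (zero_add 0)
      (by omega), R.exact₂.extClass_comp, Ext.zero_comp, Ext.comp_zero]

/-- Comparison of two step resolutions. -/
theorem exists_hom {X' : D} (R' : TwoStep X') (s : X ⟶ X') :
    ∃ (c₁ : R.P₁ ⟶ R'.P₁) (c₂ : R.P₂ ⟶ R'.P₂), R.d ≫ c₁ = c₂ ≫ R'.d ∧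
      R.cls.comp (Ext.mk₀ c₂) (add_zero 2) =
        (Ext.mk₀ s).comp R'.cls (zero_add 2 : 0 + 2 = 2) := by
  have := R.proj₀
  have := R.proj₁
  have := R'.exact₁.epi_g
  have := R'.exact₂.epi_g
  have := R'.exact₁.mono_f
  have := R'.exact₂.mono_f
  let c₀ : R.P₀ ⟶ R'.P₀ := Projective.factorThru (R.ε ≫ s) R'.ε
  have h₀ : c₀ ≫ R'.ε = R.ε ≫ s := Projective.factorThru_comp _ _
  let t : R.Ω ⟶ R'.Ω := R'.exact₁.exact.lift (R.i ≫ c₀) (by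
    change (R.i ≫ c₀) ≫ R'.ε = 0
    rw [Category.assoc, h₀, ← Category.assoc, R.zero₁, zero_comp])
  have ht : t ≫ R'.i = R.i ≫ c₀ := R'.exact₁.exact.lift_f _ _
  let c₁ : R.P₁ ⟶ R'.P₁ := Projective.factorThru (R.p ≫ t) R'.p
  have h₁ : c₁ ≫ R'.p = R.p ≫ t := Projective.factorThru_comp _ _
  let c₂ : R.P₂ ⟶ R'.P₂ := R'.exact₂.exact.lift (R.d ≫ c₁) (by
    change (R.d ≫ c₁) ≫ R'.p = 0
    rw [Category.assoc, h₁, ← Category.assoc, R.zero₂, zero_comp])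
  have h₂ : c₂ ≫ R'.d = R.d ≫ c₁ := R'.exact₂.exact.lift_f _ _
  refine ⟨c₁, c₂, h₂.symm, ?_⟩
  -- The comparison is a pair of morphisms of short exact sequences sharing `t`; naturality of both
  -- extension classes gives the identity for their Yoneda product.
  let f₁ : ShortComplex.mk R.i R.ε R.zero₁ ⟶ ShortComplex.mk R'.i R'.ε R'.zero₁ :=
    { τ₁ := t, τ₂ := c₀, τ₃ := s, comm₁₂ := ht, comm₂₃ := h₀ }
  let f₂ : ShortComplex.mk R.d R.p R.zero₂ ⟶ ShortComplex.mk R'.d R'.p R'.zero₂ :=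
    { τ₁ := c₂, τ₂ := c₁, τ₃ := t, comm₁₂ := h₂, comm₂₃ := h₁ }
  have n₁ := ShortComplex.ShortExact.extClass_naturality.{w'} R.exact₁ R'.exact₁ f₁
  have n₂ := ShortComplex.ShortExact.extClass_naturality.{w'} R.exact₂ R'.exact₂ f₂
  change R.exact₁.extClass.comp (Ext.mk₀ t) _ = (Ext.mk₀ s).comp R'.exact₁.extClass _ at n₁
  change R.exact₂.extClass.comp (Ext.mk₀ c₂) _ = (Ext.mk₀ t).comp R'.exact₂.extClass _ at n₂
  rw [cls, Ext.comp_assoc _ _ _ rfl (add_zero 1) (by omega), n₂,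
    ← Ext.comp_assoc _ _ _ (add_zero 1) (zero_add 1) (by omega), n₁,
    Ext.comp_assoc _ _ _ (zero_add 1) rfl (by omega)]
  rfl

/-- If `s : X ⟶ X'` is a monomorphism and `Ext³` of its cokernel vanishes, then every morphism on
the last term of a resolution of `X` comes from a resolution of `X'`, up to morphisms that extend. -/
theorem exists_eq_add {X' Z : D} (R' : TwoStep X') {s : X ⟶ X'} {q : X' ⟶ Z} {h₀ : s ≫ q = 0}
    (hs : (ShortComplex.mk s q h₀).ShortExact) {c₂ : R.P₂ ⟶ R'.P₂}
    (hc : R.cls.comp (Ext.mk₀ c₂) (add_zero 2) =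
        (Ext.mk₀ s).comp R'.cls (zero_add 2 : 0 + 2 = 2)) {Y : D}
    (hZ : ∀ e : Ext.{w'} Z Y 3, e = 0) (φ : R.P₂ ⟶ Y) :
    ∃ (ω : R'.P₂ ⟶ Y) (g : R.P₁ ⟶ Y), φ = c₂ ≫ ω + R.d ≫ g := by
  -- Since `Ext³(Z, Y) = 0`, restriction `Ext²(X', Y) → Ext²(X, Y)` is onto, so the class of `φ` is
  -- the restriction of a class represented by some `ω`. Then `φ - c₂ ≫ ω` has zero class and
  -- extends to `P₁`.
  obtain ⟨x, hx⟩ := Ext.contravariant_sequence_exact₁ hs Y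
    (R.cls.comp (Ext.mk₀ φ) (add_zero 2)) (show 1 + 2 = 3 from rfl) (hZ _)
  obtain ⟨ω, rfl⟩ := R'.exists_eq_cls_comp x
  change (Ext.mk₀ s).comp _ _ = _ at hx
  rw [← Ext.comp_assoc _ _ _ (zero_add 2) (add_zero 2) (by omega), ← hc,
    Ext.comp_assoc _ _ _ (add_zero 2) (add_zero 0) (by omega), Ext.mk₀_comp_mk₀] at hx
  have h : R.cls.comp (Ext.mk₀ (φ - c₂ ≫ ω)) (add_zero 2) = (0 : Ext.{w'} X Y 2) := by
    rw [sub_eq_add_neg, Ext.mk₀_add, Ext.mk₀_neg, Ext.comp_add, Ext.comp_neg, hx, add_neg_cancel]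
  obtain ⟨g, hg⟩ := (R.cls_comp_eq_zero_iff _).1 h
  exact ⟨ω, g, by rw [hg, add_sub_cancel]⟩

end TwoStep

end TwoStep

/-! ### Duals of projective functors and dual bases -/

section Star

variable {K : Type w} [Field K] {A : Type u} [SmallCategory A] [Preadditive A] [Linear K A]

/-- Projective dimension at most two makes the second syzygy of the given resolution projective, so
the resolution can be cut there. -/
theorem TwoStep.exists_of_resolution {F : LinFun K A}
    (h : ∃ P : ProjectiveResolution F, ∀ i, FinGen (P.complex.X i))
    (h₂ : HasProjectiveDimensionLE F 2) :
    ∃ R : TwoStep F, Projective R.P₂ ∧ FinGen R.P₀ ∧ FinGen R.P₁ ∧ FinGen R.P₂ := by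
  obtain ⟨P, p, h0, h1, h2, P', p', h3, h4, h5, h6⟩ := exists_resolution h
  refine ⟨⟨p, _, p', _, _, _, SubF.shortExact_ker p, SubF.shortExact_ker p', h0, h3⟩, ?_, h1, h4,
    h6⟩
  have e1 : HasProjectiveDimensionLT (SubF.ker p).fn 2 :=
    (SubF.shortExact_ker p).hasProjectiveDimensionLT_X₁ 2 inferInstance h₂
  have e2 : HasProjectiveDimensionLT (SubF.ker p').fn 1 :=
    (SubF.shortExact_ker p').hasProjectiveDimensionLT_X₁ 1 inferInstance e1
  exact projective_iff_hasProjectiveDimensionLT_one.2 e2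

/-- A dual basis of a finitely generated projective functor. -/
theorem exists_dual_basis {P : LinFun K A} [Projective P] (hP : FinGen P) :
    ∃ (m : ℕ) (a : Fin m → A) (x : ∀ i, P.obj.obj (a i)) (ξ : ∀ i, P ⟶ corep (a i)),
      ∑ i, ξ i ≫ ofElement P (a i) (x i) = 𝟙 P := by
  obtain ⟨m, a, x, hx⟩ := hP.exists_generates
  let L := fun i => corep (K := K) (a i)
  let p : ∐ L ⟶ P := Sigma.desc fun i => ofElement P (a i) (x i)
  have hp : Epi p := (epi_sigma_desc_iff _ _).2 hx
  let s : P ⟶ ∐ L := Projective.factorThru (𝟙 P) p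
  have hs : s ≫ p = 𝟙 P := Projective.factorThru_comp _ _
  refine ⟨m, a, x, fun i => s ≫ coprojection L i, ?_⟩
  have h1 : ∑ i, coprojection L i ≫ Sigma.ι L i = 𝟙 (∐ L) := by
    apply Sigma.hom_ext
    intro j
    rw [Preadditive.comp_sum, Finset.sum_eq_single j]
    · rw [← Category.assoc, ι_coprojection_self, Category.id_comp, Category.comp_id]
    · intro i _ hi
      rw [← Category.assoc, ι_coprojection_of_ne L hi.symm, zero_comp]
    · simp
  have h2 : ∀ i, Sigma.ι L i ≫ p = ofElement P (a i) (x i) := fun i => Sigma.ι_desc _ _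
  calc _ = s ≫ (∑ i, coprojection L i ≫ Sigma.ι L i) ≫ p := by
        rw [Preadditive.sum_comp, Preadditive.comp_sum]
        exact Finset.sum_congr rfl fun i _ => by rw [Category.assoc, Category.assoc, h2]
    _ = 𝟙 P := by rw [h1, Category.id_comp, hs]

theorem corepMap_ofElement {a b : A} (F : LinFun K A) (f : a ⟶ b) (x : F.obj.obj a) :
    corepMap f ≫ ofElement F a x = ofElement F b (act F f x) :=
  hom_ext' fun c g => act_comp F f (show b ⟶ c from g) x

theorem dual_basis_hom {P : LinFun K A} {m : ℕ} {a : Fin m → A} {x : ∀ i, P.obj.obj (a i)}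
    {ξ : ∀ i, P ⟶ corep (a i)} (h : ∑ i, ξ i ≫ ofElement P (a i) (x i) = 𝟙 P) {F : LinFun K A}
    (η : P ⟶ F) : η = ∑ i, ξ i ≫ ofElement F (a i) (ev η _ (x i)) := by
  conv_lhs => rw [← Category.id_comp η, ← h, Preadditive.sum_comp]
  exact Finset.sum_congr rfl fun i _ => by rw [Category.assoc, ofElement_comp]

variable {A' : Type u} [SmallCategory A'] [Preadditive A'] [Linear K A']
  (H : A' ⥤ LinFun K A) [H.Additive] [H.Linear K]

/-- The functor `a ↦ Hom(P, H(a))`. -/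
def star (P : LinFun K A) : LinFun K A' :=
  mkFun (fun a => ModuleCat.of K (P ⟶ H.obj a)) (fun f => Linear.rightComp K P (H.map f))
    (fun a x => by
      change x ≫ H.map (𝟙 a) = x
      rw [H.map_id, Category.comp_id])
    (fun f g x => by
      change x ≫ H.map (f ≫ g) = (x ≫ H.map f) ≫ H.map g
      rw [H.map_comp, Category.assoc])
    (fun f g x => by
      change x ≫ H.map (f + g) = x ≫ H.map f + x ≫ H.map g
      rw [H.map_add, Preadditive.comp_add])
    (fun r f x => by
      change x ≫ H.map (r • f) = r • (x ≫ H.map f)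
      rw [H.map_smul, Linear.comp_smul])

variable {H}

/-- The morphism given by an element of `star H P`. -/
def star.hom {P : LinFun K A} {a : A'} (φ : (star H P).obj.obj a) : P ⟶ H.obj a := φ

/-- The element of `star H P` given by a morphism. -/
def star.of {P : LinFun K A} {a : A'} (φ : P ⟶ H.obj a) : (star H P).obj.obj a := φ

variable (H) in
/-- The action of `star` on natural transformations. -/
def starMap {P Q : LinFun K A} (f : P ⟶ Q) : star H Q ⟶ star H P :=
  mkHom (fun a => Linear.leftComp K (H.obj a) f) fun g x =>
    (Category.assoc f (star.hom x) (H.map g)).symm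

/-- The dual of a two step resolution of `X` is a two step resolution if `Hom(X, H(a))` and
`Ext¹(X, H(a))` vanish. -/
theorem star_shortExact {X : LinFun K A} (R : TwoStep X) (h₀ : ∀ a (f : X ⟶ H.obj a), f = 0)
    (h₁ : ∀ a (e : Abelian.Ext.{u} X (H.obj a) 1), e = 0) :
    ∃ (p : star H R.P₁ ⟶ (SubF.range (starMap H R.d)).fn)
      (h : starMap H (R.p ≫ R.i) ≫ p = 0), (ShortComplex.mk _ p h).ShortExact := by
  have := R.exact₁.epi_g
  have := R.exact₁.mono_f
  have := R.exact₂.epi_g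
  have := R.proj₀
  have e1 : Epi R.p := R.exact₂.epi_g
  have e2 : Epi R.ε := R.exact₁.epi_g
  -- Exactness at the dual of `P₁`: `φ` descends to `Ω`, and `Ext¹(X, H a) = 0` extends it to `P₀`.
  -- The vanishing of `Hom(X, H a)` is used for injectivity.
  have key : ∀ a (φ : R.P₁ ⟶ H.obj a), R.d ≫ φ = 0 → ∃ ψ : R.P₀ ⟶ H.obj a,
      (R.p ≫ R.i) ≫ ψ = φ := by
    intro a φ hφ
    obtain ⟨t, ht⟩ := exists_desc_of_epi R.p φ fun b x hx => by
      obtain ⟨y, rfl⟩ := ShortExact.exact' R.exact₂ b x hx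
      exact congrArg (fun t => ev t b y) hφ
    obtain ⟨ψ, hψ⟩ := (ext_contravariant_one.{u} R.exact₁ (H.obj a)).2 (h₁ a) t
    exact ⟨ψ, by rw [Category.assoc, ← ht]; exact congrArg (R.p ≫ ·) hψ⟩
  let p : star H R.P₁ ⟶ (SubF.range (starMap H R.d)).fn :=
    mkHom (fun a => (ev (starMap H R.d) a).rangeRestrict)
      fun f x => Subtype.ext (ev_act (starMap H R.d) f x)
  refine ⟨p, _, shortExact_of (starMap H (R.p ≫ R.i)) p (fun a => ?_) (fun a => LinearMap.surjective_rangeRestrict (ev (starMap H R.d) a))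
    (fun a x => Subtype.ext ?_) fun a x hx => ?_⟩
  · rw [injective_iff_map_eq_zero]
    intro φ hφ
    have hφ : (R.p ≫ R.i) ≫ star.hom φ = 0 := hφ
    rw [Category.assoc] at hφ
    have hφ' : R.i ≫ star.hom φ = 0 := (cancel_epi R.p).1 (hφ.trans comp_zero.symm)
    obtain ⟨t, ht⟩ := exists_desc_of_epi R.ε (star.hom φ) fun b x hx => by
      obtain ⟨y, rfl⟩ := ShortExact.exact' R.exact₁ b x hx
      exact congrArg (fun t => ev t b y) hφ'
    change star.hom φ = 0
    rw [← ht, h₀ a t, comp_zero]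
  · change R.d ≫ (R.p ≫ R.i) ≫ star.hom x = 0
    rw [← Category.assoc, ← Category.assoc, R.zero₂, zero_comp, zero_comp]
  · obtain ⟨ψ, hψ⟩ := key a (star.hom x) (congrArg Subtype.val hx)
    exact ⟨ψ, hψ⟩

end Star

/-! ### Yoneda duals, reflexivity and `Ext²` of a dual cokernel -/

section StarOp

variable {K : Type w} [Field K] {B : Type u} [SmallCategory B] [Preadditive B] [Linear K B]

variable (K B) in
/-- The contravariant Yoneda functor. -/
def coyo : Bᵒᵖ ⥤ LinFun K B where
  obj b := corep b.unop
  map f := corepMap f.unop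
  map_id _ := corepMap_id _
  map_comp f g := corepMap_comp g.unop f.unop

variable (K B) in
/-- The covariant Yoneda functor. -/
def yo : B ⥤ LinFun K Bᵒᵖ where
  obj b := corep (op b)
  map f := corepMap f.op
  map_id _ := corepMap_id _
  map_comp f g := corepMap_comp g.op f.op

instance : (coyo K B).Additive := ⟨fun {_ _ f g} => corepMap_add f.unop g.unop⟩
instance : (coyo K B).Linear K := ⟨fun f r => corepMap_smul r f.unop⟩
instance : (yo K B).Additive := ⟨fun {_ _ f g} => corepMap_add f.op g.op⟩
instance : (yo K B).Linear K := ⟨fun f r => corepMap_smul r f.op⟩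

/-- The morphism given by an element of `star (yo K B) P`. -/
def star.yoHom {P : LinFun K Bᵒᵖ} {c : B} (φ : (star (yo K B) P).obj.obj c) : P ⟶ corep (op c) := φ

theorem star_coyo_eq_sum {L : LinFun K B} {m : ℕ} {a : Fin m → B} {x : ∀ i, L.obj.obj (a i)}
    {ξ : ∀ i, L ⟶ corep (a i)} (h : ∑ i, ξ i ≫ ofElement L (a i) (x i) = 𝟙 L) {c : B}
    (η : L ⟶ corep c) : star.of (H := coyo K B) (a := op c) η =
      ∑ i, act (star (coyo K B) L) (show op (a i) ⟶ op c from
        Quiver.Hom.op (show c ⟶ a i from ev η _ (x i))) (star.of (H := coyo K B) (ξ i)) := by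
  conv_lhs => rw [dual_basis_hom h η]
  rfl

theorem star_yo_eq_sum {P : LinFun K Bᵒᵖ} {m : ℕ} {a : Fin m → Bᵒᵖ} {x : ∀ i, P.obj.obj (a i)}
    {ξ : ∀ i, P ⟶ corep (a i)} (h : ∑ i, ξ i ≫ ofElement P (a i) (x i) = 𝟙 P) {c : B}
    (η : P ⟶ corep (op c)) : star.of (H := yo K B) (a := c) η =
      ∑ i, act (star (yo K B) P) (show (a i).unop ⟶ c from
        Quiver.Hom.unop (show op c ⟶ a i from ev η _ (x i)))
          (star.of (H := yo K B) (a := (a i).unop) (ξ i)) := by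
  conv_lhs => rw [dual_basis_hom h η]
  rfl

/-- The functor `star` preserves finitely generated projectives. -/
theorem projective_star_coyo {L : LinFun K B} [Projective L] (hL : FinGen L) :
    Projective (star (coyo K B) L) where
  factors {F G} f e he := by
    obtain ⟨m, a, x, ξ, h⟩ := exists_dual_basis hL
    choose y hy using fun i => ev_surjective e _ (ev f _ (star.of (H := coyo K B) (a := op (a i))
      (ξ i)))
    refine ⟨mkHom (fun c => ∑ i, orbit F (y i) c ∘ₗ
      (show (star (coyo K B) L).obj.obj c →ₗ[K] (op (a i) ⟶ c) from
        { toFun := fun η => Quiver.Hom.op (show c.unop ⟶ a i from ev (star.hom η) _ (x i))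
          map_add' := fun _ _ => rfl
          map_smul' := fun _ _ => rfl })) fun {c d} g η => ?_, hom_ext' fun c η => ?_⟩
    · simp only [LinearMap.coe_sum, Finset.sum_apply, LinearMap.comp_apply, map_sum, orbit_apply]
      exact Finset.sum_congr rfl fun i _ => act_comp F (Quiver.Hom.op
        (show c.unop ⟶ a i from ev (star.hom η) _ (x i))) g (y i)
    · rw [ev_comp, ev_mkHom]
      have := congrArg (ev f c) (star_coyo_eq_sum h (star.hom η))
      refine Eq.trans ?_ this.symm
      rw [LinearMap.sum_apply, map_sum, map_sum]
      refine Finset.sum_congr rfl fun i _ => ?_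
      rw [ev_act, ← hy, ← ev_act]
      rfl

/-- The functor `star` preserves finitely generated projectives. -/
theorem projective_star_yo {P : LinFun K Bᵒᵖ} [Projective P] (hP : FinGen P) :
    Projective (star (yo K B) P) where
  factors {F G} f e he := by
    obtain ⟨m, a, x, ξ, h⟩ := exists_dual_basis hP
    choose y hy using fun i => ev_surjective e _ (ev f _ (star.of (H := yo K B)
      (a := (a i).unop) (ξ i)))
    refine ⟨mkHom (fun c => ∑ i, orbit F (y i) c ∘ₗ
      (show (star (yo K B) P).obj.obj c →ₗ[K] ((a i).unop ⟶ c) from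
        { toFun := fun η => Quiver.Hom.unop (show op c ⟶ a i from ev (star.hom η) _ (x i))
          map_add' := fun _ _ => rfl
          map_smul' := fun _ _ => rfl })) fun {c d} g η => ?_, hom_ext' fun c η => ?_⟩
    · simp only [LinearMap.coe_sum, Finset.sum_apply, LinearMap.comp_apply, map_sum, orbit_apply]
      exact Finset.sum_congr rfl fun i _ => act_comp F (Quiver.Hom.unop
        (show op c ⟶ a i from ev (star.hom η) _ (x i))) g (y i)
    · rw [ev_comp, ev_mkHom]
      have := congrArg (ev f c) (star_yo_eq_sum h (star.hom η))
      refine Eq.trans ?_ this.symm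
      rw [LinearMap.sum_apply, map_sum, map_sum]
      refine Finset.sum_congr rfl fun i _ => ?_
      rw [ev_act, ← hy, ← ev_act]
      rfl

/-- Evaluation at an element of `L`. -/
def evalAt {L : LinFun K B} {b : B} (x : L.obj.obj b) : star (coyo K B) L ⟶ corep (op b) :=
  mkHom (fun c => show (star (coyo K B) L).obj.obj c →ₗ[K] (op b ⟶ c) from
    { toFun := fun η => Quiver.Hom.op (show c.unop ⟶ b from ev (star.hom η) _ x)
      map_add' := fun _ _ => rfl
      map_smul' := fun _ _ => rfl }) fun _ _ => rfl

theorem evalAt_sum {L : LinFun K B} {b : B} {ι : Type*} (s : Finset ι) (x : ι → L.obj.obj b) :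
    evalAt (∑ i ∈ s, x i) = ∑ i ∈ s, evalAt (x i) :=
  map_sum (show L.obj.obj b →+ (star (coyo K B) L ⟶ corep (op b)) from
    { toFun := evalAt
      map_zero' := hom_ext' fun c η =>
        congrArg (Quiver.Hom.op (X := c.unop) (Y := b)) (map_zero (ev (star.hom η) b))
      map_add' := fun x y => hom_ext' fun c η =>
        congrArg (Quiver.Hom.op (X := c.unop) (Y := b)) (map_add (ev (star.hom η) b) x y) }) x s

/-- Finitely generated projective functors are reflexive. -/
theorem exists_eq_evalAt {L : LinFun K B} [Projective L] (hL : FinGen L) {b : B}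
    (ω : star (coyo K B) L ⟶ corep (op b)) : ∃ x : L.obj.obj b, ω = evalAt x := by
  obtain ⟨m, a, x, ξ, h⟩ := exists_dual_basis hL
  -- `ω` is determined by its values on the dual basis `ξ i`, which serve as the coefficients of the
  -- `x i`.
  refine ⟨∑ i, act L (Quiver.Hom.unop (show op b ⟶ op (a i) from
    ev ω _ (star.of (H := coyo K B) (a := op (a i)) (ξ i)))) (x i), hom_ext' fun c η => ?_⟩
  have h1 := congrArg (ev ω c) (star_coyo_eq_sum h (star.hom η))
  refine h1.trans ?_
  rw [map_sum, evalAt_sum, ev_sum]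
  refine Finset.sum_congr rfl fun i _ => ?_
  rw [ev_act]
  refine (congrArg (Quiver.Hom.op (X := c.unop) (Y := b)) (ev_act (star.hom η) (Quiver.Hom.unop
    (show op b ⟶ op (a i) from ev ω _ (star.of (H := coyo K B) (a := op (a i)) (ξ i))))
      (x i))).symm

/-- If `Hom(S, G)` vanishes, then every morphism from the dual of `P₀` to the dual of `G` extends to
the dual of `P₁`. -/
theorem exists_extension_dualOp (E : ModuleCat.{u} K) {S G : LinFun K Bᵒᵖ} (R : TwoStep S)
    (hR : FinGen R.P₀) (hG : ∀ f : S ⟶ G, f = 0) (Θ : star (yo K B) R.P₀ ⟶ dualOp E G) :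
    ∃ Θ' : star (yo K B) R.P₁ ⟶ dualOp E G, starMap (yo K B) (R.p ≫ R.i) ≫ Θ' = Θ := by
  have := R.proj₀
  have e1 : Epi R.p := R.exact₂.epi_g
  have e2 : Epi R.ε := R.exact₁.epi_g
  obtain ⟨m, a, x, ξ, h⟩ := exists_dual_basis hR
  -- Through the dual basis, `Θ` becomes a single functional on the vector space `Hom(P₀, G)`,
  -- namely `f ↦ ∑ θ i (f (x i))`.
  let θ : ∀ i, G.obj.obj (a i) →ₗ[K] E := fun i =>
    dualOp.fn (b := (a i).unop) (ev Θ _ (star.of (H := yo K B) (a := (a i).unop) (ξ i)))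
  let lam : (R.P₀ ⟶ G) →ₗ[K] E := ∑ i, θ i ∘ₗ evAt (x i) G
  -- The kernel of `Hom(P₀, G) → Hom(P₁, G)` is `Hom(S, G) = 0`, so the functional extends to
  -- `Hom(P₁, G)`. The extension of `Θ` sends `ζ` and `y` to `lam'` of the composite of `ζ` with the
  -- morphism given by `y`.
  obtain ⟨lam', hlam⟩ := exists_comp_eq_of_ker_le (Linear.leftComp K G (R.p ≫ R.i)) lam
    fun f hf => by
      have hf : (R.p ≫ R.i) ≫ f = 0 := hf
      rw [Category.assoc] at hf
      have hf' : R.i ≫ f = 0 := (cancel_epi R.p).1 (hf.trans comp_zero.symm)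
      obtain ⟨t, rfl⟩ := exists_desc_of_epi R.ε f fun b x hx => by
        obtain ⟨y, rfl⟩ := ShortExact.exact' R.exact₁ b x hx
        exact congrArg (fun t => ev t b y) hf'
      rw [hG t, comp_zero, map_zero]
  refine ⟨mkHom (fun c => show (star (yo K B) R.P₁).obj.obj c →ₗ[K] (G.obj.obj (op c) →ₗ[K] E) from
    LinearMap.mk₂ K (fun ζ y => lam' (star.yoHom ζ ≫ ofElement G (op c) y))
      (fun ζ ζ' y => (congrArg lam' (Preadditive.add_comp _ _ _ (star.yoHom ζ) (star.yoHom ζ')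
        (ofElement G (op c) y))).trans (map_add lam' _ _))
      (fun r ζ y => (congrArg lam' (Linear.smul_comp _ _ _ r (star.yoHom ζ)
        (ofElement G (op c) y))).trans (map_smul lam' _ _))
      (fun ζ y y' => ?_) fun r ζ y => ?_) fun f ζ => ?_,
    hom_ext' fun c η => LinearMap.ext fun y => ?_⟩
  · rw [ofElement_add, Preadditive.comp_add, map_add]
  · have : ofElement G (op c) (r • y) = r • ofElement G (op c) y :=
      hom_ext' fun c g => map_smul (act G (show op _ ⟶ c from g)) r y
    rw [this, Linear.comp_smul, map_smul]
  · refine LinearMap.ext fun y => ?_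
    change lam' ((star.yoHom ζ ≫ corepMap f.op) ≫ ofElement G _ y) =
      lam' (star.yoHom ζ ≫ ofElement G _ (act G f.op y))
    rw [Category.assoc, corepMap_ofElement]
  · have h2 := hlam (star.yoHom η ≫ ofElement G (op c) y)
    have h3 : (R.p ≫ R.i) ≫ (star.yoHom η ≫ ofElement G (op c) y) =
      ((R.p ≫ R.i) ≫ star.yoHom η) ≫ ofElement G (op c) y := (Category.assoc _ _ _).symm
    change lam' (((R.p ≫ R.i) ≫ star.yoHom η) ≫ ofElement G (op c) y) = dualOp.fn (ev Θ c η) y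
    rw [← h3]
    refine h2.trans ?_
    have h1 := congrArg (fun t => dualOp.fn (ev Θ c t) y) (star_yo_eq_sum h (star.yoHom η))
    refine Eq.trans ?_ h1.symm
    change (∑ i, θ i ∘ₗ evAt (x i) G) _ = dualOp.fn (ev Θ c (∑ i, _)) y
    rw [map_sum, LinearMap.sum_apply]
    refine Eq.trans ?_ (LinearMap.sum_apply _ _ _).symm
    refine Finset.sum_congr rfl fun i _ => ?_
    rw [ev_act]
    rfl

/-- If `Hom(S, G)` vanishes, then `Ext²(T', D G)` vanishes, where `T'` is the cokernel of the dual of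
the resolution of `S`. -/
theorem ext_two_eq_zero (E : ModuleCat.{u} K) {S G : LinFun K Bᵒᵖ} (R : TwoStep S)
    (hP₀ : FinGen R.P₀) (hP₁ : FinGen R.P₁) (hP₂ : FinGen R.P₂) (hproj : Projective R.P₂)
    (h₀ : ∀ a (f : S ⟶ corep a), f = 0)
    (h₁ : ∀ a (e : Abelian.Ext.{u} S (corep a) 1), e = 0) (hG : ∀ f : S ⟶ G, f = 0)
    (e : Abelian.Ext.{u} (SubF.range (starMap (yo K B) R.d)).quot (dualOp E G) 2) : e = 0 := by
  have := R.proj₁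
  have p1 := projective_star_yo hP₁
  have p2 := projective_star_yo hP₂
  obtain ⟨p, h, hS⟩ := star_shortExact (H := yo K B) R (fun a f => h₀ _ f) (fun a e => h₁ _ e)
  -- The duals of `P₂` and `P₁` are projective and begin a resolution whose second syzygy is the
  -- dual of `P₀`; so `Ext²` is the obstruction to extending from the dual of `P₀` to that of `P₁`.
  refine (ext_contravariant_shift.{u} (S := ShortComplex.mk (SubF.range (starMap (yo K B) R.d)).ι
    (SubF.range (starMap (yo K B) R.d)).π _) (SubF.shortExact _) _ 0).1 ?_ e
  exact (ext_contravariant_one.{u} (S := ShortComplex.mk _ p h) hS _).1 fun Θ =>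
    exists_extension_dualOp E R hP₀ hG Θ

end StarOp

/-! ### The simple functor `T` recovered from a simple subfunctor of `tr²(T)` -/

section Transpose

variable {K : Type w} [Field K] {B : Type u} [SmallCategory B] [Preadditive B] [Linear K B]

open Abelian

/-- The functor `tr²` is computed by the dual of a resolution. -/
theorem tr_two_iso {T : LinFun K B} (R : TwoStep T) :
    Nonempty ((SubF.range (starMap (coyo K B) R.d)).quot ≅ tr 2 T) := by
  -- `ρ` sends `φ` to the class it represents in `Ext²`; it is onto, and its kernel consists of the
  -- `φ` that extend along `R.d`.
  let ρ : star (coyo K B) R.P₂ ⟶ tr 2 T :=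
    mkHom (fun b => show (R.P₂ ⟶ corep b.unop) →ₗ[K] Ext.{u} T (corep b.unop) 2 from
      { toFun := fun φ => R.cls.comp (Ext.mk₀ φ) (add_zero 2)
        map_add' := fun φ ψ => by rw [Ext.mk₀_add, Ext.comp_add]
        map_smul' := fun r φ => by rw [Ext.mk₀_smul, Ext.comp_smul]; rfl }) fun {b c} f φ => by
      change R.cls.comp (Ext.mk₀ (star.hom φ ≫ corepMap f.unop)) (add_zero 2) =
        (R.cls.comp (Ext.mk₀ (star.hom φ)) (add_zero 2)).comp (Ext.mk₀ (corepMap f.unop))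
          (add_zero 2)
      rw [Ext.comp_assoc _ _ _ (add_zero 2) (add_zero 0) (by omega)]
      exact congrArg (fun t => R.cls.comp t (add_zero 2)) (Ext.mk₀_comp_mk₀ _ _).symm
  have hρ : ∀ b (φ : (star (coyo K B) R.P₂).obj.obj b), ev ρ b φ = 0 ↔
      φ ∈ (SubF.range (starMap (coyo K B) R.d)).carrier b := fun b φ =>
    R.cls_comp_eq_zero_iff (star.hom φ)
  obtain ⟨k, hk⟩ := exists_desc_of_epi (SubF.range (starMap (coyo K B) R.d)).π ρ fun b φ h =>
    (hρ b φ).2 ((SubF.ev_π_eq_zero _ _).1 h)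
  have hk' : ∀ b φ, ev k b (ev (SubF.range (starMap (coyo K B) R.d)).π b φ) = ev ρ b φ :=
    fun b φ => by rw [← ev_comp, hk]
  refine ⟨@asIso _ _ _ _ k (isIso_of_bijective k (fun b => ?_) fun b e => ?_)⟩
  · rw [injective_iff_map_eq_zero]
    intro x hx
    obtain ⟨φ, rfl⟩ := ev_surjective (SubF.range (starMap (coyo K B) R.d)).π b x
    rw [hk', hρ] at hx
    exact (SubF.ev_π_eq_zero _ _).2 hx
  · obtain ⟨φ, hφ⟩ := R.exists_eq_cls_comp (Y := corep b.unop) e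
    exact ⟨ev (SubF.range (starMap (coyo K B) R.d)).π b (star.of (H := coyo K B) φ),
      (hk' _ _).trans hφ⟩

theorem evalAt_act {L : LinFun K B} {b c : B} (g : b ⟶ c) (x : L.obj.obj b) :
    evalAt (act L g x) = evalAt x ≫ corepMap g.op :=
  hom_ext' fun d η =>
    congrArg (Quiver.Hom.op (X := d.unop) (Y := c)) (ev_act (star.hom η) g x)

theorem evalAt_ev {L M : LinFun K B} (f : L ⟶ M) {b : B} (x : L.obj.obj b) :
    evalAt (ev f b x) = starMap (coyo K B) f ≫ evalAt x := rfl

/-- If the cokernel were zero, the coordinates of a dual basis of `P₂` would extend along `d`. Then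
`d` would split, `Ω` would be projective, and `S` would have projective dimension at most one. -/
theorem not_isZero_dual_cokernel {S : LinFun K Bᵒᵖ} (R : TwoStep S) (hproj : Projective R.P₂)
    (hP₂ : FinGen R.P₂) (hS : projectiveDimension S = 2) :
    ¬ IsZero (SubF.range (starMap (yo K B) R.d)).quot := by
  intro h
  have := R.proj₀
  have := R.proj₁
  have h1 : ∀ b (φ : R.P₂ ⟶ corep (op b)), ∃ g : R.P₁ ⟶ corep (op b), R.d ≫ g = φ := fun b φ =>
    (SubF.ev_π_eq_zero _ (star.of (H := yo K B) φ)).1 ((isZero_iff _).1 h b _)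
  obtain ⟨m, a, x, ξ, hξ⟩ := exists_dual_basis hP₂
  choose g hg using fun i => h1 (a i).unop (ξ i)
  have h2 : R.d ≫ ∑ i, g i ≫ ofElement R.P₂ (a i) (x i) = 𝟙 _ := by
    rw [← hξ, Preadditive.comp_sum]
    exact Finset.sum_congr rfl fun i _ => by
      rw [← Category.assoc]
      exact congrArg (· ≫ ofElement R.P₂ (a i) (x i)) (hg i)
  have h3 : Projective R.Ω := by
    rw [projective_iff_subsingleton_ext_one.{u}]
    intro Y
    have := (ext_contravariant_one.{u} R.exact₂ Y).1 fun f =>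
      ⟨(∑ i, g i ≫ ofElement R.P₂ (a i) (x i)) ≫ f, by
        change R.d ≫ _ ≫ f = f
        rw [← Category.assoc, h2, Category.id_comp]⟩
    exact ⟨fun e e' => (this e).trans (this e').symm⟩
  have h4 : HasProjectiveDimensionLT S 2 :=
    R.exact₁.hasProjectiveDimensionLT_X₃ 1 (projective_iff_hasProjectiveDimensionLT_one.1 h3)
      inferInstance
  have h5 := (projectiveDimension_le_iff S 1).2 h4
  rw [hS] at h5
  exact absurd h5 (by decide)

/-- If a simple functor `S` embeds into `tr²(T)` for a simple functor `T`, then `T` is the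
cokernel of the dual of a resolution of `S`. -/
theorem iso_dual_cokernel {T : LinFun K B} [Simple T] (R : TwoStep T) (hR₀ : FinGen R.P₀)
    (hR₁ : FinGen R.P₁) (hR₂ : FinGen R.P₂) (hRp : Projective R.P₂)
    (h₀ : ∀ a (f : T ⟶ corep a), f = 0)
    (h₁ : ∀ a (e : Ext.{u} T (corep a) 1), e = 0) {S : LinFun K Bᵒᵖ} (R' : TwoStep S)
    (hR'₂ : FinGen R'.P₂) (hR'p : Projective R'.P₂) (hS : projectiveDimension S = 2)
    (s : S ⟶ tr 2 T) [Mono s] (hgl : ∀ Z : LinFun K Bᵒᵖ, HasProjectiveDimensionLT Z 3) :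
    Nonempty (T ≅ (SubF.range (starMap (yo K B) R'.d)).quot) := by
  have := R.proj₀
  have := R.proj₁
  have e1 : Epi R.ε := R.exact₁.epi_g
  have e2 : Epi R.p := R.exact₂.epi_g
  have p1 := projective_star_coyo hR₁
  have p2 := projective_star_coyo hR₂
  obtain ⟨p, h, hD⟩ := star_shortExact (H := coyo K B) R (fun a f => h₀ _ f) (fun a e => h₁ _ e)
  -- Dualizing reverses the resolution: the last term for `tr²(T)` is the dual of `R.P₀`.
  let RD : TwoStep (SubF.range (starMap (coyo K B) R.d)).quot :=
    { ε := _, i := _, p := p, d := _, zero₁ := _, zero₂ := h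
      exact₁ := SubF.shortExact _, exact₂ := hD, proj₀ := p2, proj₁ := p1 }
  obtain ⟨e⟩ := tr_two_iso R
  let s' := s ≫ e.inv
  have hs' : (ShortComplex.mk s' (SubF.range s').π (hom_ext' fun a x =>
      ((SubF.range s').ev_π_eq_zero _).2 ⟨x, rfl⟩)).ShortExact :=
    shortExact_of _ _ (ev_injective _) (ev_surjective _)
      (fun a x => ((SubF.range s').ev_π_eq_zero _).2 ⟨x, rfl⟩)
      fun a x hx => ((SubF.range s').ev_π_eq_zero x).1 hx
  obtain ⟨c₁, c₂, hc, hcls⟩ := R'.exists_hom RD s'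
  let V := SubF.range (starMap (yo K B) R'.d)
  -- The transpose of `c₂`, from `R'.P₂` to the dual of `R.P₀`: an element `x` goes to `c₂` followed
  -- by evaluation at `x`.
  let τ : R.P₀ ⟶ star (yo K B) R'.P₂ :=
    mkHom (fun b => show R.P₀.obj.obj b →ₗ[K] (R'.P₂ ⟶ corep (op b)) from
      { toFun := fun x => c₂ ≫ evalAt x
        map_add' := fun x y => by
          rw [← Preadditive.comp_add]
          congr 1
          exact hom_ext' fun c η =>
            congrArg (Quiver.Hom.op (X := c.unop) (Y := b)) (map_add (ev (star.hom η) b) x y)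
        map_smul' := fun r x => by
          rw [RingHom.id_apply, ← Linear.comp_smul]
          congr 1
          exact hom_ext' fun c η =>
            congrArg (Quiver.Hom.op (X := c.unop) (Y := b)) (map_smul (ev (star.hom η) b) r x) })
      fun {b c} g x => by
        change c₂ ≫ evalAt (act R.P₀ g x) = (c₂ ≫ evalAt x) ≫ corepMap g.op
        rw [evalAt_act, Category.assoc]
  have hτ : ∀ b (x : R.P₀.obj.obj b), ev τ b x = star.of (H := yo K B) (c₂ ≫ evalAt x) :=
    fun b x => rfl
  -- On elements coming from `R.P₁`, the morphism `c₁` supplies the extension along `R'.d`, so `τ`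
  -- descends to `T`.
  obtain ⟨k, hk⟩ := exists_desc_of_epi R.ε (τ ≫ V.π) fun b x hx => by
    obtain ⟨x', hx'⟩ := ShortExact.exact' R.exact₁ b x hx
    obtain ⟨y, rfl⟩ := ev_surjective R.p b x'
    have hx'' : ev (R.p ≫ R.i) b y = x := hx'
    rw [ev_comp, V.ev_π_eq_zero, hτ, ← hx'', evalAt_ev]
    refine ⟨star.of (H := yo K B) (c₁ ≫ evalAt y), ?_⟩
    change R'.d ≫ c₁ ≫ evalAt y = c₂ ≫ RD.d ≫ evalAt y
    rw [← Category.assoc, hc, Category.assoc]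
  have : Epi k := by
    have : Epi (R.ε ≫ k) := by
      rw [hk, epi_iff]
      intro b z
      obtain ⟨φ, rfl⟩ := ev_surjective V.π b z
      -- Surjectivity: as `Ext³` vanishes, `φ` is `c₂ ≫ ω` up to a morphism extending along `R'.d`,
      -- and by reflexivity `ω` is evaluation at an element of `R.P₀`.
      obtain ⟨ω, g, hφ⟩ := R'.exists_eq_add RD hs' hcls
        (fun e => by
          have := hgl (SubF.range s').quot
          exact Ext.eq_zero_of_hasProjectiveDimensionLT e 3 le_rfl) (star.yoHom φ)
      obtain ⟨x, rfl⟩ := exists_eq_evalAt hR₀ ω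
      refine ⟨x, ?_⟩
      rw [ev_comp, ← sub_eq_zero, ← map_sub, V.ev_π_eq_zero]
      refine ⟨star.of (H := yo K B) (-g), ?_⟩
      change R'.d ≫ (-g) = c₂ ≫ evalAt x - star.yoHom φ
      rw [hφ, Preadditive.comp_neg, sub_add_cancel_left]
    exact epi_of_epi R.ε k
  rcases isZero_or_isIso_of_simple ‹Simple T› k with h | h
  · exact absurd h (not_isZero_dual_cokernel R' hR'p hR'₂ hS)
  · exact ⟨asIso k⟩

theorem le_two_of_eq {A : Type u} [SmallCategory A] [Preadditive A] [Linear K A]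
    {F : LinFun K A} (h : projectiveDimension F = 2) : HasProjectiveDimensionLE F 2 :=
  (projectiveDimension_le_iff F 2).1 h.le

/-- If `T` is a simple functor of projective dimension two that satisfies the Artin-Schelter
condition, and `G` has no simple subfunctors in `H²`, then `Ext²(T, D G)` vanishes. -/
theorem ext_two_simple_eq_zero (E : ModuleCat.{u} K) {T : LinFun K B} [Simple T] (hT : InH 2 T)
    {S : LinFun K Bᵒᵖ} (hS : InH 2 S) (s : S ⟶ tr 2 T) [Mono s]
    (hgl : ∀ Z : LinFun K Bᵒᵖ, HasProjectiveDimensionLT Z 3) {G : LinFun K Bᵒᵖ}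
    (hG : ∀ f : S ⟶ G, f = 0) (e : Ext.{u} T (dualOp E G) 2) : e = 0 := by
  obtain ⟨R, hp, h0, h1, h2⟩ := TwoStep.exists_of_resolution hT.2.1 (le_two_of_eq hT.1)
  obtain ⟨R', hp', h0', h1', h2'⟩ := TwoStep.exists_of_resolution hS.2.1 (le_two_of_eq hS.1)
  obtain ⟨i⟩ := iso_dual_cokernel R h0 h1 h2 hp (fun a => hT.hom_eq_zero (by decide) a)
    (fun a => hT.ext_eq_zero (by decide) a) R' h2' hp' hS.1 s hgl
  have := ext_two_eq_zero E R' h0' h1' h2' hp' (fun a => hS.hom_eq_zero (by decide) a)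
    (fun a => hS.ext_eq_zero (by decide) a) hG ((Ext.mk₀ i.inv).comp e (zero_add 2))
  have h3 : (Ext.mk₀ i.hom).comp ((Ext.mk₀ i.inv).comp e (zero_add 2)) (zero_add 2) = e := by
    simp
  rw [← h3, this, Ext.comp_zero]

end Transpose

section PositiveDegree

open Abelian

variable {K : Type w} [Field K] {A : Type u} [SmallCategory A] [Preadditive A] [Linear K A]

/-! ## Categories with a degree function -/

/-- The morphisms of `A` do not decrease the degree `d`, the nonzero morphisms of degree `0`
starting at an object in `L` are split monomorphisms, and every object is a finite direct sum of
objects in `L` of the same degree. -/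
structure IsPositive (d : A → ℤ) (L : A → Prop) : Prop where
  hom_eq_zero : ∀ {a b : A} (f : a ⟶ b), d b < d a → f = 0
  id_ne_zero : ∀ {a : A}, L a → 𝟙 a ≠ 0
  split : ∀ {a b : A} (f : a ⟶ b), L a → d a = d b → f ≠ 0 → ∃ g : b ⟶ a, f ≫ g = 𝟙 a
  decomp : ∀ a : A, ∃ (m : ℕ) (Y : Fin m → A) (ι : ∀ k, Y k ⟶ a) (π : ∀ k, a ⟶ Y k),
    (∀ k, L (Y k) ∧ d (Y k) = d a) ∧ ∑ k, π k ≫ ι k = 𝟙 a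

/-- `W` is concentrated in degree `k`. -/
def Concentrated (d : A → ℤ) (k : ℤ) (W : LinFun K A) : Prop :=
  ∀ a, d a ≠ k → ∀ x : W.obj.obj a, x = 0

/-- `M` vanishes in degrees less than `k`. -/
def BoundedBelow (d : A → ℤ) (k : ℤ) (M : LinFun K A) : Prop :=
  ∀ a, d a < k → ∀ x : M.obj.obj a, x = 0

/-- The functor `V` is killed by the morphisms of positive degree. -/
def KilledByPositive (d : A → ℤ) (V : LinFun K A) : Prop :=
  ∀ {a b : A} (f : a ⟶ b), d a < d b → ∀ x : V.obj.obj a, act V f x = 0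

theorem Concentrated.killed {d : A → ℤ} {k : ℤ} {W : LinFun K A} (h : Concentrated d k W) :
    KilledByPositive d W := by
  intro a b f hab x
  by_cases ha : d a = k
  · exact h b (by omega) _
  · rw [h a ha x, map_zero]

variable {d : A → ℤ} {L : A → Prop} (hA : IsPositive d L)

include hA

theorem IsPositive.act_eq_zero (F : LinFun K A) {a b : A} (f : a ⟶ b) (h : d b < d a)
    (x : F.obj.obj a) : act F f x = 0 := by
  rw [hA.hom_eq_zero f h, act_zero]

/-- An element lies in a subfunctor if its components at the objects in `L` do. -/
theorem IsPositive.mem_of_local {F : LinFun K A} {U : SubF F} {a : A} (x : F.obj.obj a)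
    (h : ∀ (b : A) (f : a ⟶ b), L b → d b = d a → act F f x ∈ U.carrier b) : x ∈ U.carrier a := by
  obtain ⟨m, Y, ι, π, hY, hs⟩ := hA.decomp a
  rw [← act_id F a x, ← hs, act_sum]
  refine Submodule.sum_mem _ fun k _ => ?_
  rw [act_comp]
  exact U.act_mem _ (h _ _ (hY k).1 (hY k).2)

/-- Every subfunctor of a functor that is killed by the morphisms of positive degree has a
complement. -/
theorem IsPositive.exists_complement {V : LinFun K A} (hV : KilledByPositive d V) (W : SubF V) :
    ∃ U : SubF V, (∀ a x, x ∈ U.carrier a → x ∈ W.carrier a → x = 0) ∧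
      ∀ a x, ∃ y ∈ U.carrier a, ∃ z ∈ W.carrier a, y + z = x := by
  -- Zorn's lemma for the subfunctors that meet `W` trivially; a maximal one must be a complement.
  let s : Set (∀ a, Submodule K (V.obj.obj a)) :=
    {c | (∀ a b (f : a ⟶ b) x, x ∈ c a → act V f x ∈ c b) ∧
      ∀ a x, x ∈ c a → x ∈ W.carrier a → x = 0}
  obtain ⟨U, -, ⟨hU₁, hU₂⟩, hU⟩ := zorn_le_nonempty₀ s (by
    intro c hc hch y hy
    have : Nonempty c := ⟨⟨y, hy⟩⟩
    have hmem : ∀ a x, x ∈ (sSup c) a ↔ ∃ f ∈ c, x ∈ f a := by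
      intro a x
      rw [sSup_apply, Submodule.mem_iSup_of_directed]
      · simp
      · intro f g
        rcases hch.total f.2 g.2 with h | h
        · exact ⟨g, h a, le_rfl⟩
        · exact ⟨f, le_rfl, h a⟩
    refine ⟨sSup c, ⟨?_, ?_⟩, fun z hz => le_sSup hz⟩
    · intro a b f x hx
      obtain ⟨g, hg, hx⟩ := (hmem a x).1 hx
      exact (hmem b _).2 ⟨g, hg, (hc hg).1 a b f x hx⟩
    · intro a x hx hw
      obtain ⟨g, hg, hx⟩ := (hmem a x).1 hx
      exact (hc hg).2 a x hx hw) ⊥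
    ⟨fun a b f x hx => by
      rw [(Submodule.mem_bot K).1 hx, map_zero]
      exact Submodule.zero_mem _, fun a x hx _ => (Submodule.mem_bot K).1 hx⟩
  refine ⟨⟨U, fun f _ hx => hU₁ _ _ f _ hx⟩, hU₂, ?_⟩
  let T : SubF V := ⟨fun a => U a ⊔ W.carrier a, by
    intro a b f x hx
    obtain ⟨y, hy, z, hz, rfl⟩ := Submodule.mem_sup.1 hx
    rw [map_add]
    exact Submodule.add_mem_sup (hU₁ _ _ f _ hy) (W.act_mem f hz)⟩
  suffices h : ∀ (b : A), L b → ∀ x : V.obj.obj b, x ∈ T.carrier b from fun a x =>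
    Submodule.mem_sup.1 (hA.mem_of_local (U := T) x fun b f hb _ => h b hb _)
  intro b hb x
  by_contra hx
  have hle : U ≤ fun c => U c ⊔ LinearMap.range (orbit V x c) := fun c => le_sup_left
  have hmem : (fun c => U c ⊔ LinearMap.range (orbit V x c)) ∈ s := by
    refine ⟨?_, ?_⟩
    · intro a c f y hy
      obtain ⟨y', hy', _, ⟨g, rfl⟩, rfl⟩ := Submodule.mem_sup.1 hy
      rw [map_add]
      refine Submodule.add_mem_sup (hU₁ _ _ f _ hy') ⟨g ≫ f, ?_⟩
      simp
    · intro a y hy hw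
      obtain ⟨y', hy', _, ⟨g, rfl⟩, rfl⟩ := Submodule.mem_sup.1 hy
      rw [orbit_apply] at hw ⊢
      by_cases h0 : act V g x = 0
      · rw [h0, add_zero] at hw ⊢
        exact hU₂ _ _ hy' hw
      -- `g` has degree zero and starts at a local object, so it has a retraction `r`. Applying `r`
      -- to `y' + act V g x`, which lies in `W`, exhibits `x` as an element of `U + W`.
      · have hg : g ≠ 0 := fun h => h0 (by rw [h, act_zero])
        have h1 : ¬ d b < d a := fun h => h0 (hV g h x)
        have h2 : ¬ d a < d b := fun h => hg (hA.hom_eq_zero g h)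
        obtain ⟨r, hr⟩ := hA.split g hb (by omega) hg
        refine absurd ?_ hx
        have h3 := act_id V b x
        rw [← hr, act_comp, ← add_sub_cancel_left y' (act V g x), map_sub] at h3
        rw [← h3]
        exact Submodule.sub_mem _ (Submodule.mem_sup_right (W.act_mem r hw))
          (Submodule.mem_sup_left (hU₁ _ _ r _ hy'))
  refine hx (Submodule.mem_sup_left (hU hmem hle b (Submodule.mem_sup_right ⟨𝟙 b, ?_⟩)))
  simp

/-- A monomorphism to a functor that is killed by the morphisms of positive degree splits. -/
theorem IsPositive.exists_retraction {V W : LinFun K A} (hV : KilledByPositive d V) (i : W ⟶ V)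
    [Mono i] : ∃ r : V ⟶ W, i ≫ r = 𝟙 W := by
  obtain ⟨U, hU₁, hU₂⟩ := hA.exists_complement hV (SubF.range i)
  have : IsIso (i ≫ U.π) := by
    refine isIso_of_bijective _ (fun a => ?_) fun a => ?_
    · rw [injective_iff_map_eq_zero]
      intro x hx
      rw [ev_comp, U.ev_π_eq_zero] at hx
      exact ev_injective i a ((hU₁ a _ hx ⟨x, rfl⟩).trans (map_zero _).symm)
    · intro y
      obtain ⟨y, rfl⟩ := ev_surjective U.π a y
      obtain ⟨z, hz, _, ⟨t, rfl⟩, rfl⟩ := hU₂ a y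
      exact ⟨t, by rw [ev_comp, map_add, (U.ev_π_eq_zero z).2 hz, zero_add]⟩
  exact ⟨U.π ≫ inv (i ≫ U.π), by rw [← Category.assoc, IsIso.hom_inv_id]⟩

/-! ### Truncations -/

/-- The part of `F` in degrees at least `k`. -/
def IsPositive.trunc (k : ℤ) (F : LinFun K A) : SubF F where
  carrier a :=
    { carrier := {x | d a < k → x = 0}
      add_mem' := fun hx hy h => by rw [hx h, hy h, add_zero]
      zero_mem' := fun _ => rfl
      smul_mem' := fun r x hx h => by rw [hx h, smul_zero] }
  act_mem := by
    intro a b f x hx h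
    by_cases hab : d b < d a
    · exact hA.act_eq_zero F f hab x
    · rw [hx (by omega), map_zero]

theorem IsPositive.mem_trunc {k : ℤ} {F : LinFun K A} {a : A} {x : F.obj.obj a} :
    x ∈ (hA.trunc k F).carrier a ↔ (d a < k → x = 0) := Iff.rfl

theorem IsPositive.boundedBelow_corep (a : A) : BoundedBelow d (d a) (corep (K := K) a) :=
  fun _ hb x => hA.hom_eq_zero x hb

theorem IsPositive.boundedBelow_coproduct {I : Type*} (F : I → LinFun K A) [HasCoproduct F]
    (k : ℤ)
    (h : ∀ i, BoundedBelow d k (F i)) : BoundedBelow d k (∐ F) := fun a ha x =>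
  SubF.mem_of_coproduct (hA.trunc k (∐ F))
    (fun i b y hb => by rw [h i b hb y, map_zero]) a x ha

/-- Only elements in degrees at least `k` are used as generators, so the syzygies of a bounded
functor stay bounded. -/
theorem IsPositive.exists_cover {k : ℤ} {M : LinFun K A} (hM : BoundedBelow d k M) :
    ∃ (P : LinFun K A) (p : P ⟶ M), Projective P ∧ BoundedBelow d k P ∧ Epi p := by
  let F : {i : (Σ a : A, M.obj.obj a) // k ≤ d i.1} → LinFun K A := fun i => corep i.1.1
  have : ∀ i, Projective (F i) := fun i => inferInstanceAs (Projective (corep _))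
  refine ⟨∐ F, Sigma.desc fun i => ofElement M i.1.1 i.1.2, projective_coproduct F,
    hA.boundedBelow_coproduct F k fun i b hb => hA.boundedBelow_corep _ b (hb.trans_le i.2), ?_⟩
  rw [epi_iff]
  intro a x
  by_cases ha : d a < k
  · exact ⟨0, by rw [hM a ha x, map_zero]⟩
  · refine ⟨ev (Sigma.ι F ⟨⟨a, x⟩, not_lt.1 ha⟩) a (el (𝟙 a)), ?_⟩
    rw [← ev_comp, Sigma.ι_desc, ev_ofElement_id]

omit hA in
theorem BoundedBelow.of_mono {k : ℤ} {M N : LinFun K A} (hM : BoundedBelow d k M) (i : N ⟶ M)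
    [Mono i] : BoundedBelow d k N := fun a ha _ =>
  ev_injective i a ((hM a ha _).trans (map_zero _).symm)

omit hA in
theorem BoundedBelow.of_epi {k : ℤ} {M N : LinFun K A} (hM : BoundedBelow d k M) (p : M ⟶ N)
    [Epi p] : BoundedBelow d k N := fun a ha => by
  intro x
  obtain ⟨y, rfl⟩ := ev_surjective p a x
  rw [hM a ha y, map_zero]

/-! ### Projectivity of bounded functors -/

/-- `𝒥` contains enough functors concentrated in one degree: each functor `W` that is concentrated
in the degree of `a` has a morphism to such a functor that is injective at `a`. -/
def HasEnoughConcentrated (d : A → ℤ) (L : A → Prop) (𝒥 : LinFun K A → Prop) : Prop :=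
  ∀ a, L a → ∀ W : LinFun K A, Concentrated d (d a) W →
    ∃ (J : LinFun K A) (η : W ⟶ J), 𝒥 J ∧ Concentrated d (d a) J ∧ Function.Injective (ev η a)

/-- If the morphisms from `N` to the functors in `𝒥` extend along `j`, then so do the morphisms to
functors concentrated in one degree. -/
theorem IsPositive.exists_extension {𝒥 : LinFun K A → Prop}
    (h𝒥 : HasEnoughConcentrated d L 𝒥) {N P : LinFun K A} (j : N ⟶ P)
    (hj : ∀ J, 𝒥 J → ∀ f : N ⟶ J, ∃ g, j ≫ g = f) {k : ℤ} {W : LinFun K A}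
    (hW : Concentrated d k W) (f : N ⟶ W) : ∃ g, j ≫ g = f := by
  -- Elements of `W` are detected at local objects of degree `k`, so `W` embeds in a product of
  -- members of `𝒥`. Positive morphisms kill this product, so `W` is a direct summand, and it
  -- suffices to extend each component.
  have h1 : ∀ a : {a : A // L a ∧ d a = k}, ∃ (J : LinFun K A) (η : W ⟶ J), 𝒥 J ∧
      Concentrated d k J ∧ Function.Injective (ev η a.1) := fun a => by
    obtain ⟨a, ha, rfl⟩ := a
    exact h𝒥 a ha W hW
  choose J η h𝒥' hJ hη using h1
  have : HasProduct J := inferInstance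
  have hV : KilledByPositive d (∏ᶜ J) := by
    intro a b f hab x
    have h2 : ofElement (∏ᶜ J) b (act (∏ᶜ J) f x) = 0 := Pi.hom_ext _ _ fun i => by
      rw [ofElement_comp, zero_comp, ev_act, (hJ i).killed f hab, ofElement_zero]
    rw [← ev_ofElement_id (∏ᶜ J) b (act (∏ᶜ J) f x), h2, ev_zero]
  have hm : Mono (Pi.lift η) := by
    rw [mono_iff]
    intro a
    rw [injective_iff_map_eq_zero]
    intro x hx
    refine hA.mem_of_local (U := (⟨fun _ => ⊥, by
      intro a b f x hx
      rw [(Submodule.mem_bot K).1 hx, map_zero]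
      exact Submodule.zero_mem _⟩ : SubF W)) x fun b f hb hab => ?_
    by_cases hk : d b = k
    · refine (Submodule.mem_bot K).2 (hη ⟨b, hb, hk⟩ ?_)
      rw [ev_act, ← Pi.lift_π η ⟨b, hb, hk⟩, ev_comp, hx, map_zero, map_zero, map_zero]
    · exact (Submodule.mem_bot K).2 (hW b hk _)
  obtain ⟨r, hr⟩ := hA.exists_retraction hV (Pi.lift η)
  choose g hg using fun i => hj (J i) (h𝒥' i) (f ≫ η i)
  refine ⟨Pi.lift g ≫ r, ?_⟩
  have : j ≫ Pi.lift g = f ≫ Pi.lift η := Pi.hom_ext _ _ fun i => by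
    simp [hg]
  rw [← Category.assoc, this, Category.assoc, hr, Category.comp_id]

/-- One step of an approximation: the degree `k` part of the error `δ` is a morphism to the
concentrated functor `N_{≥k}/N_{≥k+1}`. It extends to `P`, and projectivity lifts the extension to
`N_{≥k}`; subtracting it moves the error to degree `k + 1`. -/
theorem IsPositive.exists_extension_step {N P : LinFun K A} [Projective P] (j : N ⟶ P)
    (hj : ∀ (k : ℤ) (W : LinFun K A), Concentrated d k W → ∀ f : N ⟶ W, ∃ g, j ≫ g = f) (k : ℤ)
    (δ : N ⟶ N) (hδ : ∀ a, d a < k → ∀ x, ev δ a x = 0) :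
    ∃ h : P ⟶ N, (∀ a, d a < k → ∀ y, ev h a y = 0) ∧
      ∀ a, d a < k + 1 → ∀ x, ev (δ - j ≫ h) a x = 0 := by
  let T := hA.trunc k N
  let T' := hA.trunc (k + 1) T.fn
  have hT : ∀ a, d a < k → ∀ x : T.fn.obj.obj a, x = 0 := fun a ha x =>
    ev_injective T.ι a ((T.ev_ι_mem x ha).trans (map_zero _).symm)
  have hW : Concentrated d k T'.quot := by
    intro a ha x
    obtain ⟨x, rfl⟩ := ev_surjective T'.π a x
    rw [T'.ev_π_eq_zero]
    intro hk
    exact hT a (by omega) x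
  obtain ⟨δ', hδ'⟩ := exists_lift_of_mono T.ι δ fun a x => ⟨T.mk' _ (fun ha => hδ a ha x), rfl⟩
  obtain ⟨g, hg⟩ := hj k _ hW (δ' ≫ T'.π)
  refine ⟨Projective.factorThru g T'.π ≫ T.ι, fun a ha y => ?_, fun a ha x => ?_⟩
  · rw [ev_comp, hT a ha (ev _ a y), map_zero]
  · have h1 : (δ' - j ≫ Projective.factorThru g T'.π) ≫ T'.π = 0 := by
      rw [Preadditive.sub_comp, Category.assoc, Projective.factorThru_comp, hg, sub_self]
    have h2 : δ - j ≫ Projective.factorThru g T'.π ≫ T.ι =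
        (δ' - j ≫ Projective.factorThru g T'.π) ≫ T.ι := by
      rw [Preadditive.sub_comp, Category.assoc, hδ']
    have h3 : ev (δ' - j ≫ Projective.factorThru g T'.π) a x = 0 :=
      (T'.ev_π_eq_zero _).1 (congrArg (fun t => ev t a x) h1) ha
    rw [h2, ev_comp, h3, map_zero]

/-- If the morphisms from the bounded functor `N` to the functors concentrated in one degree extend
along `j : N ⟶ P`, then `j` splits. -/
theorem IsPositive.exists_retraction_of_extension {N P : LinFun K A} [Projective P] (j : N ⟶ P)
    (hj : ∀ (k : ℤ) (W : LinFun K A), Concentrated d k W → ∀ f : N ⟶ W, ∃ g, j ≫ g = f) {c : ℤ}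
    (hN : BoundedBelow d c N) : ∃ r : P ⟶ N, j ≫ r = 𝟙 N := by
  choose s hs₁ hs₂ using fun k => hA.exists_extension_step j hj k
  -- Successive approximations to a retraction, starting from zero, which is correct below degree
  -- `c` because `N` vanishes there.
  let q : ∀ n : ℕ, {r : P ⟶ N // ∀ a, d a < c + n → ∀ x, ev (𝟙 N - j ≫ r) a x = 0} := fun n =>
    Nat.rec ⟨0, fun a ha x => hN a (by simpa using ha) _⟩
      (fun n r => ⟨r.1 + s (c + n) _ r.2, fun a ha x => by
        rw [Preadditive.comp_add, ← sub_sub]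
        exact hs₂ (c + n) _ r.2 a (by push_cast at ha; omega) x⟩) n
  have hq : ∀ (n : ℕ) a y, d a < c + n → ev (q (n + 1)).1 a y = ev (q n).1 a y := by
    intro n a y ha
    have h1 : (q (n + 1)).1 = (q n).1 + s (c + n) _ (q n).2 := rfl
    rw [h1, ev_add, hs₁ (c + n) _ (q n).2 a ha y, add_zero]
  have hq' : ∀ n m : ℕ, n ≤ m → ∀ a y, d a < c + n → ev (q m).1 a y = ev (q n).1 a y := by
    intro n m hnm
    induction m, hnm using Nat.le_induction with
    | base => exact fun _ _ _ => rfl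
    | succ m hm ih =>
      intro a y ha
      rw [hq m a y (by omega), ih a y ha]
  -- From stage `ν a` on the approximations no longer change at `a`, so their limit is defined
  -- object by object.
  let ν : A → ℕ := fun a => (d a - c + 1).toNat
  have hν : ∀ a, d a < c + ν a := fun a => by
    have := Int.self_le_toNat (d a - c + 1)
    change _ < c + ((d a - c + 1).toNat : ℤ)
    omega
  let r : P ⟶ N := mkHom (fun a => ev (q (ν a)).1 a) fun {a b} f y => by
    by_cases hab : d b < d a
    · rw [hA.act_eq_zero _ f hab, hA.act_eq_zero _ f hab, map_zero]
    · rw [← hq' (ν a) (ν b) (Int.toNat_le_toNat (by omega)) a y (hν a), ev_act]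
  refine ⟨r, hom_ext' fun a x => ?_⟩
  have h1 := (q (ν a)).2 a (hν a) x
  rw [ev_sub, sub_eq_zero] at h1
  exact h1.symm

/-- A bounded functor `M` is projective if `Ext¹(M, J)` vanishes for enough functors `J` concentrated
in one degree. -/
theorem IsPositive.projective {𝒥 : LinFun K A → Prop} (h𝒥 : HasEnoughConcentrated d L 𝒥) {c : ℤ}
    {M : LinFun K A} (hM : BoundedBelow d c M) (h : ∀ J, 𝒥 J → ∀ e : Ext.{u} M J 1, e = 0) :
    Projective M := by
  obtain ⟨P, p, hP, hPc, hp⟩ := hA.exists_cover hM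
  have hS := SubF.shortExact_ker p
  obtain ⟨r, hr⟩ := hA.exists_retraction_of_extension (SubF.ker p).ι
    (fun k W hW f => hA.exists_extension h𝒥 _
      (fun J hJ => (ext_contravariant_one.{u} hS J).2 (h J hJ)) hW f)
    (hPc.of_mono (SubF.ker p).ι)
  obtain ⟨s, hs⟩ := exists_desc_of_epi p (𝟙 P - r ≫ (SubF.ker p).ι) fun a x hx => by
    have h1 := congrArg (fun t => ev t a ((SubF.ker p).mk' x hx)) hr
    have h2 : ev r a x = (SubF.ker p).mk' x hx := h1
    rw [ev_sub, ev_comp, h2, ev_id, sub_eq_zero]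
    rfl
  have h0 : (SubF.ker p).ι ≫ p = 0 := hom_ext' fun a x => (SubF.ker p).ev_ι_mem x
  refine Retract.projective (Y := P) ⟨s, p, ?_⟩
  rw [← cancel_epi p, ← Category.assoc, hs, Preadditive.sub_comp, Category.assoc, h0, comp_zero,
    sub_zero, Category.id_comp, Category.comp_id]

/-- The projective dimension of a bounded functor `M` is at most `m` if `Ext^(m+1)(M, J)` vanishes
for enough functors `J` concentrated in one degree. -/
theorem IsPositive.hasProjectiveDimensionLE {𝒥 : LinFun K A → Prop}
    (h𝒥 : HasEnoughConcentrated d L 𝒥) {c : ℤ} (m : ℕ) {M : LinFun K A}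
    (hM : BoundedBelow d c M) (h : ∀ J, 𝒥 J → ∀ e : Ext.{u} M J (m + 1), e = 0) :
    HasProjectiveDimensionLE M m := by
  induction m generalizing M with
  | zero => exact projective_iff_hasProjectiveDimensionLT_one.1 (hA.projective h𝒥 hM h)
  | succ m ih =>
    obtain ⟨P, p, hP, hPc, hp⟩ := hA.exists_cover hM
    have hS := SubF.shortExact_ker p
    have h1 : HasProjectiveDimensionLE (SubF.ker p).fn m :=
      ih (hPc.of_mono (SubF.ker p).ι) fun J hJ =>
        (ext_contravariant_shift.{u} hS J m).2 (h J hJ)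
    exact hS.hasProjectiveDimensionLT_X₃ (m + 1) h1 inferInstance

/-! ### The simple functors -/

/-- The quotient of `Hom(a, -)` by the morphisms of positive degree. -/
abbrev IsPositive.top (a : A) : LinFun K A := (hA.trunc (d a + 1) (corep a)).quot

theorem IsPositive.boundedBelow_top (a : A) : BoundedBelow d (d a) (hA.top a : LinFun K A) :=
  (hA.boundedBelow_corep a).of_epi (SubF.π _)

theorem IsPositive.concentrated_top (a : A) : Concentrated d (d a) (hA.top a : LinFun K A) := by
  intro b hb x
  obtain ⟨x, rfl⟩ := ev_surjective (hA.trunc (d a + 1) (corep a)).π b x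
  rw [SubF.ev_π_eq_zero]
  exact fun h => hA.boundedBelow_corep a b (by omega) x

/-- A nonzero element is the image of the class of the identity under some `g` of degree zero; a
retraction of `g` returns that generator, so a nonzero subfunctor is everything. -/
theorem IsPositive.simple_top {a : A} (ha : L a) : Simple (hA.top a : LinFun K A) where
  mono_isIso_iff_nonzero {X} f hf := by
    let U := hA.trunc (d a + 1) (corep (K := K) a)
    have hgen : ∀ b (t : (hA.top a : LinFun K A).obj.obj b), ∃ g : a ⟶ b,
        act (hA.top a : LinFun K A) g (ev U.π a (el (𝟙 a))) = t := fun b t => by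
      obtain ⟨g, rfl⟩ := ev_surjective U.π b t
      refine ⟨g, (ev_act U.π g _).symm.trans ?_⟩
      exact congrArg (ev U.π b) (Category.id_comp (X := a) (Y := b) g)
    constructor
    · rintro hf rfl
      obtain ⟨y, hy⟩ := ev_surjective (0 : X ⟶ (hA.top a : LinFun K A)) a (ev U.π a (el (𝟙 a)))
      exact hA.id_ne_zero ha ((U.ev_π_eq_zero _).1 hy.symm (by omega))
    · intro hf0
      obtain ⟨b, x, hx⟩ : ∃ b x, ev f b x ≠ 0 := by
        by_contra! h
        exact hf0 (hom_ext' h)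
      obtain ⟨g, hg⟩ := hgen b (ev f b x)
      have hb : d b = d a := by
        by_contra h
        exact hx (hA.concentrated_top a b h _)
      obtain ⟨r, hr⟩ := hA.split g ha hb.symm fun h => hx (by rw [← hg, h, act_zero])
      have : Epi f := by
        rw [epi_iff]
        intro c t
        obtain ⟨s, rfl⟩ := hgen c t
        refine ⟨act X s (act X r x), ?_⟩
        rw [ev_act, ev_act, ← hg, ← act_comp _ g r, hr, act_id]
      exact isIso_of_mono_of_epi f

/-- The morphisms from `top a` to a functor `F` concentrated in the degree of `a` are given by
elements. -/
theorem IsPositive.exists_hom_top {a : A} {F : LinFun K A} (hF : Concentrated d (d a) F)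
    (x : F.obj.obj a) :
    ∃ f : (hA.top a : LinFun K A) ⟶ F,
      (hA.trunc (d a + 1) (corep a)).π ≫ f = ofElement F a x :=
  exists_desc_of_epi _ _ fun b g hg => by
    rw [SubF.ev_π_eq_zero, hA.mem_trunc] at hg
    by_cases hb : d b = d a
    · rw [hg (by omega), map_zero]
    · exact hF b hb _

end PositiveDegree

section PositivelyGraded

open Abelian

variable {K : Type w} [Field K]

/-! ## Duals of functors concentrated in one degree -/

section Dual

variable {B : Type u} [SmallCategory B] [Preadditive B] [Linear K B] {d : B → ℤ} {L : B → Prop}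

/-- Take `E = W(b)`. The identity of `W(b)`, an element of `dualOp E W`, defines a morphism from the
top at `b`. Its transpose `W → dual E (top b)`, evaluated at the class of the identity of `b`,
returns the given element of `W(b)` and so is injective there. -/
theorem IsPositive.hasEnoughConcentrated_dual (hB : IsPositive d L) :
    HasEnoughConcentrated (A := Bᵒᵖ) (fun a => -d a.unop) (fun a => L a.unop)
      (fun J : LinFun K Bᵒᵖ => ∃ b E, L b ∧ J = dual E (hB.top b)) := by
  intro a ha W hW
  obtain ⟨b, rfl⟩ : ∃ b, a = op b := ⟨a.unop, rfl⟩
  have hc : Concentrated d (d b) (dualOp (W.obj.obj (op b)) W) := fun c hc φ => by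
    refine LinearMap.ext fun x => ?_
    have h1 : x = 0 := hW (op c) (fun h => hc (neg_injective h)) x
    exact (congrArg (dualOp.fn φ) h1).trans (map_zero (dualOp.fn φ))
  obtain ⟨f, hf⟩ := hB.exists_hom_top hc
    (show (dualOp (W.obj.obj (op b)) W).obj.obj b from LinearMap.id)
  refine ⟨_, (dualAdj (W.obj.obj (op b)) W (hB.top b)).symm f, ⟨b, _, ha, rfl⟩, ?_, ?_⟩
  · intro c hc φ
    refine LinearMap.ext fun x => ?_
    have h1 : x = 0 := hB.concentrated_top b c.unop (fun h => hc (congrArg Neg.neg h)) x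
    exact (congrArg (dual.fn φ) h1).trans (map_zero (dual.fn φ))
  · rw [injective_iff_map_eq_zero]
    intro w hw
    have h1 := LinearMap.congr_fun hw (ev (hB.trunc (d b + 1) (corep b)).π b (el (𝟙 b)))
    have h2 := congrArg (fun t => dualOp.fn (ev t b (el (𝟙 b))) w) hf
    have h3 := congrArg (fun t => dualOp.fn t w) (ev_ofElement_id (dualOp (W.obj.obj (op b)) W) b
      (show (dualOp (W.obj.obj (op b)) W).obj.obj b from LinearMap.id))
    exact (h3.symm.trans h2.symm).trans h1

theorem IsPositive.hasEnoughConcentrated_dualOp {d : Bᵒᵖ → ℤ} {L : Bᵒᵖ → Prop}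
    (hA : IsPositive d L) :
    HasEnoughConcentrated (A := B) (fun b => -d (op b)) (fun b => L (op b))
      (fun J : LinFun K B => ∃ a E, L a ∧ J = dualOp E (hA.top a)) := by
  intro b hb W hW
  have hc : Concentrated d (d (op b)) (dual (W.obj.obj b) W) := fun c hc φ => by
    refine LinearMap.ext fun x => ?_
    have h1 : x = 0 := hW c.unop (fun h => hc (neg_injective h)) x
    exact (congrArg (dual.fn φ) h1).trans (map_zero (dual.fn φ))
  obtain ⟨f, hf⟩ := hA.exists_hom_top hc
    (show (dual (W.obj.obj b) W).obj.obj (op b) from LinearMap.id)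
  refine ⟨_, dualAdj (W.obj.obj b) (hA.top (op b)) W f, ⟨op b, _, hb, rfl⟩, ?_, ?_⟩
  · intro c hc φ
    refine LinearMap.ext fun x => ?_
    have h1 : x = 0 := hA.concentrated_top (op b) (op c) (fun h => hc (congrArg Neg.neg h)) x
    exact (congrArg (dualOp.fn φ) h1).trans (map_zero (dualOp.fn φ))
  · rw [injective_iff_map_eq_zero]
    intro w hw
    have h1 := LinearMap.congr_fun hw
      (ev (hA.trunc (d (op b) + 1) (corep (op b))).π (op b) (el (𝟙 (op b))))
    have h2 := congrArg (fun t => dual.fn (ev t (op b) (el (𝟙 (op b)))) w) hf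
    have h3 := congrArg (fun t => dual.fn t w) (ev_ofElement_id (dual (W.obj.obj b) W) (op b)
      (show (dual (W.obj.obj b) W).obj.obj (op b) from LinearMap.id))
    exact (h3.symm.trans h2.symm).trans h1

end Dual

/-! ## The category of shifts of a positively graded category -/

namespace HomGrading

variable {C : Type u} [SmallCategory C] [Preadditive C] [Linear K C] (G : HomGrading K C)

/-- The ring of endomorphisms of degree `0` is local. -/
def IsLocalObj (a : G.Shifted) : Prop := IsLocalRing (End (⟨a.obj, 0⟩ : G.Shifted))

variable {G}

theorem mem_deg_of_eq {X Y : C} {i j : ℤ} {f : X ⟶ Y} (hf : f ∈ G.deg X Y i) (h : i = j) :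
    f ∈ G.deg X Y j := h ▸ hf

/-- An endomorphism of a shift of `X`, as an endomorphism of `X`. -/
def unshiftEnd {a : G.Shifted} (h : a ⟶ a) : End (⟨a.obj, 0⟩ : G.Shifted) :=
  ⟨h.1, mem_deg_of_eq h.2 (by simp)⟩

theorem isIso_of_isUnit_unshiftEnd {a : G.Shifted} {h : a ⟶ a} (hu : IsUnit (unshiftEnd h)) :
    IsIso h := by
  obtain ⟨v, hv₁, hv₂⟩ := isUnit_iff_exists.1 hu
  have h₁ : h.1 ≫ v.1 = 𝟙 a.obj := congrArg Subtype.val hv₂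
  have h₂ : v.1 ≫ h.1 = 𝟙 a.obj := congrArg Subtype.val hv₁
  exact ⟨⟨⟨v.1, mem_deg_of_eq v.2 (by simp)⟩, Subtype.ext h₁, Subtype.ext h₂⟩⟩

/-- An endomorphism of an object with local endomorphism ring is invertible or differs from the
identity by an invertible endomorphism. -/
theorem IsLocalObj.isIso_or_isIso {a : G.Shifted} (ha : G.IsLocalObj a) (h : a ⟶ a) :
    IsIso h ∨ IsIso (𝟙 a - h) := by
  have hlocal : IsLocalRing (End (⟨a.obj, 0⟩ : G.Shifted)) := ha
  have h1 : unshiftEnd h + unshiftEnd (𝟙 a - h) = 1 := Subtype.ext (by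
    change h.1 + (𝟙 a.obj - h.1) = 𝟙 a.obj
    abel)
  exact (hlocal.isUnit_or_isUnit_of_add_one h1).imp isIso_of_isUnit_unshiftEnd
    isIso_of_isUnit_unshiftEnd

/-- If the graded radical is the part of positive degree, then a nonzero morphism of degree `0` is
not in the radical. -/
theorem RadicalEqPositivePart.exists_not_isIso (hG : G.RadicalEqPositivePart) {a b : G.Shifted}
    (f : a ⟶ b) (hab : a.shift = b.shift) (hf : f ≠ 0) : ∃ g : b ⟶ a, ¬ IsIso (𝟙 a - f ≫ g) := by
  -- Otherwise `f` would lie in the degree zero part of the radical, hence in the sum of the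
  -- positive components, which meets degree zero trivially.
  by_contra! h
  have h0 : f.1 ∈ G.deg a.obj b.obj 0 :=
    mem_deg_of_eq f.2 (by rw [hab, sub_self])
  have h1 : f.1 ∈ G.radDeg a.obj b.obj 0 := ⟨h0, fun g hg => by
    let g' : b ⟶ a := ⟨g, mem_deg_of_eq hg (by rw [hab, sub_self, neg_zero])⟩
    have := h g'
    refine ⟨⟨(inv (𝟙 a - f ≫ g')).1, ?_, ?_⟩⟩
    · exact congrArg Subtype.val (IsIso.hom_inv_id (𝟙 a - f ≫ g'))
    · exact congrArg Subtype.val (IsIso.inv_hom_id (𝟙 a - f ≫ g'))⟩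
  have h2 : f.1 ∈ ⨆ i : {i : ℤ // 1 ≤ i}, G.deg a.obj b.obj i := by
    rw [← hG]
    exact Submodule.subset_span (Set.mem_iUnion.2 ⟨0, h1⟩)
  have h3 : (⨆ i : {i : ℤ // 1 ≤ i}, G.deg a.obj b.obj i) ≤ ⨆ j ≠ (0 : ℤ), G.deg a.obj b.obj j :=
    iSup_le fun i => le_iSup₂_of_le i.1 (by have := i.2; omega) le_rfl
  have h4 := (G.isInternal a.obj b.obj).submodule_iSupIndep 0
  exact hf (Subtype.ext ((Submodule.disjoint_def.1 h4) _ h0 (h3 h2)))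

theorem exists_decomposition (hG : G.IsKrullSchmidt) (a : G.Shifted) :
    ∃ (m : ℕ) (Y : Fin m → G.Shifted) (ι : ∀ k, Y k ⟶ a) (π : ∀ k, a ⟶ Y k),
      (∀ k, G.IsLocalObj (Y k) ∧ (Y k).shift = a.shift) ∧ ∑ k, π k ≫ ι k = 𝟙 a := by
  obtain ⟨m, Y, ι, π, hY, -, -, hs⟩ := hG a.obj
  refine ⟨m, fun k => ⟨Y k, a.shift⟩, fun k => ⟨(ι k).1, mem_deg_of_eq (ι k).2 (by simp)⟩,
    fun k => ⟨(π k).1, mem_deg_of_eq (π k).2 (by simp)⟩, fun k => ⟨hY k, rfl⟩, ?_⟩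
  have h1 : ∑ k, (π k).1 ≫ (ι k).1 = 𝟙 a.obj :=
    (map_sum (Submodule.subtype _) (fun k => π k ≫ ι k) Finset.univ).symm.trans
      (congrArg (Submodule.subtype _) hs)
  exact Submodule.subtype_injective _ ((map_sum (Submodule.subtype _) _ _).trans h1)

variable (hpos : G.IsPositivelyGraded) (hks : G.IsKrullSchmidt) (hrad : G.RadicalEqPositivePart)

include hpos hks hrad

/-- For the splitting, some `1 - f ≫ g` is not invertible, so `f ≫ g` is invertible in the local
endomorphism ring of the source. -/
theorem isPositive : IsPositive (fun a : G.Shifted => a.shift) G.IsLocalObj where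
  hom_eq_zero {a b} f h := Subtype.ext
    ((Submodule.mem_bot K).1 ((hpos _ _ (b.shift - a.shift) (sub_neg.2 h)).le f.2))
  id_ne_zero {a} ha h := by
    have : IsLocalRing (End (⟨a.obj, 0⟩ : G.Shifted)) := ha
    have h1 : (𝟙 a : a ⟶ a).1 = 0 := congrArg Subtype.val h
    exact one_ne_zero (α := End (⟨a.obj, 0⟩ : G.Shifted)) (Subtype.ext h1)
  split {a b} f ha hab hf := by
    obtain ⟨g, hg⟩ := hrad.exists_not_isIso f hab hf
    have : IsIso (f ≫ g) := (ha.isIso_or_isIso (f ≫ g)).resolve_right hg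
    exact ⟨g ≫ inv (f ≫ g), by rw [← Category.assoc, IsIso.hom_inv_id]⟩
  decomp := exists_decomposition hks

theorem isPositive_op :
    IsPositive (fun a : G.Shiftedᵒᵖ => -a.unop.shift) (fun a => G.IsLocalObj a.unop) where
  hom_eq_zero f h := Quiver.Hom.unop_inj
    ((isPositive hpos hks hrad).hom_eq_zero f.unop (neg_lt_neg_iff.1 h))
  id_ne_zero {a} ha h := (isPositive hpos hks hrad).id_ne_zero ha (congrArg Quiver.Hom.unop h)
  split {a b} f ha hab hf := by
    obtain ⟨g, hg⟩ := hrad.exists_not_isIso f.unop (neg_injective hab).symm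
      fun h => hf (Quiver.Hom.unop_inj h)
    have : IsIso (g ≫ f.unop) := (ha.isIso_or_isIso (g ≫ f.unop)).resolve_right fun h => hg <| by
      let v := inv (𝟙 _ - g ≫ f.unop)
      have h1 : (𝟙 _ - g ≫ f.unop) ≫ v = 𝟙 _ := IsIso.hom_inv_id _
      have h2 : v ≫ (𝟙 _ - g ≫ f.unop) = 𝟙 _ := IsIso.inv_hom_id _
      rw [Preadditive.sub_comp, Category.id_comp, sub_eq_iff_eq_add] at h1
      rw [Preadditive.comp_sub, Category.comp_id, sub_eq_iff_eq_add] at h2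
      -- In the opposite category the local object is the target of `f.unop`, so the composite in
      -- the other order is needed. Jacobson's identity transfers invertibility: if `v` inverts `1 -
      -- gf`, then `1 + fvg` inverts `1 - fg`.
      refine ⟨⟨𝟙 _ + f.unop ≫ v ≫ g, ?_, ?_⟩⟩
      · have h3 : f.unop ≫ v ≫ g - f.unop ≫ g ≫ f.unop ≫ v ≫ g = f.unop ≫ g := by
          rw [sub_eq_iff_eq_add]
          conv_lhs => rw [h1]
          simp
        simp only [Preadditive.sub_comp, Preadditive.comp_add, Category.id_comp, Category.comp_id,
          Category.assoc]
        rw [h3]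
        simp
      · have h3 : f.unop ≫ v ≫ g - f.unop ≫ v ≫ g ≫ f.unop ≫ g = f.unop ≫ g := by
          rw [sub_eq_iff_eq_add]
          conv_lhs => rw [h2]
          simp
        simp only [Preadditive.comp_sub, Preadditive.add_comp, Category.id_comp, Category.comp_id,
          Category.assoc]
        rw [add_sub_add_comm, h3, sub_add_cancel]
    exact ⟨(inv (g ≫ f.unop) ≫ g).op, Quiver.Hom.unop_inj (by
      change (inv (g ≫ f.unop) ≫ g) ≫ f.unop = 𝟙 _
      rw [Category.assoc, IsIso.inv_hom_id])⟩
  decomp a := by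
    obtain ⟨m, Y, ι, π, hY, hs⟩ := exists_decomposition hks a.unop
    refine ⟨m, fun k => op (Y k), fun k => (π k).op, fun k => (ι k).op,
      fun k => ⟨(hY k).1, congrArg Neg.neg (hY k).2⟩, Quiver.Hom.unop_inj ?_⟩
    rw [unop_sum]
    exact hs

end HomGrading

/-! ## The main theorem -/

theorem FinGen.exists_boundedBelow {A : Type u} [SmallCategory A] [Preadditive A] [Linear K A]
    {d : A → ℤ} {L : A → Prop} (hA : IsPositive d L) {F : LinFun K A} (hF : FinGen F) :
    ∃ c, BoundedBelow d c F := by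
  obtain ⟨m, a, x, hx⟩ := hF.exists_generates
  obtain ⟨c, hc⟩ := (Set.finite_range fun k => d (a k)).bddBelow
  exact ⟨c, fun b hb y => hx (hA.trunc c F) (fun k hk => absurd hk (hc ⟨k, rfl⟩).not_gt) b y hb⟩

variable {C : Type u} [SmallCategory C] [Preadditive C] [Linear K C] {G : HomGrading K C}

theorem HomGrading.IsGeneralizedASRegular.hasProjectiveDimensionLT
    (hreg : G.IsGeneralizedASRegular 2) (Z : G.Gr) : HasProjectiveDimensionLT Z 3 :=
  (projectiveDimension_le_iff Z 2).1
    ((le_iSup projectiveDimension Z).trans hreg.globalDimension_eq.le)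

theorem SimpleInH.finPres {A : Type u} [SmallCategory A] [Preadditive A] [Linear K A] {n : ℕ}
    {S : LinFun K A} (hS : SimpleInH n S) : FinPres S := by
  obtain ⟨P, p, _, hP, _, hk⟩ := hS.2.finPres_syzygy
  exact finPres_of_cover hP p hk.finGen

/-- The quotient of a finitely presented functor by its torsion subfunctor has projective dimension
at most one. -/
theorem HomGrading.IsGeneralizedASRegular.hasProjectiveDimensionLE_quot
    (hreg : G.IsGeneralizedASRegular 2) (hpos : G.IsPositivelyGraded)
    (hrad : G.RadicalEqPositivePart) {F : G.Gr} (hF : FinGen F) :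
    HasProjectiveDimensionLE (torsionSub (Q := SimpleInH 2) (fun _ h => h.1) F).quot 1 := by
  have hB := HomGrading.isPositive hpos hreg.krullSchmidt hrad
  have hA := HomGrading.isPositive_op hpos hreg.krullSchmidt hrad
  have hgl := hreg.hasProjectiveDimensionLT
  obtain ⟨c, hc⟩ := hF.exists_boundedBelow hA
  -- The global dimension is bounded on one side only. The tops on the other side are tested against
  -- duals of tops, and duality moves `Ext³` back to the side where it vanishes.
  have hT : ∀ b : G.Shifted, HasProjectiveDimensionLE (hB.top b : G.GrOp) 2 := fun b => by
    have h𝒥 := hA.hasEnoughConcentrated_dualOp (K := K)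
    simp only [neg_neg] at h𝒥
    refine hB.hasProjectiveDimensionLE h𝒥 2 (hB.boundedBelow_top b) ?_
    rintro _ ⟨a, E, ha, rfl⟩
    refine (ext_dual_eq_zero_iff E _ 2 _).1 fun e => ?_
    have := hgl (hA.top a)
    exact Ext.eq_zero_of_hasProjectiveDimensionLT e 3 le_rfl
  refine hA.hasProjectiveDimensionLE hB.hasEnoughConcentrated_dual 1 (hc.of_epi (SubF.π _)) ?_
  rintro _ ⟨b, E, hb, rfl⟩
  refine (ext_dual_eq_zero_iff E _ 1 _).2 fun e => ?_
  have hsimple : Simple (hB.top b : G.GrOp) := hB.simple_top hb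
  -- The regularity condition concerns only simple functors of projective dimension exactly two;
  -- below that `Ext²` vanishes anyway.
  by_cases h1 : HasProjectiveDimensionLE (hB.top b : G.GrOp) 1
  · exact Ext.eq_zero_of_hasProjectiveDimensionLT e 2 le_rfl
  · have h2 : projectiveDimension (hB.top b : G.GrOp) = (2 : ℕ) :=
      le_antisymm ((projectiveDimension_le_iff _ 2).2 (hT b)) ((projectiveDimension_ge_iff _ 2).2 h1)
    obtain ⟨hT₂, T', hT'⟩ := hreg.simples_op _ hsimple h2
    exact ext_two_simple_eq_zero E hT₂ hT'.2 T'.arrow hgl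
      (fun f => hom_quot_torsionSub_eq_zero _ hT' hT'.finPres f) e

end PositivelyGraded

end

end GradedAS

theorem mainTheorem7 {K : Type w} [Field K] {C : Type u} [SmallCategory C] [Preadditive C]
    [Linear K C] (G : GradedAS.HomGrading K C)
    (hpos : G.IsPositivelyGraded) (hfin : G.IsLocallyFinite)
    (hgen : G.IsGeneratedInDegreesZeroOne) (hreg : G.IsGeneralizedASRegular 2) :
    (∀ F : G.Gr, GradedAS.FinPres F →
      GradedAS.FiniteLength (GradedAS.torsion 2 F : G.Gr)) ∧
    GradedAS.IsCoherentCat K G.Shiftedᵒᵖ ∧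
    Nonempty (Abelian (GradedAS.FinPres : ObjectProperty G.Gr).FullSubcategory) := by
  have hQ : ∀ S : G.Gr, GradedAS.SimpleInH 2 S → Simple S := fun _ h => h.1
  have hQ₀ : ∀ S : G.Gr, GradedAS.SimpleInH 2 S → ∀ a (f : S ⟶ GradedAS.corep a), f = 0 :=
    fun S hS a f => hS.2.hom_eq_zero (by decide) a f
  -- A finitely generated torsion part lies in one of the filtered subfunctors whose union it is, so
  -- it has finite length.
  suffices h : (∀ F : G.Gr, GradedAS.FinPres F → GradedAS.FinGen (GradedAS.torsionSub hQ F).fn) ∧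
      GradedAS.IsCoherentCat K G.Shiftedᵒᵖ from
    ⟨fun F hF => by
      rw [GradedAS.torsion_eq]
      exact ((GradedAS.finiteFiltration_torsionSub hQ (h.1 F hF)).mono hQ).of_iso
        (Subobject.underlyingIso _).symm, h.2, GradedAS.abelian_finPres h.2⟩
  rcases hreg.noetherian_or_radical with hN | ⟨-, hrad⟩
  · exact ⟨fun F hF => hN.finGen_subF hF.finGen _, hN.isCoherentCat⟩
  · have hpd : ∀ F : G.Gr, GradedAS.FinPres F →
        HasProjectiveDimensionLE (GradedAS.torsionSub hQ F).quot 1 :=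
      fun F hF => hreg.hasProjectiveDimensionLE_quot hpos hrad hF.finGen
    refine ⟨fun F hF => ?_, GradedAS.isCoherentCat_of_torsionSub hQ hQ₀
      (fun S hS => hS.2.finPres_syzygy) hpd⟩
    have := hpd F hF
    exact GradedAS.finGen_torsionSub hQ hQ₀ hF
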